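/- **Setting.** Algorithms are randomized programs for a random-access machine with registers and arrays of natural numbers; one time step is one instruction (constants, addition, truncated subtraction, halving, indirect load/store, a fair coin flip, branching and loops on a register being nonzero, or one oracle call). "Running in time $O(t(n))$" means that there is $T$ with $T(n)=O(t(n))$ as $n\to\infty$ such that on every instance of parameter $n$, and for every outcome of the random choices, the program halts within $T(n)$ steps. Logarithms are to base $2$. *Linear-3-RL.* An instance of feature dimension $d$ is a deterministic MDP with $3$ actions: states including a starting state $s_0$ and an absorbing, reward-free end state $\bot$, a deterministic transition function $P(s,a)$, random rewards $R(s,a)$ in $[0,1]$, and a horizon $H=O(d)$ such that every trajectory reaches $\bot$ within $H$ actions; together with features $\psi(s),\psi(s,a)\in\mathbb{Q}^d$ such that for some $\theta\in\mathbb{R}^d$ we have $V^*(s)=\langle\theta,\psi(s)\rangle$ and $Q^*(s,a)=\langle\theta,\psi(s,a)\rangle$ for all $s,a$, where $V^*=\sup_\pi V^\pi$, $Q^*=\sup_\pi Q^\pi$ over deterministic stationary policies, and $V^\pi, Q^\pi$ are the expected total rewards until $\bot$ is reached. State codes, rewards and feature coordinates are (pairs of) binary numbers of length polynomial in $d$.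 Precisely, fix integers $K,b\ge 1$ and require $H\le Kd$ and that all these numbers have at most $d^b+b$ bits. The algorithm is given $d$, $H$ and $s_0$ and may, at unit cost per call, sample $R(s,a)$ and query $P(s,a)$, $\psi(s)$ and $\psi(s,a)$ for any $s,a$. It outputs a sequence of actions, and solves the problem with error probability $p$ if, with probability at least $1-p$, these are the actions taken from $s_0$ by a policy $\pi$ with $V^\pi(s_0)>V^*(s_0)-1/4$. *Unique-3-SAT.* An instance is a 3-CNF formula with $v$ variables and $O(v)$ clauses (each of three, not necessarily distinct, literals) that has at most one satisfying assignment. An algorithm without oracle solves it with error probability $p$ in time $O(t(v))$ if it answers YES with probability at least $1-p$ on satisfiable instances and NO with probability $1$ on unsatisfiable ones, and if for every constant $C$ it runs in time $O(t(v))$ on the instances with at most $Cv$ clauses. **Proposition.** There is an absolute constant $A>0$ such that the following holds for all real $m\ge 0$ and $q\ge 1$ and all integers $K,b\ge 1$. If Linear-3-RL with feature dimension $d$ (with the bounds given by $K$ and $b$) can be solved in time $O\big(d^{\,q(\log d)^{m/(m+2)}}\big)$ with error probability $1/10$, then Unique-3-SAT with $v$ variables can be solved in time $O\big(v^{\,A\cdot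 16^{m+2}q^{m+2}(\log v)^m}\big)$ with error probability $1/8$. -/

import Mathlib

open Asymptotics Filter

/-! ### Randomized random-access programs with a step count -/

/-- The memory of a random-access machine: registers `reg x`, and arrays `arr a` whose cells
`arr a i` are addressed by arbitrary words `i`. Words are natural numbers. -/
structure Mem where
  reg : ℕ → ℕ
  arr : ℕ → ℕ → ℕ

/-- Overwrite one register. -/
def Mem.setReg (μ : Mem) (x n : ℕ) : Mem :=
  { μ with reg := Function.update μ.reg x n }

/-- Overwrite one array. -/
def Mem.setArr (μ : Mem) (a : ℕ) (f : ℕ → ℕ) : Mem :=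
  { μ with arr := Function.update μ.arr a f }

/-- Programs of a randomized random-access machine, with oracle instructions from `Q`.
The arithmetic is addition, truncated subtraction and halving (there is no multiplication, so that
counting one step per instruction is a legitimate measure of time). Register numbers, array names
and numerals are fixed in the program text; array cells are addressed indirectly. -/
inductive Cmd (Q : Type) : Type
  | skip : Cmd Q
  | const (x n : ℕ) : Cmd Q
  | add (x y z : ℕ) : Cmd Q
  | sub (x y z : ℕ) : Cmd Q
  | half (x y : ℕ) : Cmd Q
  | load (x a i : ℕ) : Cmd Q
  | store (a i x : ℕ) : Cmd Q
  | flip (x : ℕ) : Cmd Q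
  | call (o : Q) : Cmd Q
  | seq (c₁ c₂ : Cmd Q) : Cmd Q
  | ite (x : ℕ) (c₁ c₂ : Cmd Q) : Cmd Q
  | while (x : ℕ) (c : Cmd Q) : Cmd Q

/-- A configuration: the stack of commands still to be executed, and the memory. The machine has
halted when the stack is empty. -/
abbrev Config (Q : Type) : Type := List (Cmd Q) × Mem

/-- One step of the machine, as a probability distribution on the next configuration.
`ans o μ` is the (random) effect of the oracle instruction `o` on the memory `μ`. -/
noncomputable def step {Q : Type} (ans : Q → Mem → PMF Mem) : Config Q → PMF (Config Q)
  | ([], μ) => PMF.pure ([], μ)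
  | (.skip :: k, μ) => PMF.pure (k, μ)
  | (.const x n :: k, μ) => PMF.pure (k, μ.setReg x n)
  | (.add x y z :: k, μ) => PMF.pure (k, μ.setReg x (μ.reg y + μ.reg z))
  | (.sub x y z :: k, μ) => PMF.pure (k, μ.setReg x (μ.reg y - μ.reg z))
  | (.half x y :: k, μ) => PMF.pure (k, μ.setReg x (μ.reg y / 2))
  | (.load x a i :: k, μ) => PMF.pure (k, μ.setReg x (μ.arr a (μ.reg i)))
  | (.store a i x :: k, μ) =>
      PMF.pure (k, μ.setArr a (Function.update (μ.arr a) (μ.reg i) (μ.reg x)))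
  | (.flip x :: k, μ) =>
      (PMF.uniformOfFintype Bool).map fun β => (k, μ.setReg x β.toNat)
  | (.call o :: k, μ) => (ans o μ).map fun μ' => (k, μ')
  | (.seq c₁ c₂ :: k, μ) => PMF.pure (c₁ :: c₂ :: k, μ)
  | (.ite x c₁ c₂ :: k, μ) => PMF.pure (if μ.reg x ≠ 0 then (c₁ :: k, μ) else (c₂ :: k, μ))
  | (.while x c :: k, μ) =>
      PMF.pure (if μ.reg x ≠ 0 then (c :: .while x c :: k, μ) else (k, μ))

/-- The distribution of the configuration after `n` steps. -/
noncomputable def runFor {Q : Type} (ans : Q → Mem → PMF Mem) : ℕ → Config Q → PMF (Config Q)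
  | 0, c => PMF.pure c
  | n + 1, c => (step ans c).bind (runFor ans n)

/-- Whatever the random choices, the program started on memory `μ` halts within `n` steps. -/
def HaltsWithin {Q : Type} (ans : Q → Mem → PMF Mem) (A : Cmd Q) (μ : Mem) (n : ℕ) : Prop :=
  ∀ c ∈ (runFor ans n ([A], μ)).support, c.1 = []

/-- The probability that the memory lies in `E` after `n` steps. -/
noncomputable def probAfter {Q : Type} (ans : Q → Mem → PMF Mem) (A : Cmd Q) (μ : Mem) (n : ℕ)
    (E : Set Mem) : ℝ :=
  ((runFor ans n ([A], μ)).toOuterMeasure {c | c.2 ∈ E}).toReal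

/-! ### Deterministic Markov decision processes with features -/

/-- A deterministic MDP with `k` actions, end state `bot`, horizon `horizon`, and `d`-dimensional
features `featV s = ψ(s)`, `featQ s a = ψ(s, a)`. Transitions are deterministic, rewards are random
in `[0, 1]`. States are written down through the injective encoding `code`, the end state as `0`.
Every trajectory reaches `bot` after at most `horizon` actions, and nothing happens after that. -/
structure DetMDP (k d : ℕ) where
  State : Type
  code : State → ℕ
  code_injective : Function.Injective code
  bot : State
  code_bot : code bot = 0
  start : State
  trans : State → Fin k → State
  trans_bot : ∀ a, trans bot a = bot
  reward : State → Fin k → PMF ℚ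
  reward_mem : ∀ s a, ∀ x ∈ (reward s a).support, 0 ≤ x ∧ x ≤ 1
  reward_bot : ∀ a, reward bot a = PMF.pure 0
  horizon : ℕ
  trans_horizon : ∀ (s : State) (a : ℕ → Fin k),
    Nat.rec (motive := fun _ => State) s (fun t s' => trans s' (a t)) horizon = bot
  featV : State → Fin d → ℚ
  featQ : State → Fin k → Fin d → ℚ

namespace DetMDP

variable {k d : ℕ} (M : DetMDP k d)

/-- The state reached from `s` after the first `t` actions of the sequence `a`. -/
def path (s : M.State) (a : ℕ → Fin k) (t : ℕ) : M.State :=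
  Nat.rec (motive := fun _ => M.State) s (fun t s' => M.trans s' (a t)) t

/-- The state reached from `s` after following the stationary policy `π` for `t` steps. -/
def traj (π : M.State → Fin k) (s : M.State) (t : ℕ) : M.State :=
  (fun s' => M.trans s' (π s'))^[t] s

/-- The expected reward of action `a` in state `s`. -/
noncomputable def meanReward (s : M.State) (a : Fin k) : ℝ :=
  ∑' x : ℚ, (M.reward s a x).toReal * (x : ℝ)

/-- `V^π(s)`: the expected total reward collected from `s` under `π` until the end state is reached.
(The end state is reached within `horizon` steps and pays nothing, so that the sum may run over
all `t < horizon`.) -/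
noncomputable def V (π : M.State → Fin k) (s : M.State) : ℝ :=
  ∑ t ∈ Finset.range M.horizon, M.meanReward (M.traj π s t) (π (M.traj π s t))

/-- `Q^π(s, a)`: take action `a` in state `s`, then follow `π`. -/
noncomputable def Q (π : M.State → Fin k) (s : M.State) (a : Fin k) : ℝ :=
  M.meanReward s a + M.V π (M.trans s a)

/-- `V^*(s)`. -/
noncomputable def Vstar (s : M.State) : ℝ := ⨆ π : M.State → Fin k, M.V π s

/-- `Q^*(s, a)`. -/
noncomputable def Qstar (s : M.State) (a : Fin k) : ℝ := ⨆ π : M.State → Fin k, M.Q π s a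

/-- The optimal value functions are linear in the features, with a common parameter `θ`. -/
def LinearOptimalValues : Prop :=
  ∃ θ : Fin d → ℝ,
    (∀ s, M.Vstar s = ∑ i, θ i * (M.featV s i : ℝ)) ∧
    (∀ s a, M.Qstar s a = ∑ i, θ i * (M.featQ s a i : ℝ))

/-- The horizon is at most `K * d`, and every number exchanged with the oracle (state code, reward,
feature coordinate) has at most `d ^ b + b` bits (in numerator and denominator). -/
def SizeBounded (K b : ℕ) : Prop :=
  M.horizon ≤ K * d ∧
  (∀ s, (M.code s).size ≤ d ^ b + b) ∧
  (∀ s a, ∀ x ∈ (M.reward s a).support,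
    x.num.natAbs.size ≤ d ^ b + b ∧ x.den.size ≤ d ^ b + b) ∧
  (∀ s i, (M.featV s i).num.natAbs.size ≤ d ^ b + b ∧ (M.featV s i).den.size ≤ d ^ b + b) ∧
  (∀ s a i, (M.featQ s a i).num.natAbs.size ≤ d ^ b + b ∧
    (M.featQ s a i).den.size ≤ d ^ b + b)

open Classical in
/-- The state with a given code; words that encode no state are read as the end state. -/
noncomputable def decode (n : ℕ) : M.State :=
  if h : ∃ s, M.code s = n then h.choose else M.bot

end DetMDP

/-! ### Access to the MDP -/

/-- The oracle instructions: sample a reward, make a transition, read `ψ(s)`, read `ψ(s, a)`.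
The arguments `s` and `a` are the registers holding the state and the action, the other
arguments say where the answer goes. -/
inductive RLQuery : Type
  | reward (num den s a : ℕ) : RLQuery
  | trans (x s a : ℕ) : RLQuery
  | featV (r s : ℕ) : RLQuery
  | featQ (r s a : ℕ) : RLQuery

/-- Write a rational vector into cells `0, …, 3 * d - 1` of an array: cells `3 * i`, `3 * i + 1`,
`3 * i + 2` receive the sign (`1` for negative), the absolute value of the numerator and the
denominator of coordinate `i`. The other cells keep their content. -/
def writeVec {d : ℕ} (u : Fin d → ℚ) (old : ℕ → ℕ) : ℕ → ℕ := fun j =>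
  if h : j / 3 < d then
    if j % 3 = 0 then (if u ⟨j / 3, h⟩ < 0 then 1 else 0)
    else if j % 3 = 1 then (u ⟨j / 3, h⟩).num.natAbs
    else (u ⟨j / 3, h⟩).den
  else old j

/-- The answers of the MDP oracle. A word `n` stands for the action `n mod k`. -/
noncomputable def mdpAnswer {k d : ℕ} [NeZero k] (M : DetMDP k d) : RLQuery → Mem → PMF Mem
  | .reward num den s a, μ =>
      (M.reward (M.decode (μ.reg s)) (Fin.ofNat k (μ.reg a))).map fun x =>
        (μ.setReg num x.num.natAbs).setReg den x.den
  | .trans x s a, μ =>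
      PMF.pure (μ.setReg x (M.code (M.trans (M.decode (μ.reg s)) (Fin.ofNat k (μ.reg a)))))
  | .featV r s, μ =>
      PMF.pure (μ.setArr r (writeVec (M.featV (M.decode (μ.reg s))) (μ.arr r)))
  | .featQ r s a, μ =>
      PMF.pure (μ.setArr r
        (writeVec (M.featQ (M.decode (μ.reg s)) (Fin.ofNat k (μ.reg a))) (μ.arr r)))

/-- At the beginning the learner knows the feature dimension, the horizon and the starting state. -/
def rlInput {k d : ℕ} (M : DetMDP k d) : Mem where
  reg x := if x = 0 then d else if x = 1 then M.horizon else if x = 2 then M.code M.start else 0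
  arr _ _ := 0

/-- A policy is output as a sequence of actions, in array `0`. -/
def outputActions (k : ℕ) [NeZero k] (μ : Mem) (t : ℕ) : Fin k := Fin.ofNat k (μ.arr 0 t)

/-- The action sequence `a` is the one that some policy `π` with `V^π > V^* - 1/4` takes from the
starting state (until the end state is reached). -/
def DetMDP.GoodActions {k d : ℕ} (M : DetMDP k d) (a : ℕ → Fin k) : Prop :=
  ∃ π : M.State → Fin k,
    (∀ t, M.path M.start a t ≠ M.bot → π (M.path M.start a t) = a t) ∧
    M.Vstar M.start - 1 / 4 < M.V π M.start

/-- `Linear-k-RL` (with horizon at most `K * d` and numbers of at most `d ^ b + b` bits) can be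
solved in time `O(t(d))` with error probability `p`. -/
def LinearRLSolvable (k : ℕ) [NeZero k] (K b : ℕ) (t : ℕ → ℝ) (p : ℝ) : Prop :=
  ∃ (A : Cmd RLQuery) (T : ℕ → ℕ), (fun d => (T d : ℝ)) =O[atTop] t ∧
    ∀ (d : ℕ) (M : DetMDP k d), M.LinearOptimalValues → M.SizeBounded K b →
      HaltsWithin (mdpAnswer M) A (rlInput M) (T d) ∧
      1 - p ≤ probAfter (mdpAnswer M) A (rlInput M) (T d)
        {μ | M.GoodActions (outputActions k μ)}

/-! ### Unique-3-SAT -/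

/-- A clause on `v` variables: three literals, each a variable with the value that makes it true. -/
abbrev Clause3 (v : ℕ) : Type := Fin 3 → Fin v × Bool

/-- A 3-CNF formula on `v` variables. -/
abbrev CNF3 (v : ℕ) : Type := List (Clause3 v)

/-- The assignment `w` satisfies `φ`. -/
def CNF3.Satisfies {v : ℕ} (φ : CNF3 v) (w : Fin v → Bool) : Prop :=
  ∀ c ∈ φ, ∃ j, w (c j).1 = (c j).2

/-- The input of a SAT algorithm: the number of variables, the number of clauses, and in array `0`
the literals one after the other, variable `i` as `2 * i + 1` and its negation as `2 * i`. -/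
def satInput {v : ℕ} (φ : CNF3 v) : Mem where
  reg x := if x = 0 then v else if x = 1 then φ.length else 0
  arr a n :=
    if a = 0 then
      match φ[n / 3]? with
      | some c => 2 * (c (Fin.ofNat 3 n)).1.val + (c (Fin.ofNat 3 n)).2.toNat
      | none => 0
    else 0

/-- The answers NO and YES: register `0` is zero, or not. -/
def saysNo : Set Mem := {μ | μ.reg 0 = 0}

/-- The answer YES. -/
def saysYes : Set Mem := {μ | μ.reg 0 ≠ 0}

/-- `Unique-3-SAT` can be solved in time `O(t(v))` with (one-sided) error probability `p`: one
oracle-free program, on formulas that are promised to have at most one satisfying assignment,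
and whose running time is `O(t(v))` on formulas with `O(v)` clauses. -/
def UniqueThreeSATSolvable (t : ℕ → ℝ) (p : ℝ) : Prop :=
  ∃ A : Cmd Empty, ∀ C : ℕ, ∃ T : ℕ → ℕ, (fun v => (T v : ℝ)) =O[atTop] t ∧
    ∀ (v : ℕ) (φ : CNF3 v), φ.length ≤ C * v → {w | φ.Satisfies w}.Subsingleton →
      HaltsWithin (fun o _ => o.elim) A (satInput φ) (T v) ∧
      ((∃ w, φ.Satisfies w) →
        1 - p ≤ probAfter (fun o _ => o.elim) A (satInput φ) (T v) saysYes) ∧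
      ((¬ ∃ w, φ.Satisfies w) →
        probAfter (fun o _ => o.elim) A (satInput φ) (T v) saysNo = 1)

open scoped ENNReal NNReal


/-! A satisfying assignment is hidden in an MDP whose optimal values are powers of a linear
function. For a formula with `v` variables and a parameter `r`, a state is a level `l` below `d =
(v+2)^r` together with an assignment `w`. In a state that is neither satisfying nor on the last
level, an action flips the variable of one literal of a certain violated clause and raises the level
by one. In the other states the process ends with a coin-flip reward of mean `((N - l - dist(w, w*))
/ N)^r`, where `w*` is a satisfying assignment and `N = d + v`. A clause violated by `w` contains a
literal on which `w` and `w*` disagree, so some action keeps `l + dist(w, w*)` constant, and no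
action within the process lowers it. Hence the same expression is the optimal value in every state
(`satMDP_optimal`). Its base is an inner product of vectors of dimension `v+2`, so the power is an
inner product of `r`-th tensor powers, which have dimension `d`. The feature side of this product
does not involve `w*` (`sum_treeProd`, `exists_goalProb_linear`).

The starting state is worth at least `3/4`, while the last level pays at most `(v+2)^(-r(r-1))`. So
nearly optimal actions pass through a satisfying assignment (`exists_isSolved_of_goodActions`).
Moreover the oracle can be imitated from the formula alone, with reward `0` throughout: a reward or
transition query in a satisfying state reveals a solution at once, and elsewhere the answer `0` is
almost surely right. With a budget of `S = (v+2)^(r(r-1)/2)` steps, every answer has the correct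
probability up to a factor `a = (1 - S^(-2))^(-1)`, and `a^S ≤ 5/4`. So a run that stays within the
budget fails with probability at most `5/4 * 1/10 = 1/8` (`den_expect_le`, `runStage_failure_le`).

For `R ≥ (4q)^((m+2)/2) (log (v+2))^(m/2)`, the assumed running time at `d = (v+2)^R` is at most a
constant times `(v+2)^(R^2/4)`, which is below `S` for `r = R` (`lt_stageBudget_of_le`). The program
does not know `R`, so it tries `r = 8, 9, ...`. A run that exhausts its budget starts the next
stage, and `r` halted runs without a solution in stage `r` lead to the answer NO. The error
probabilities of the stages form a geometric series (`one_sub_errorBound_le`). The answer YES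
requires a satisfying assignment to have been seen, so it is never wrong. All stages up to `R`
together take time `(v+2)^(O(R^2))`, and `R^2` is of the order `(4q)^(m+2) (log v)^m`.

The programs are linked by `comp_simulates`, which compares the compiled program with a budgeted
semantics of the given one. Only lower bounds for expectations over halted runs are transferred: the
function `1` yields halting, and indicator functions yield the two answers. -/

/-! ### Expectations -/

/-- The expectation of a nonnegative function. -/
noncomputable def PMF.expect {α : Type*} (p : PMF α) (f : α → ℝ≥0∞) : ℝ≥0∞ := ∑' a, p a * f a

namespace PMF

variable {α β : Type*}

@[simp] theorem expect_pure (a : α) (f : α → ℝ≥0∞) : (PMF.pure a).expect f = f a := by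
  classical
  unfold expect
  rw [tsum_eq_single a]
  · simp
  · intro b hb
    simp [hb]

theorem expect_bind (p : PMF α) (q : α → PMF β) (f : β → ℝ≥0∞) :
    (p.bind q).expect f = p.expect fun a => (q a).expect f := by
  unfold expect
  simp only [PMF.bind_apply, ← ENNReal.tsum_mul_right, ← ENNReal.tsum_mul_left]
  rw [ENNReal.tsum_comm]
  simp only [mul_assoc]

theorem expect_map (p : PMF α) (g : α → β) (f : β → ℝ≥0∞) :
    (p.map g).expect f = p.expect fun a => f (g a) := by
  rw [← PMF.bind_pure_comp, expect_bind]
  simp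

theorem expect_mono_support {p : PMF α} {f g : α → ℝ≥0∞} (h : ∀ a ∈ p.support, f a ≤ g a) :
    p.expect f ≤ p.expect g := by
  refine ENNReal.tsum_le_tsum fun a => ?_
  by_cases ha : p a = 0
  · simp [ha]
  · gcongr
    exact h a ((PMF.mem_support_iff _ _).2 ha)

theorem expect_mono {p : PMF α} {f g : α → ℝ≥0∞} (h : ∀ a, f a ≤ g a) :
    p.expect f ≤ p.expect g :=
  expect_mono_support fun a _ => h a

@[simp] theorem expect_const (p : PMF α) (c : ℝ≥0∞) : (p.expect fun _ => c) = c := by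
  unfold expect
  rw [ENNReal.tsum_mul_right, PMF.tsum_coe, one_mul]

theorem expect_mul_left (p : PMF α) (c : ℝ≥0∞) (f : α → ℝ≥0∞) :
    (p.expect fun a => c * f a) = c * p.expect f := by
  unfold expect
  rw [← ENNReal.tsum_mul_left]
  exact tsum_congr fun a => by ring

theorem expect_add (p : PMF α) (f g : α → ℝ≥0∞) :
    (p.expect fun a => f a + g a) = p.expect f + p.expect g := by
  unfold expect
  rw [← ENNReal.tsum_add]
  exact tsum_congr fun a => by ring

theorem mul_le_expect (p : PMF α) (f : α → ℝ≥0∞) (a : α) : p a * f a ≤ p.expect f :=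
  ENNReal.le_tsum a

theorem one_le_expect {p : PMF α} {f : α → ℝ≥0∞} (h : ∀ a ∈ p.support, 1 ≤ f a) :
    1 ≤ p.expect f := by
  calc (1 : ℝ≥0∞) = p.expect fun _ => 1 := by simp
    _ ≤ p.expect f := expect_mono_support h

theorem expect_uniform_bool (f : Bool → ℝ≥0∞) :
    (PMF.uniformOfFintype Bool).expect f = 2⁻¹ * f true + 2⁻¹ * f false := by
  unfold expect
  rw [tsum_fintype]
  simp

end PMF

/-! ### Expected values on halted runs -/

section Halting

variable {Q : Type} (ans : Q → Mem → PMF Mem)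

open Classical in
/-- The expectation of `f` over those runs which have halted after `n` steps. -/
noncomputable def haltVal (n : ℕ) (c : Config Q) (f : Mem → ℝ≥0∞) : ℝ≥0∞ :=
  (runFor ans n c).expect fun c' => if c'.1 = [] then f c'.2 else 0

@[simp] theorem haltVal_zero_nil (μ : Mem) (f : Mem → ℝ≥0∞) :
    haltVal ans 0 ([], μ) f = f μ := by
  simp [haltVal, runFor]

theorem haltVal_succ (n : ℕ) (c : Config Q) (f : Mem → ℝ≥0∞) :
    haltVal ans (n + 1) c f = (step ans c).expect fun c' => haltVal ans n c' f := by
  simp [haltVal, runFor, PMF.expect_bind]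

@[simp] theorem haltVal_nil (n : ℕ) (μ : Mem) (f : Mem → ℝ≥0∞) :
    haltVal ans n ([], μ) f = f μ := by
  induction n with
  | zero => simp
  | succ n ih => rw [haltVal_succ]; simp [step, ih]

/-- A halted configuration does not move any more, so halted runs keep their contribution. -/
theorem haltVal_le_succ (n : ℕ) (c : Config Q) (f : Mem → ℝ≥0∞) :
    haltVal ans n c f ≤ haltVal ans (n + 1) c f := by
  induction n generalizing c with
  | zero =>
    obtain ⟨k, μ⟩ := c
    cases k with
    | nil => simp
    | cons a k => simp [haltVal, runFor]
  | succ n ih =>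
    rw [haltVal_succ, haltVal_succ ans (n + 1)]
    exact PMF.expect_mono fun c' => ih c'

theorem haltVal_mono {m n : ℕ} (h : m ≤ n) (c : Config Q) (f : Mem → ℝ≥0∞) :
    haltVal ans m c f ≤ haltVal ans n c f :=
  monotone_nat_of_le_succ (fun n => haltVal_le_succ ans n c f) h

theorem runFor_add (m n : ℕ) (c : Config Q) :
    runFor ans (m + n) c = (runFor ans m c).bind (runFor ans n) := by
  induction m generalizing c with
  | zero => simp [runFor]
  | succ m ih =>
    rw [Nat.succ_add]
    simp only [runFor, PMF.bind_bind]
    congr 1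
    funext c'
    exact ih c'

theorem haltVal_add_of_pure {m n : ℕ} {c c' : Config Q} (h : runFor ans m c = PMF.pure c')
    (f : Mem → ℝ≥0∞) : haltVal ans (m + n) c f = haltVal ans n c' f := by
  simp [haltVal, runFor_add, h]

/-- A configuration of positive probability that has not halted would push the halted mass below
`1`. This turns a lower bound on `haltVal` into halting for every outcome of the coins. -/
theorem haltsWithin_of_one_le {A : Cmd Q} {μ : Mem} {n : ℕ}
    (h : 1 ≤ haltVal ans n ([A], μ) fun _ => 1) : HaltsWithin ans A μ n := by
  classical
  intro c hc
  by_contra hne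
  have h1 : (runFor ans n ([A], μ)).expect (fun c' => if c'.1 = [] then 1 else 0)
      + (runFor ans n ([A], μ)) c ≤ 1 := by
    calc _ ≤ (runFor ans n ([A], μ)).expect (fun c' => if c'.1 = [] then 1 else 0)
          + (runFor ans n ([A], μ)).expect (fun c' => if c'.1 = [] then 0 else 1) := by
          gcongr
          have := PMF.mul_le_expect (runFor ans n ([A], μ))
            (fun c' => if c'.1 = [] then 0 else 1) c
          simpa [hne] using this
      _ = (runFor ans n ([A], μ)).expect (fun _ => 1) := by
          rw [← PMF.expect_add]
          congr 1
          funext c'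
          split_ifs <;> simp
      _ = 1 := by simp
  have h2 : (runFor ans n ([A], μ)) c ≠ 0 := (PMF.mem_support_iff _ _).1 hc
  have h3 : (1 : ℝ≥0∞) + (runFor ans n ([A], μ)) c ≤ 1 := (add_le_add_left h _).trans h1
  have h4 : (1 : ℝ≥0∞) + (runFor ans n ([A], μ)) c ≤ 1 + 0 := by simpa using h3
  exact h2 (le_antisymm ((ENNReal.add_le_add_iff_left ENNReal.one_ne_top).1 h4) bot_le)

open Classical in
theorem toOuterMeasure_eq_expect {α : Type*} (p : PMF α) (s : Set α) :
    p.toOuterMeasure s = p.expect fun a => if a ∈ s then 1 else 0 := by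
  rw [PMF.toOuterMeasure_apply]
  unfold PMF.expect
  refine tsum_congr fun a => ?_
  by_cases h : a ∈ s <;> simp [h]

theorem toOuterMeasure_le_one {α : Type*} (p : PMF α) (s : Set α) : p.toOuterMeasure s ≤ 1 := by
  classical
  rw [toOuterMeasure_eq_expect]
  calc _ ≤ p.expect fun _ => 1 := PMF.expect_mono fun a => by split_ifs <;> simp
    _ = 1 := by simp

open Classical in
-- The right side also counts runs that have not halted.
theorem haltVal_indicator_le (A : Cmd Q) (μ : Mem) (n : ℕ) (E : Set Mem) :
    haltVal ans n ([A], μ) (fun μ' => if μ' ∈ E then 1 else 0)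
      ≤ ENNReal.ofReal (probAfter ans A μ n E) := by
  unfold probAfter
  rw [ENNReal.ofReal_toReal (ne_top_of_le_ne_top ENNReal.one_ne_top (toOuterMeasure_le_one _ _)),
    toOuterMeasure_eq_expect]
  unfold haltVal
  refine PMF.expect_mono fun c => ?_
  by_cases h1 : c.1 = [] <;> by_cases h2 : c.2 ∈ E <;> simp [h1, h2]

theorem runFor_nil (n : ℕ) (μ : Mem) : runFor ans n ([], μ) = PMF.pure ([], μ) := by
  induction n with
  | zero => rfl
  | succ n ih => simp [runFor, step, ih]

/-- Once all runs have halted, the expectation does not change any more. -/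
theorem haltVal_le_of_haltsWithin {A : Cmd Q} {μ : Mem} {T : ℕ} (h : HaltsWithin ans A μ T)
    (n : ℕ) (f : Mem → ℝ≥0∞) : haltVal ans n ([A], μ) f ≤ haltVal ans T ([A], μ) f := by
  refine (haltVal_mono ans (Nat.le_add_left n T) _ f).trans (le_of_eq ?_)
  unfold haltVal
  rw [runFor_add, PMF.expect_bind]
  unfold PMF.expect
  refine tsum_congr fun c => ?_
  by_cases hc : runFor ans T ([A], μ) c = 0
  · simp [hc]
  · have := h c ((PMF.mem_support_iff _ _).2 hc)
    obtain ⟨k, μ'⟩ := c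
    simp only at this
    subst this
    congr 1
    change (runFor ans n ([], μ')).expect _ = _
    rw [runFor_nil]
    exact PMF.expect_pure _ _

open Classical in
-- The success guarantee of the given algorithm becomes an upper bound for failure, the form in
-- which it is compared with the simulated runs.
theorem haltVal_compl_le {A : Cmd Q} {μ : Mem} {T : ℕ} {E : Set Mem} {p : ℝ}
    (hp : 1 - p ≤ probAfter ans A μ T E) :
    haltVal ans T ([A], μ) (fun μ' => if μ' ∈ E then 0 else 1) ≤ ENNReal.ofReal p := by
  have h1 : haltVal ans T ([A], μ) (fun μ' => if μ' ∈ E then 0 else 1)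
      ≤ (runFor ans T ([A], μ)).expect (fun c => if c ∈ {c : Config Q | c.2 ∈ E} then 0 else 1) := by
    unfold haltVal
    refine PMF.expect_mono fun c => ?_
    by_cases h1 : c.1 = [] <;> by_cases h2 : c.2 ∈ E <;> simp [h1, h2]
  have h2 : (runFor ans T ([A], μ)).expect
        (fun c => if c ∈ {c : Config Q | c.2 ∈ E} then 0 else 1)
      + (runFor ans T ([A], μ)).toOuterMeasure {c : Config Q | c.2 ∈ E} = 1 := by
    rw [toOuterMeasure_eq_expect, ← PMF.expect_add]
    calc _ = (runFor ans T ([A], μ)).expect fun _ => 1 := by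
          congr 1
          funext c
          split_ifs <;> simp
      _ = 1 := by simp
  refine h1.trans ?_
  set x := (runFor ans T ([A], μ)).expect (fun c => if c ∈ {c : Config Q | c.2 ∈ E} then 0 else 1)
  set y := (runFor ans T ([A], μ)).toOuterMeasure {c : Config Q | c.2 ∈ E} with hy
  have hx : x ≠ ⊤ := fun hx => by simp [hx] at h2
  have hyt : y ≠ ⊤ := fun hx => by simp [hx] at h2
  rw [← ENNReal.ofReal_toReal hx]
  apply ENNReal.ofReal_le_ofReal
  have h3 := congrArg ENNReal.toReal h2
  rw [ENNReal.toReal_add hx hyt, ENNReal.toReal_one] at h3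
  have h4 : 1 - p ≤ y.toReal := hp
  linarith

end Halting

/-! ### Budgeted denotational semantics -/

/-- A memory together with a budget of elementary steps, and a flag. -/
structure BState where
  mem : Mem
  bud : ℕ
  fnd : ℕ

/-- Spend one unit of the budget. -/
def BState.tick (s : BState) (μ : Mem) : BState := ⟨μ, s.bud - 1, s.fnd⟩

/-- The state after a deterministic instruction with the given effect: without an effect, the flag
is raised and the budget is withdrawn. -/
def BState.apply (s : BState) : Option Mem → BState
  | some μ => s.tick μ
  | none => ⟨s.mem, 0, 1⟩

section Den

variable {Q : Type} (sim : Q → Mem → Option Mem)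

/-- The deterministic elementary instructions, oracle calls being answered by `sim`. -/
def effect : Cmd Q → Mem → Option Mem
  | .const x n, μ => some (μ.setReg x n)
  | .add x y z, μ => some (μ.setReg x (μ.reg y + μ.reg z))
  | .sub x y z, μ => some (μ.setReg x (μ.reg y - μ.reg z))
  | .half x y, μ => some (μ.setReg x (μ.reg y / 2))
  | .load x a i, μ => some (μ.setReg x (μ.arr a (μ.reg i)))
  | .store a i x, μ => some (μ.setArr a (Function.update (μ.arr a) (μ.reg i) (μ.reg x)))
  | .call o, μ => sim o μ
  | _, μ => some μ

/-- A loop with body `D`, with at most `n` iterations. -/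
noncomputable def denLoop (x : ℕ) (D : BState → PMF BState) : ℕ → BState → PMF BState
  | 0, s => PMF.pure s
  | n + 1, s =>
    if s.bud ≠ 0 ∧ s.mem.reg x ≠ 0 then (D (s.tick s.mem)).bind (denLoop x D n) else PMF.pure s

/-- The effect of an elementary instruction which is only executed as long as the budget lasts. -/
noncomputable def denAtom (c : Cmd Q) (s : BState) : PMF BState :=
  PMF.pure (if s.bud = 0 then s else s.apply (effect sim c s.mem))

/-- The distribution of the final state of a program whose elementary instructions and loop
iterations each use up one unit of the budget; without budget, they are skipped. -/
noncomputable def den : Cmd Q → BState → PMF BState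
  | .skip, s => PMF.pure s
  | .flip x, s =>
      if s.bud = 0 then PMF.pure s
      else (PMF.uniformOfFintype Bool).map fun β => s.tick (s.mem.setReg x β.toNat)
  | .seq c₁ c₂, s => (den c₁ s).bind (den c₂)
  | .ite x c₁ c₂, s => if s.mem.reg x ≠ 0 then den c₁ s else den c₂ s
  -- Each iteration spends at least one unit, so the budget itself is sufficient fuel.
  | .while x c, s => denLoop x (den c) s.bud s
  | .const x n, s => denAtom sim (.const x n) s
  | .add x y z, s => denAtom sim (.add x y z) s
  | .sub x y z, s => denAtom sim (.sub x y z) s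
  | .half x y, s => denAtom sim (.half x y) s
  | .load x a i, s => denAtom sim (.load x a i) s
  | .store a i x, s => denAtom sim (.store a i x) s
  | .call o, s => denAtom sim (.call o) s

/-- Everything that holds initially and is preserved by elementary instructions holds finally. -/
theorem den_invariant {I : BState → Prop}
    (hatom : ∀ c s, I s → s.bud ≠ 0 → I (s.apply (effect sim c s.mem)))
    (hflip : ∀ (x : ℕ) (β : Bool) s, I s → s.bud ≠ 0 → I (s.tick (s.mem.setReg x β.toNat)))
    (htick : ∀ s, I s → s.bud ≠ 0 → I (s.tick s.mem))
    (c : Cmd Q) {s s' : BState} (hs : I s) (h : s' ∈ (den sim c s).support) : I s' := by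
  have atom : ∀ (c : Cmd Q) (s s' : BState), I s → s' ∈ (denAtom sim c s).support → I s' := by
    intro c s s' hs h
    simp only [denAtom, PMF.support_pure, Set.mem_singleton_iff] at h
    subst h
    split_ifs with h0
    exacts [hs, hatom c s hs h0]
  induction c generalizing s s' with
  | skip =>
    simp only [den, PMF.support_pure, Set.mem_singleton_iff] at h
    exact h ▸ hs
  | flip x =>
    simp only [den] at h
    split_ifs at h with h0
    · simp only [PMF.support_pure, Set.mem_singleton_iff] at h
      exact h ▸ hs
    · simp only [PMF.support_map, Set.mem_image] at h
      obtain ⟨β, -, rfl⟩ := h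
      exact hflip x β s hs h0
  | seq c₁ c₂ ih₁ ih₂ =>
    simp only [den, PMF.mem_support_bind_iff] at h
    obtain ⟨s₁, h₁, h₂⟩ := h
    exact ih₂ (ih₁ hs h₁) h₂
  | ite x c₁ c₂ ih₁ ih₂ =>
    simp only [den] at h
    split_ifs at h
    exacts [ih₁ hs h, ih₂ hs h]
  | const | add | sub | half | load | store | call => exact atom _ _ _ hs h
  | _ =>
    rename_i x c ih
    simp only [den] at h
    generalize s.bud = n at h
    induction n generalizing s with
    | zero =>
      simp only [denLoop, PMF.support_pure, Set.mem_singleton_iff] at h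
      exact h ▸ hs
    | succ n ihn =>
      simp only [denLoop] at h
      split_ifs at h with h0
      · simp only [PMF.mem_support_bind_iff] at h
        obtain ⟨s₁, h₁, h₂⟩ := h
        exact ihn (ih (htick s hs h0.1) h₁) h₂
      · simp only [PMF.support_pure, Set.mem_singleton_iff] at h
        exact h ▸ hs

theorem den_fnd_ne_zero (c : Cmd Q) {s s' : BState} (hs : s.fnd ≠ 0)
    (h : s' ∈ (den sim c s).support) : s'.fnd ≠ 0 := by
  refine den_invariant sim (I := fun s => s.fnd ≠ 0) ?_ (fun _ _ _ h _ => h) (fun _ h _ => h)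
    c hs h
  intro c s hs _
  cases effect sim c s.mem <;> simp [BState.apply, BState.tick, hs]

/-- Only a missing answer raises the flag. For an unsatisfiable formula no answer is missing, which
excludes a wrong YES. -/
theorem den_fnd_eq_zero (hsim : ∀ o μ, sim o μ ≠ none) (c : Cmd Q) {s s' : BState}
    (hs : s.fnd = 0) (h : s' ∈ (den sim c s).support) : s'.fnd = 0 := by
  refine den_invariant sim (I := fun s => s.fnd = 0) ?_ (fun _ _ _ h _ => h) (fun _ h _ => h)
    c hs h
  intro c s hs _
  cases he : effect sim c s.mem with
  | some μ => simpa [BState.apply, BState.tick] using hs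
  | none =>
    exfalso
    cases c <;> simp only [effect, reduceCtorEq] at he
    exact hsim _ _ he

theorem den_bud_le (c : Cmd Q) {s s' : BState} (h : s' ∈ (den sim c s).support) :
    s'.bud ≤ s.bud := by
  refine den_invariant sim (I := fun s' => s'.bud ≤ s.bud) ?_ ?_ ?_ c le_rfl h
  · intro c s₁ hs _
    cases effect sim c s₁.mem <;> simp only [BState.apply, BState.tick] <;> omega
  · intro x β s₁ hs _
    simp only [BState.tick]; omega
  · intro s₁ hs _
    simp only [BState.tick]; omega

end Den

/-! ### Comparison with the true oracle -/

section Compare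

variable {Q : Type} (ans : Q → Mem → PMF Mem) (sim : Q → Mem → Option Mem)

/-- The expectation of `f` over all halting runs. -/
noncomputable def limVal (c : Config Q) (f : Mem → ℝ≥0∞) : ℝ≥0∞ := ⨆ n, haltVal ans n c f

theorem limVal_nil (μ : Mem) (f : Mem → ℝ≥0∞) : limVal ans ([], μ) f = f μ := by
  simp [limVal]

theorem mul_limVal_le (c c' : Config Q) (f : Mem → ℝ≥0∞) :
    step ans c c' * limVal ans c' f ≤ limVal ans c f := by
  unfold limVal
  rw [ENNReal.mul_iSup]
  refine iSup_le fun n => le_trans ?_ (le_iSup _ (n + 1))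
  rw [haltVal_succ]
  exact PMF.mul_le_expect _ (fun c' => haltVal ans n c' f) c'

theorem limVal_le_of_pure {c c' : Config Q} (h : step ans c = PMF.pure c') (f : Mem → ℝ≥0∞) :
    limVal ans c' f ≤ limVal ans c f := by
  have := mul_limVal_le ans c c' f
  simpa [h] using this

/-- The two suprema add up because both sequences are monotone in the number of steps. -/
theorem flip_limVal_le (x : ℕ) (k : List (Cmd Q)) (μ : Mem) (f : Mem → ℝ≥0∞) :
    2⁻¹ * limVal ans (k, μ.setReg x 1) f + 2⁻¹ * limVal ans (k, μ.setReg x 0) f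
      ≤ limVal ans (.flip x :: k, μ) f := by
  unfold limVal
  rw [ENNReal.mul_iSup, ENNReal.mul_iSup, ENNReal.iSup_add_iSup_of_monotone]
  · refine iSup_le fun n => le_trans ?_ (le_iSup _ (n + 1))
    rw [haltVal_succ]
    simp [step, PMF.expect_map, PMF.expect_uniform_bool]
  · intro a b h
    dsimp only
    gcongr
    exact haltVal_mono ans h _ f
  · intro a b h
    dsimp only
    gcongr
    exact haltVal_mono ans h _ f

/-- If `sim` gives every answer of the oracle with an error of at most a factor `a`, or none, then
so does the budgeted semantics with the factor `a` for every unit of the budget, for the runs that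
do not exhaust the budget. -/
theorem den_expect_le {a : ℝ≥0∞} (ha : 1 ≤ a)
    (hsim : ∀ o μ μ', sim o μ = some μ' → 1 ≤ a * ans o μ μ') (f : Mem → ℝ≥0∞) (c : Cmd Q) :
    ∀ (k : List (Cmd Q)) (s : BState),
      (den sim c s).expect
          (fun s' => if s'.bud = 0 then 0 else a ^ s'.bud * limVal ans (k, s'.mem) f)
        ≤ if s.bud = 0 then 0 else a ^ s.bud * limVal ans (c :: k, s.mem) f := by
  have atom : ∀ (c : Cmd Q) (k : List (Cmd Q)) (s : BState),
      (∀ μ', effect sim c s.mem = some μ' → 1 ≤ a * step ans (c :: k, s.mem) (k, μ')) →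
      (denAtom sim c s).expect
          (fun s' => if s'.bud = 0 then 0 else a ^ s'.bud * limVal ans (k, s'.mem) f)
        ≤ if s.bud = 0 then 0 else a ^ s.bud * limVal ans (c :: k, s.mem) f := by
    intro c k s h
    simp only [denAtom, PMF.expect_pure]
    by_cases h0 : s.bud = 0
    · simp [h0]
    rw [if_neg h0, if_neg h0]
    cases he : effect sim c s.mem with
    -- A missing answer withdraws the budget, and states without budget count as zero.
    | none => simp [BState.apply]
    | some μ' =>
      simp only [BState.apply, BState.tick]
      by_cases h1 : s.bud - 1 = 0
      · simp [h1]
      simp only [h1, if_false]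
      -- The unit of budget that is spent supplies the factor `a` paying for the error of this one
      -- answer.
      calc a ^ (s.bud - 1) * limVal ans (k, μ') f
          ≤ a ^ (s.bud - 1) * ((a * step ans (c :: k, s.mem) (k, μ')) * limVal ans (k, μ') f) := by
            gcongr
            exact le_mul_of_one_le_left bot_le (h μ' he)
        _ = a ^ (s.bud - 1 + 1) * (step ans (c :: k, s.mem) (k, μ') * limVal ans (k, μ') f) := by
            rw [pow_succ]; ring
        _ ≤ a ^ s.bud * limVal ans (c :: k, s.mem) f := by
            rw [Nat.sub_add_cancel (Nat.one_le_iff_ne_zero.2 h0)]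
            gcongr
            exact mul_limVal_le _ _ _ _
  have det : ∀ (c : Cmd Q) (k : List (Cmd Q)) (s : BState),
      (∀ μ', effect sim c s.mem = some μ' → step ans (c :: k, s.mem) = PMF.pure (k, μ')) →
      ∀ μ', effect sim c s.mem = some μ' → 1 ≤ a * step ans (c :: k, s.mem) (k, μ') := by
    intro c k s h μ' he
    rw [h μ' he]
    simpa using ha
  have mono : ∀ (s s' : BState) (x y : Config Q), s'.bud ≤ s.bud →
      limVal ans x f ≤ limVal ans y f →
      (if s'.bud = 0 then 0 else a ^ s'.bud * limVal ans x f)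
        ≤ if s.bud = 0 then 0 else a ^ s.bud * limVal ans y f := by
    intro s s' x y hb h
    split_ifs with h1 h2
    · exact le_rfl
    · exact bot_le
    · omega
    · gcongr
  induction c with
  | skip =>
    intro k s
    simp only [den, PMF.expect_pure]
    exact mono s s _ _ le_rfl (limVal_le_of_pure ans rfl f)
  | flip x =>
    intro k s
    simp only [den]
    by_cases h0 : s.bud = 0
    · simp [h0]
    rw [if_neg h0, if_neg h0, PMF.expect_map, PMF.expect_uniform_bool]
    simp only [BState.tick, Bool.toNat_true, Bool.toNat_false]
    by_cases h1 : s.bud - 1 = 0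
    · simp [h1]
    simp only [h1, if_false]
    calc _ = a ^ (s.bud - 1) * (2⁻¹ * limVal ans (k, s.mem.setReg x 1) f
            + 2⁻¹ * limVal ans (k, s.mem.setReg x 0) f) := by ring
      _ ≤ a ^ s.bud * limVal ans (.flip x :: k, s.mem) f := by
        gcongr
        · exact Nat.sub_le _ _
        · exact flip_limVal_le ans x k s.mem f
  | seq c₁ c₂ ih₁ ih₂ =>
    intro k s
    simp only [den, PMF.expect_bind]
    refine (PMF.expect_mono fun s₁ => ih₂ k s₁).trans ((ih₁ (c₂ :: k) s).trans ?_)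
    exact mono s s _ _ le_rfl (limVal_le_of_pure ans rfl f)
  | ite x c₁ c₂ ih₁ ih₂ =>
    intro k s
    simp only [den]
    by_cases h : s.mem.reg x ≠ 0
    · rw [if_pos h]
      refine (ih₁ k s).trans (mono s s _ _ le_rfl (limVal_le_of_pure ans ?_ f))
      simp [step, h]
    · rw [if_neg h]
      refine (ih₂ k s).trans (mono s s _ _ le_rfl (limVal_le_of_pure ans ?_ f))
      simp only [step, if_neg h]
  | call o =>
    intro k s
    refine atom _ k s fun μ' he => ?_
    refine (hsim o s.mem μ' he).trans ?_
    gcongr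
    simp only [step]
    rw [PMF.map_apply]
    refine le_trans (le_of_eq ?_) (ENNReal.le_tsum μ')
    simp
  | const x n => exact fun k s => atom _ k s (det _ k s fun _ he => by cases he; rfl)
  | add x y z => exact fun k s => atom _ k s (det _ k s fun _ he => by cases he; rfl)
  | sub x y z => exact fun k s => atom _ k s (det _ k s fun _ he => by cases he; rfl)
  | half x y => exact fun k s => atom _ k s (det _ k s fun _ he => by cases he; rfl)
  | load x b i => exact fun k s => atom _ k s (det _ k s fun _ he => by cases he; rfl)
  | store b i x => exact fun k s => atom _ k s (det _ k s fun _ he => by cases he; rfl)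
  | _ =>
    rename_i x c ih
    intro k s
    simp only [den]
    obtain ⟨n, hn⟩ : ∃ n, s.bud ≤ n := ⟨_, le_rfl⟩
    -- With fuel below a positive budget the loop might be cut short; the bound `⊤` then claims
    -- nothing, unless the loop is left immediately.
    suffices H : ∀ (n : ℕ) (s : BState),
        (denLoop x (den sim c) n s).expect
          (fun s' => if s'.bud = 0 then 0 else a ^ s'.bud * limVal ans (k, s'.mem) f)
        ≤ if s.bud = 0 ∨ n < s.bud then
            (if s.bud = 0 then 0 else if s.mem.reg x = 0 then
              a ^ s.bud * limVal ans (.while x c :: k, s.mem) f else ⊤)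
          else a ^ s.bud * limVal ans (.while x c :: k, s.mem) f by
      refine (H s.bud s).trans (le_of_eq ?_)
      by_cases h0 : s.bud = 0 <;> simp [h0]
    intro n
    induction n with
    | zero =>
      intro s
      simp only [denLoop, PMF.expect_pure]
      by_cases h0 : s.bud = 0
      · simp [h0]
      have h1 : 0 < s.bud := Nat.pos_of_ne_zero h0
      simp only [h0, h1, if_false, if_true, or_true]
      split_ifs with h2
      · gcongr
        exact limVal_le_of_pure ans (by simp [step, h2]) f
      · exact le_top
    | succ n ihn =>
      intro s
      simp only [denLoop]
      by_cases h0 : s.bud = 0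
      · simp [h0]
      by_cases hx : s.mem.reg x = 0
      · simp only [h0, hx, ne_eq, not_true, and_false, if_false, PMF.expect_pure]
        have : limVal ans (k, s.mem) f ≤ limVal ans (.while x c :: k, s.mem) f :=
          limVal_le_of_pure ans (by simp [step, hx]) f
        split_ifs <;> gcongr
      by_cases hn : n + 1 < s.bud
      · simp [h0, hx, hn]
      rw [if_pos ⟨h0, hx⟩, PMF.expect_bind]
      simp only [h0, hn, or_self, if_false]
      have key := ih (.while x c :: k) (s.tick s.mem)
      calc _ ≤ (den sim c (s.tick s.mem)).expect (fun s' => if s'.bud = 0 then 0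
              else a ^ s'.bud * limVal ans (.while x c :: k, s'.mem) f) := by
            refine PMF.expect_mono_support fun s' hs' => (ihn s').trans (le_of_eq ?_)
            have hb : s'.bud ≤ s.bud - 1 := den_bud_le sim c hs'
            have hb' : ¬ n < s'.bud := by omega
            by_cases h1 : s'.bud = 0 <;> simp [h1, hb']
        _ ≤ _ := key
        _ ≤ a ^ s.bud * limVal ans (.while x c :: k, s.mem) f := by
            have hst : limVal ans (c :: .while x c :: k, s.mem) f
                ≤ limVal ans (.while x c :: k, s.mem) f :=
              limVal_le_of_pure ans (by simp [step, hx]) f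
            have := mono s (s.tick s.mem) _ _ (Nat.sub_le _ _) hst
            rwa [if_neg h0] at this

/-- All runs from the configuration `c` halt within `n` steps. -/
def SafeWithin (n : ℕ) (c : Config Q) : Prop := ∀ c' ∈ (runFor ans n c).support, c'.1 = []

variable {ans} in
theorem SafeWithin.step {n : ℕ} {a : Cmd Q} {k : List (Cmd Q)} {μ : Mem}
    (h : SafeWithin ans n (a :: k, μ)) :
    ∃ m, n = m + 1 ∧ ∀ c' ∈ (_root_.step ans (a :: k, μ)).support, SafeWithin ans m c' := by
  cases n with
  | zero =>
    have := h (a :: k, μ) (by simp [runFor])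
    simp at this
  | succ m =>
    refine ⟨m, rfl, fun c' hc' c'' hc'' => h c'' ?_⟩
    simp only [runFor, PMF.mem_support_bind_iff]
    exact ⟨c', hc', hc''⟩

/-- A program which halts within less steps than the budget does not exhaust the budget. -/
theorem den_not_exhausted (hsim : ∀ o μ μ', sim o μ = some μ' → ans o μ μ' ≠ 0) (c : Cmd Q) :
    ∀ (k : List (Cmd Q)) (n : ℕ) (s s' : BState), SafeWithin ans n (c :: k, s.mem) → n < s.bud →
      s' ∈ (den sim c s).support →
      s'.fnd ≠ 0 ∨ ∃ n', SafeWithin ans n' (k, s'.mem) ∧ n' < s'.bud := by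
  have atom : ∀ (c : Cmd Q) (k : List (Cmd Q)) (n : ℕ) (s s' : BState),
      SafeWithin ans n (c :: k, s.mem) → n < s.bud →
      (∀ μ', effect sim c s.mem = some μ' → (k, μ') ∈ (step ans (c :: k, s.mem)).support) →
      s' ∈ (denAtom sim c s).support →
      s'.fnd ≠ 0 ∨ ∃ n', SafeWithin ans n' (k, s'.mem) ∧ n' < s'.bud := by
    intro c k n s s' hs hn h hs'
    simp only [denAtom, PMF.support_pure, Set.mem_singleton_iff] at hs'
    rw [if_neg (by omega)] at hs'
    subst hs'
    obtain ⟨m, rfl, hm⟩ := hs.step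
    cases he : effect sim c s.mem with
    | none => left; simp [BState.apply]
    | some μ' =>
      right
      -- The simulated answer has positive probability under the true oracle, so the simulated run
      -- is also a possible true run, for which halting is guaranteed.
      exact ⟨m, hm _ (h μ' he), by simp only [BState.apply, BState.tick]; omega⟩
  have det : ∀ {c c' : Config Q}, step ans c = PMF.pure c' → c' ∈ (step ans c).support := by
    intro c c' h
    rw [h]; simp
  induction c with
  | skip =>
    intro k n s s' hs hn hs'
    simp only [den, PMF.support_pure, Set.mem_singleton_iff] at hs'
    subst hs'
    obtain ⟨m, rfl, hm⟩ := hs.step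
    exact Or.inr ⟨m, hm _ (det rfl), by omega⟩
  | flip x =>
    intro k n s s' hs hn hs'
    simp only [den] at hs'
    rw [if_neg (by omega)] at hs'
    simp only [PMF.support_map, Set.mem_image] at hs'
    obtain ⟨β, hβ, rfl⟩ := hs'
    obtain ⟨m, rfl, hm⟩ := hs.step
    refine Or.inr ⟨m, hm _ ?_, by simp only [BState.tick]; omega⟩
    simp only [step, PMF.support_map, Set.mem_image]
    exact ⟨β, hβ, rfl⟩
  | seq c₁ c₂ ih₁ ih₂ =>
    intro k n s s' hs hn hs'
    simp only [den, PMF.mem_support_bind_iff] at hs'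
    obtain ⟨s₁, h₁, h₂⟩ := hs'
    obtain ⟨m, rfl, hm⟩ := hs.step
    rcases ih₁ (c₂ :: k) m s s₁ (hm _ (det rfl)) (by omega) h₁ with h | ⟨n', hn', hb⟩
    · exact Or.inl (den_fnd_ne_zero sim c₂ h h₂)
    · exact ih₂ k n' s₁ s' hn' hb h₂
  | ite x c₁ c₂ ih₁ ih₂ =>
    intro k n s s' hs hn hs'
    simp only [den] at hs'
    obtain ⟨m, rfl, hm⟩ := hs.step
    by_cases h : s.mem.reg x ≠ 0
    · rw [if_pos h] at hs'
      exact ih₁ k m s s' (hm _ (det (by simp [step, h]))) (by omega) hs'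
    · rw [if_neg h] at hs'
      exact ih₂ k m s s' (hm _ (det (by simp only [step, if_neg h]))) (by omega) hs'
  | call o =>
    intro k n s s' hs hn hs'
    refine atom _ k n s s' hs hn (fun μ' he => ?_) hs'
    simp only [step, PMF.support_map, Set.mem_image]
    exact ⟨μ', (PMF.mem_support_iff _ _).2 (hsim o s.mem μ' he), rfl⟩
  | const x n =>
    exact fun k n s s' hs hn => atom _ k n s s' hs hn fun _ he => det (by cases he; rfl)
  | add x y z =>
    exact fun k n s s' hs hn => atom _ k n s s' hs hn fun _ he => det (by cases he; rfl)
  | sub x y z =>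
    exact fun k n s s' hs hn => atom _ k n s s' hs hn fun _ he => det (by cases he; rfl)
  | half x y =>
    exact fun k n s s' hs hn => atom _ k n s s' hs hn fun _ he => det (by cases he; rfl)
  | load x b i =>
    exact fun k n s s' hs hn => atom _ k n s s' hs hn fun _ he => det (by cases he; rfl)
  | store b i x =>
    exact fun k n s s' hs hn => atom _ k n s s' hs hn fun _ he => det (by cases he; rfl)
  | _ =>
    rename_i x c ih
    intro k n s s' hs hn hs'
    simp only [den] at hs'
    obtain ⟨b, hb⟩ : ∃ b, b = s.bud := ⟨_, rfl⟩
    rw [← hb] at hs'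
    replace hb : s.bud ≤ b := hb.ge
    induction b generalizing n s with
    | zero => omega
    | succ b ihb =>
      obtain ⟨m, rfl, hm⟩ := hs.step
      simp only [denLoop] at hs'
      by_cases h : s.mem.reg x ≠ 0
      · rw [if_pos ⟨by omega, h⟩] at hs'
        simp only [PMF.mem_support_bind_iff] at hs'
        obtain ⟨s₁, h₁, h₂⟩ := hs'
        have hbud : s₁.bud ≤ s.bud - 1 := den_bud_le sim c h₁
        rcases ih (.while x c :: k) m (s.tick s.mem) s₁ (hm _ (det (by simp [step, BState.tick, h])))
          (by simp only [BState.tick]; omega) h₁ with h3 | ⟨n', hn', hb'⟩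
        · left
          clear ihb
          have : ∀ (b : ℕ) (s₁ : BState), s₁.fnd ≠ 0 →
              s' ∈ (denLoop x (den sim c) b s₁).support → s'.fnd ≠ 0 := by
            intro b
            induction b with
            | zero =>
              intro s₁ h3 h₂
              simp only [denLoop, PMF.support_pure, Set.mem_singleton_iff] at h₂
              exact h₂ ▸ h3
            | succ b ihb =>
              intro s₁ h3 h₂
              simp only [denLoop] at h₂
              split_ifs at h₂
              · simp only [PMF.mem_support_bind_iff] at h₂
                obtain ⟨s₂, h4, h5⟩ := h₂
                exact ihb s₂ (den_fnd_ne_zero sim c (by exact h3) h4) h5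
              · simp only [PMF.support_pure, Set.mem_singleton_iff] at h₂
                exact h₂ ▸ h3
          exact this b s₁ h3 h₂
        · exact ihb n' s₁ hn' hb' h₂ (by omega)
      · rw [if_neg (fun h' => h h'.2)] at hs'
        simp only [PMF.support_pure, Set.mem_singleton_iff] at hs'
        subst hs'
        exact Or.inr ⟨m, hm _ (det (by simp only [step, if_neg h])), by omega⟩

end Compare

/-! ### Policies and values in deterministic MDPs -/

namespace DetMDP

variable {k d : ℕ} (M : DetMDP k d)

theorem traj_succ (π : M.State → Fin k) (s : M.State) (t : ℕ) :
    M.traj π s (t + 1) = M.trans (M.traj π s t) (π (M.traj π s t)) :=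
  Function.iterate_succ_apply' _ _ _

theorem traj_eq_path (π : M.State → Fin k) (s : M.State) (t : ℕ) :
    M.traj π s t = M.path s (fun t => π (M.traj π s t)) t := by
  induction t with
  | zero => rfl
  | succ t ih =>
    rw [traj_succ]
    change _ = M.trans (M.path s (fun t => π (M.traj π s t)) t) _
    rw [← ih]

theorem traj_horizon (π : M.State → Fin k) (s : M.State) : M.traj π s M.horizon = M.bot := by
  rw [traj_eq_path]
  exact M.trans_horizon _ _

/-- The rewards are bounded by the decrements of `g` along the trajectory, and these telescope
because the trajectory ends in `bot`, where `g` vanishes. -/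
theorem V_le_of_superharmonic {g : M.State → ℝ} (h0 : g M.bot = 0)
    (h : ∀ s a, M.meanReward s a + g (M.trans s a) ≤ g s) (π : M.State → Fin k) (s : M.State) :
    M.V π s ≤ g s := by
  calc M.V π s ≤ ∑ t ∈ Finset.range M.horizon, (g (M.traj π s t) - g (M.traj π s (t + 1))) := by
        refine Finset.sum_le_sum fun t _ => ?_
        rw [traj_succ]
        linarith [h (M.traj π s t) (π (M.traj π s t))]
    _ = g s := by
        rw [Finset.sum_range_sub', traj_horizon, h0, sub_zero]
        rfl

theorem V_eq_of_harmonic {g : M.State → ℝ} (h0 : g M.bot = 0) (π : M.State → Fin k)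
    (h : ∀ s, M.meanReward s (π s) + g (M.trans s (π s)) = g s) (s : M.State) :
    M.V π s = g s := by
  calc M.V π s = ∑ t ∈ Finset.range M.horizon, (g (M.traj π s t) - g (M.traj π s (t + 1))) := by
        refine Finset.sum_congr rfl fun t _ => ?_
        rw [traj_succ]
        linarith [h (M.traj π s t)]
    _ = g s := by
        rw [Finset.sum_range_sub', traj_horizon, h0, sub_zero]
        rfl

/-- A solution of the Bellman equation is the optimal value function. -/
theorem optimal_of_bellman [NeZero k] {g : M.State → ℝ} (h0 : g M.bot = 0)
    (h : ∀ s a, M.meanReward s a + g (M.trans s a) ≤ g s)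
    (h' : ∀ s, ∃ a, M.meanReward s a + g (M.trans s a) = g s) :
    (∀ s, M.Vstar s = g s) ∧ ∀ s a, M.Qstar s a = M.meanReward s a + g (M.trans s a) := by
  choose π hπ using h'
  have hV := M.V_le_of_superharmonic h0 h
  have hπV := M.V_eq_of_harmonic h0 π hπ
  have hne : Nonempty (M.State → Fin k) := ⟨π⟩
  constructor
  · intro s
    refine le_antisymm (ciSup_le fun π' => hV π' s) ?_
    rw [← hπV s]
    exact le_ciSup (f := fun π => M.V π s) ⟨g s, by rintro _ ⟨π', rfl⟩; exact hV π' s⟩ π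
  · intro s a
    have hQ : ∀ π', M.Q π' s a ≤ M.meanReward s a + g (M.trans s a) := fun π' => by
      unfold Q
      linarith [hV π' (M.trans s a)]
    refine le_antisymm (ciSup_le hQ) ?_
    rw [← hπV]
    exact le_ciSup (f := fun π => M.Q π s a) ⟨_, by rintro _ ⟨π', rfl⟩; exact hQ π'⟩ π

theorem decode_code (s : M.State) : M.decode (M.code s) = s := by
  have h : ∃ s', M.code s' = M.code s := ⟨s, rfl⟩
  unfold decode
  rw [dif_pos h]
  exact M.code_injective h.choose_spec

theorem decode_of_forall_ne {n : ℕ} (h : ∀ s, M.code s ≠ n) : M.decode n = M.bot := by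
  unfold decode
  rw [dif_neg (by simpa using h)]

end DetMDP

/-- A reward which is `1` with probability `p` and `0` otherwise. -/
noncomputable def coinReward (p : ℝ≥0) (hp : p ≤ 1) : PMF ℚ :=
  PMF.ofFinset (fun x => if x = 1 then (p : ℝ≥0∞) else if x = 0 then 1 - (p : ℝ≥0∞) else 0) {1, 0}
    (by
      rw [Finset.sum_pair one_ne_zero]
      simp only [if_true, zero_ne_one, if_false]
      exact add_tsub_cancel_of_le (by exact_mod_cast hp))
    (by
      intro a ha
      simp only [Finset.mem_insert, Finset.mem_singleton, not_or] at ha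
      simp [ha.1, ha.2])

theorem coinReward_zero (p : ℝ≥0) (hp : p ≤ 1) : coinReward p hp 0 = 1 - (p : ℝ≥0∞) := by
  simp [coinReward]

theorem coinReward_support {p : ℝ≥0} {hp : p ≤ 1} {x : ℚ} (hx : x ∈ (coinReward p hp).support) :
    x = 1 ∨ x = 0 := by
  by_contra h
  push Not at h
  rw [PMF.mem_support_iff] at hx
  exact hx (by simp [coinReward, h.1, h.2])

theorem coinReward_mean (p : ℝ≥0) (hp : p ≤ 1) :
    ∑' x : ℚ, (coinReward p hp x).toReal * (x : ℝ) = p := by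
  rw [tsum_eq_single 1]
  · simp [coinReward]
  · intro x hx
    by_cases h0 : x = 0
    · simp [h0]
    · simp [coinReward, hx, h0]

/-! ### Assignments written as numbers -/

/-- The number with lower binary digits `w 0, …, w (v - 1)` and the rest given by `l`. -/
def encodeBits (w : ℕ → ℕ) : ℕ → ℕ → ℕ
  | 0, l => l
  | v + 1, l => encodeBits w v (2 * l + w v)

theorem encodeBits_eq (w : ℕ → ℕ) (v l : ℕ) :
    encodeBits w v l = l * 2 ^ v + encodeBits w v 0 := by
  induction v generalizing l with
  | zero => simp [encodeBits]
  | succ v ih =>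
    simp only [encodeBits]
    rw [ih (2 * l + w v), ih (2 * 0 + w v)]
    ring

theorem encodeBits_lt {w : ℕ → ℕ} (hw : ∀ i, w i < 2) (v : ℕ) : encodeBits w v 0 < 2 ^ v := by
  induction v with
  | zero => simp [encodeBits]
  | succ v ih =>
    simp only [encodeBits]
    rw [encodeBits_eq, pow_succ]
    have := hw v
    have : (2 * 0 + w v) * 2 ^ v ≤ 1 * 2 ^ v := Nat.mul_le_mul_right _ (by omega)
    omega

theorem encodeBits_div {w : ℕ → ℕ} (hw : ∀ i, w i < 2) (v l : ℕ) :
    encodeBits w v l / 2 ^ v = l := by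
  rw [encodeBits_eq, Nat.add_comm, Nat.add_mul_div_right _ _ (by positivity),
    Nat.div_eq_of_lt (encodeBits_lt hw v), zero_add]

theorem encodeBits_digit {w : ℕ → ℕ} (hw : ∀ i, w i < 2) {v i : ℕ} (hi : i < v) (l : ℕ) :
    encodeBits w v l / 2 ^ i % 2 = w i := by
  induction v generalizing l with
  | zero => omega
  | succ v ih =>
    simp only [encodeBits]
    rcases Nat.lt_succ_iff_lt_or_eq.1 hi with h | rfl
    · exact ih h _
    · rw [encodeBits_div hw]
      have := hw i
      omega

theorem encodeBits_digits (m v : ℕ) :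
    encodeBits (fun i => m / 2 ^ i % 2) v (m / 2 ^ v) = m := by
  induction v with
  | zero => simp [encodeBits]
  | succ v ih =>
    simp only [encodeBits]
    rw [pow_succ, ← Nat.div_div_eq_div_mul, Nat.div_add_mod]
    exact ih

theorem encodeBits_congr {w w' : ℕ → ℕ} {v : ℕ} (h : ∀ i < v, w i = w' i) (l : ℕ) :
    encodeBits w v l = encodeBits w' v l := by
  induction v generalizing l with
  | zero => rfl
  | succ v ih =>
    simp only [encodeBits]
    rw [h v (by omega)]
    exact ih (fun i hi => h i (by omega)) _

/-- The digits of an assignment. -/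
def bitsOf {v : ℕ} (w : Fin v → Bool) (i : ℕ) : ℕ := if h : i < v then (w ⟨i, h⟩).toNat else 0

theorem bitsOf_lt {v : ℕ} (w : Fin v → Bool) (i : ℕ) : bitsOf w i < 2 := by
  unfold bitsOf
  split_ifs
  · exact Bool.toNat_lt _
  · norm_num

theorem bitsOf_val {v : ℕ} (w : Fin v → Bool) (i : Fin v) : bitsOf w i = (w i).toNat := by
  simp [bitsOf]

/-- A state: a level and an assignment, or the end state. -/
abbrev SatState (v d : ℕ) : Type := Option (Fin d × (Fin v → Bool))

/-- The code of a state. -/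
def SatState.code {v d : ℕ} : SatState v d → ℕ
  | none => 0
  -- The shift by one reserves the code zero for the end state.
  | some (l, w) => encodeBits (bitsOf w) v l + 1

/-- The state with a given code; words that encode no state are read as the end state. -/
def SatState.decode (v d n : ℕ) : SatState v d :=
  if n = 0 then none
  else if h : (n - 1) / 2 ^ v < d then
    some (⟨(n - 1) / 2 ^ v, h⟩, fun i => decide ((n - 1) / 2 ^ (i : ℕ) % 2 = 1))
  else none

theorem SatState.decode_code {v d : ℕ} (s : SatState v d) :
    SatState.decode v d s.code = s := by
  rcases s with _ | ⟨l, w⟩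
  · rfl
  · have hl : encodeBits (bitsOf w) v l / 2 ^ v = l := encodeBits_div (bitsOf_lt w) v l
    simp only [SatState.decode, SatState.code, Nat.add_eq_zero_iff, one_ne_zero, and_false,
      if_false, Nat.add_sub_cancel, hl, Fin.is_lt, dif_pos]
    congr 2
    funext i
    rw [encodeBits_digit (bitsOf_lt w) i.2, bitsOf_val]
    cases w i <;> simp

/-- Together with `SatState.decode_code` this shows that the arithmetic decoding agrees with
`DetMDP.decode`, which is defined by choice. -/
theorem SatState.code_decode {v d n : ℕ} (h : SatState.decode v d n ≠ none) :
    (SatState.decode v d n).code = n := by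
  unfold SatState.decode at h ⊢
  split_ifs at h ⊢ with h0 h1
  · exact absurd rfl h
  · simp only [SatState.code]
    rw [encodeBits_congr (w' := fun i => (n - 1) / 2 ^ i % 2), encodeBits_digits]
    · omega
    · intro i hi
      have := Nat.mod_lt ((n - 1) / 2 ^ i) two_pos
      simp only [bitsOf, hi, dif_pos]
      by_cases h : (n - 1) / 2 ^ i % 2 = 1 <;> simp [h]
      omega
  · exact absurd rfl h

theorem SatState.code_injective {v d : ℕ} : Function.Injective (SatState.code (v := v) (d := d)) :=
  fun s s' h => by rw [← s.decode_code, h, s'.decode_code]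

theorem SatState.code_lt {v d : ℕ} (s : SatState v d) : s.code < d * 2 ^ v + 1 := by
  rcases s with _ | ⟨l, w⟩
  · simp [SatState.code]
  · simp only [SatState.code]
    rw [encodeBits_eq]
    have h1 := encodeBits_lt (bitsOf_lt w) v
    have h2 : (l + 1 : ℕ) * 2 ^ v ≤ d * 2 ^ v := Nat.mul_le_mul_right _ l.2
    rw [Nat.add_mul] at h2
    omega

/-! ### Products along the branches of a regular tree -/

/-- The nodes of the `B`-ary tree are numbered level by level, the children of `j` being
`B * j + 1, …, B * j + B`. Every child is labelled by `x`; this is the product of the labels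
on the way from the root. -/
def treeProd {R : Type*} [CommSemiring R] (B : ℕ) (x : ℕ → R) : ℕ → R
  | 0 => 1
  | j + 1 => x (j % B) * treeProd B x (j / B)
termination_by j => j
decreasing_by exact Nat.lt_succ_of_le (Nat.div_le_self _ _)

/-- The number of nodes above level `r`. -/
def levelStart (B r : ℕ) : ℕ := ∑ i ∈ Finset.range r, B ^ i

theorem levelStart_succ (B r : ℕ) : levelStart B (r + 1) = levelStart B r + B ^ r :=
  Finset.sum_range_succ _ _

theorem levelStart_succ' (B r : ℕ) : levelStart B (r + 1) = B * levelStart B r + 1 := by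
  simp [levelStart, Finset.sum_range_succ', Finset.mul_sum, pow_succ']

theorem treeProd_child {R : Type*} [CommSemiring R] {B : ℕ} (x : ℕ → R) (j : ℕ) {i : ℕ}
    (hi : i < B) : treeProd B x (B * j + i + 1) = x i * treeProd B x j := by
  rw [treeProd, Nat.mul_add_mod, Nat.mod_eq_of_lt hi, Nat.mul_add_div (by omega),
    Nat.div_eq_of_lt hi, add_zero]

theorem sum_range_mul_eq {R : Type*} [AddCommMonoid R] (f : ℕ → R) (a B : ℕ) :
    ∑ n ∈ Finset.range (a * B), f n
      = ∑ m ∈ Finset.range a, ∑ i ∈ Finset.range B, f (B * m + i) := by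
  induction a with
  | zero => simp
  | succ a ih =>
    rw [Nat.add_mul, one_mul, Finset.sum_range_add, ih, Finset.sum_range_succ, mul_comm a B]

/-- The inner product of two tensor powers is the power of the inner product. -/
theorem sum_treeProd {R : Type*} [CommSemiring R] (B : ℕ) (x y : ℕ → R) (r : ℕ) :
    ∑ n ∈ Finset.range (B ^ r),
        treeProd B x (levelStart B r + n) * treeProd B y (levelStart B r + n)
      = (∑ i ∈ Finset.range B, x i * y i) ^ r := by
  induction r with
  | zero => simp [levelStart, treeProd]
  | succ r ih =>
    rw [pow_succ, sum_range_mul_eq, pow_succ, ← ih, Finset.sum_mul]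
    refine Finset.sum_congr rfl fun m _ => ?_
    rw [Finset.mul_sum]
    refine Finset.sum_congr rfl fun i hi => ?_
    -- The children of the nodes of level `r`, taken in order, fill level `r + 1` without gaps.
    have : levelStart B (r + 1) + (B * m + i) = B * (levelStart B r + m) + i + 1 := by
      rw [levelStart_succ']; ring
    rw [this, treeProd_child _ _ (Finset.mem_range.1 hi), treeProd_child _ _ (Finset.mem_range.1 hi)]
    ring

/-- A node on level at most `r` has at most `r` labels on its way from the root. -/
theorem treeProd_le {B N : ℕ} {x : ℕ → ℕ} (hN : 1 ≤ N) (hx : ∀ i, x i ≤ N) (r : ℕ) {n : ℕ}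
    (hn : n < levelStart B (r + 1)) : treeProd B x n ≤ N ^ r := by
  induction r generalizing n with
  | zero =>
    have : n = 0 := by simpa [levelStart] using hn
    subst this
    simp [treeProd]
  | succ r ih =>
    cases n with
    | zero => simpa [treeProd] using Nat.one_le_pow _ _ hN
    | succ j =>
      rw [treeProd, pow_succ']
      refine Nat.mul_le_mul (hx _) (ih ?_)
      rw [levelStart_succ'] at hn
      exact Nat.div_lt_of_lt_mul (by omega)

/-! ### The local search process of a formula -/

/-- The clause is violated by the assignment. -/
def Clause3.Violated {v : ℕ} (c : Clause3 v) (w : Fin v → Bool) : Prop := ∀ j, w (c j).1 ≠ (c j).2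

instance {v : ℕ} (c : Clause3 v) (w : Fin v → Bool) : Decidable (c.Violated w) :=
  inferInstanceAs (Decidable (∀ j, w (c j).1 ≠ (c j).2))

/-- The last violated clause. -/
def CNF3.lastViolated {v : ℕ} (φ : CNF3 v) (w : Fin v → Bool) : Option (Clause3 v) :=
  φ.foldl (fun o c => if c.Violated w then some c else o) none

theorem CNF3.lastViolated_concat {v : ℕ} (φ : CNF3 v) (c : Clause3 v) (w : Fin v → Bool) :
    CNF3.lastViolated (φ ++ [c]) w = if c.Violated w then some c else CNF3.lastViolated φ w := by
  simp [CNF3.lastViolated, List.foldl_append]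

theorem CNF3.lastViolated_eq_none {v : ℕ} {φ : CNF3 v} {w : Fin v → Bool} :
    φ.lastViolated w = none ↔ φ.Satisfies w := by
  induction φ using List.reverseRecOn with
  | nil => simp [CNF3.lastViolated, CNF3.Satisfies]
  | append_singleton φ c ih =>
    rw [CNF3.lastViolated_concat]
    unfold CNF3.Satisfies at ih ⊢
    by_cases hc : c.Violated w
    · simp only [hc, if_true, reduceCtorEq, false_iff]
      intro h
      obtain ⟨j, hj⟩ := h c (by simp)
      exact hc j hj
    · simp only [hc, if_false, ih, List.mem_append, List.mem_singleton]
      unfold Clause3.Violated at hc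
      push Not at hc
      constructor
      · rintro h c' (h' | rfl)
        exacts [h c' h', hc]
      · exact fun h c' h' => h c' (Or.inl h')

theorem CNF3.lastViolated_eq_some {v : ℕ} {φ : CNF3 v} {w : Fin v → Bool} {c : Clause3 v}
    (h : φ.lastViolated w = some c) : c ∈ φ ∧ c.Violated w := by
  induction φ using List.reverseRecOn with
  | nil => simp [CNF3.lastViolated] at h
  | append_singleton φ c' ih =>
    rw [CNF3.lastViolated_concat] at h
    by_cases hc : c'.Violated w
    · simp only [hc, if_true, Option.some.injEq] at h
      subst h
      exact ⟨by simp, hc⟩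
    · simp only [hc, if_false] at h
      exact ⟨List.mem_append_left _ (ih h).1, (ih h).2⟩

section LocalSearch

variable {v d : ℕ} (φ : CNF3 v)

/-- Flip a variable of a violated clause, and go down one level. -/
def satNext : SatState v d → Fin 3 → SatState v d
  | none, _ => none
  | some (l, w), a =>
    match φ.lastViolated w with
    | none => none
    | some c =>
      if h : l + 1 < d then some (⟨l + 1, h⟩, Function.update w (c a).1 (!w (c a).1)) else none

/-- The assignment of the state satisfies the formula. -/
def IsSolved : SatState v d → Prop
  | none => False
  | some (_, w) => φ.lastViolated w = none

instance : DecidablePred (IsSolved (d := d) φ) := fun s =>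
  match s with
  | none => inferInstanceAs (Decidable False)
  | some (_, w) => inferInstanceAs (Decidable (φ.lastViolated w = none))

/-- The level of the state is the last one. -/
def IsLeaf : SatState v d → Prop
  | none => False
  | some (l, _) => (l : ℕ) + 1 = d

instance : DecidablePred (IsLeaf (v := v) (d := d)) := fun s =>
  match s with
  | none => inferInstanceAs (Decidable False)
  | some (l, _) => inferInstanceAs (Decidable ((l : ℕ) + 1 = d))

theorem satNext_of_isSolved {s : SatState v d} (h : IsSolved φ s) (a : Fin 3) :
    satNext φ s a = none := by
  rcases s with _ | ⟨l, w⟩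
  · rfl
  · simp only [IsSolved] at h
    simp [satNext, h]

theorem satNext_of_isLeaf {s : SatState v d} (h : IsLeaf s) (a : Fin 3) :
    satNext φ s a = none := by
  rcases s with _ | ⟨l, w⟩
  · rfl
  · simp only [IsLeaf] at h
    simp only [satNext]
    split
    · rfl
    · rw [dif_neg (by omega)]

/-- Since the level is a clock, the number of levels bounds the horizon. -/
theorem satNext_level {s : SatState v d} {a : Fin 3} {l : Fin d} {w : Fin v → Bool}
    (h : satNext φ s a = some (l, w)) : ∃ l' w', s = some (l', w') ∧ (l : ℕ) = l' + 1 := by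
  rcases s with _ | ⟨l', w'⟩
  · simp [satNext] at h
  · refine ⟨l', w', rfl, ?_⟩
    simp only [satNext] at h
    split at h
    · simp at h
    · split_ifs at h
      simp only [Option.some.injEq, Prod.mk.injEq] at h
      rw [← h.1]

/-- The factors of the features of a state. -/
def coordOf (N l : ℕ) (w : ℕ → ℕ) : ℕ → ℕ
  | 0 => N - l
  | 1 => 1
  | i + 2 => w i

theorem coordOf_le {N : ℕ} (hN : 1 ≤ N) (l : ℕ) {w : ℕ → ℕ} (hw : ∀ i, w i < 2) (i : ℕ) :
    coordOf N l w i ≤ N := by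
  match i with
  | 0 => exact Nat.sub_le _ _
  | 1 => exact hN
  | i + 2 => have := hw i; simp only [coordOf]; omega

/-- The features of a state. -/
def featOf (r : ℕ) : SatState v ((v + 2) ^ r) → ℕ → ℕ
  | none, _ => 0
  | some (l, w), n =>
    -- Only level `r` of the tree is used: its `(v + 2) ^ r` products are the entries of the `r`-th
    -- tensor power of the coordinate vector.
    treeProd (v + 2) (coordOf ((v + 2) ^ r + v) l (bitsOf w)) (levelStart (v + 2) r + n)

theorem featOf_le (r : ℕ) (s : SatState v ((v + 2) ^ r)) {n : ℕ} (hn : n < (v + 2) ^ r) :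
    featOf r s n ≤ ((v + 2) ^ r + v) ^ r := by
  have hN : 1 ≤ (v + 2) ^ r + v := le_add_right (Nat.one_le_pow _ _ (by omega))
  rcases s with _ | ⟨l, w⟩
  · exact Nat.zero_le _
  · refine treeProd_le hN (coordOf_le hN _ (bitsOf_lt w)) r ?_
    rw [levelStart_succ]
    omega

end LocalSearch

/-! ### The Hamming distance to the target: its change under a flip and its linearity. -/

section Distance

variable {v : ℕ}

theorem hammingDist_update_of_ne {w w' : Fin v → Bool} {i : Fin v} (h : w i ≠ w' i) :
    hammingDist (Function.update w i (!w i)) w' + 1 = hammingDist w w' := by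
  unfold hammingDist
  have : (Finset.univ.filter fun j => w j ≠ w' j)
      = insert i (Finset.univ.filter fun j => Function.update w i (!w i) j ≠ w' j) := by
    ext j
    by_cases hj : j = i
    · subst hj; simp [h]
    · simp [hj]
  rw [this, Finset.card_insert_of_notMem]
  simp only [Finset.mem_filter, Finset.mem_univ, true_and, Function.update_self, not_not]
  revert h
  cases w i <;> cases w' i <;> simp

theorem hammingDist_le_update (w w' : Fin v → Bool) (i : Fin v) :
    hammingDist w w' ≤ hammingDist (Function.update w i (!w i)) w' + 1 := by
  refine (hammingDist_triangle w (Function.update w i (!w i)) w').trans ?_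
  rw [add_comm]
  gcongr
  unfold hammingDist
  rw [Finset.card_le_one]
  intro a ha b hb
  simp only [Finset.mem_filter, Finset.mem_univ, true_and] at ha hb
  have h1 : ∀ j, w j ≠ Function.update w i (!w i) j → j = i := fun j hj => by
    by_contra h; simp [h] at hj
  rw [h1 a ha, h1 b hb]

/-- The coefficients of the distance to an assignment. -/
def distCoeff (w : Fin v → Bool) : ℕ → ℝ
  | 0 => 1
  | 1 => -∑ i, (bitsOf w (i : Fin v) : ℝ)
  | i + 2 => 2 * bitsOf w i - 1

/-- For bits, `|x - y| = x + y - 2xy` is affine in `x` when `y` is fixed. The constant part is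
carried by the coordinate that is always `1`, and the level enters through coordinate `0`. -/
theorem sum_distCoeff (w' w : Fin v → Bool) {N l : ℕ} (hl : l ≤ N) :
    ∑ i ∈ Finset.range (v + 2), distCoeff w' i * (coordOf N l (bitsOf w) i : ℝ)
      = (N : ℝ) - l - hammingDist w w' := by
  rw [Finset.sum_range_succ', Finset.sum_range_succ', Finset.sum_range]
  have h : (hammingDist w w' : ℝ)
      = ∑ i : Fin v, ((bitsOf w i : ℝ) + bitsOf w' i - 2 * bitsOf w' i * bitsOf w i) := by
    unfold hammingDist
    rw [Finset.card_filter]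
    push_cast
    refine Finset.sum_congr rfl fun i _ => ?_
    rw [bitsOf_val, bitsOf_val]
    cases w i <;> cases w' i <;> norm_num
  rw [h]
  simp only [distCoeff, coordOf, Nat.cast_sub hl]
  simp only [Finset.sum_sub_distrib, Finset.sum_add_distrib, sub_mul, one_mul, Nat.cast_one,
    mul_one]
  ring

end Distance

/-! ### The MDP of a formula -/

section MDP

variable {v : ℕ} (φ : CNF3 v) (r : ℕ) (target : Option (Fin v → Bool))

/-- The mean reward at the end of the process: a power of a linear function of the level and the
distance to the target. Without target, there are no rewards. -/
noncomputable def goalProb : SatState v ((v + 2) ^ r) → ℝ≥0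
  | none => 0
  | some (l, w) =>
    match target with
    | none => 0
    | some w' => ((((v + 2) ^ r + v - l - hammingDist w w' : ℕ) : ℝ≥0)
        / (((v + 2) ^ r + v : ℕ) : ℝ≥0)) ^ r

theorem goalProb_le_one (s : SatState v ((v + 2) ^ r)) : goalProb r target s ≤ 1 := by
  rcases s with _ | ⟨l, w⟩
  · simp [goalProb]
  · rcases target with _ | w'
    · simp [goalProb]
    · refine pow_le_one₀ bot_le (div_le_one_of_le₀ ?_ bot_le)
      exact_mod_cast (by omega : (v + 2) ^ r + v - l - hammingDist w w' ≤ (v + 2) ^ r + v)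

/-- The MDP whose states are the assignments at every level. In a state which is neither solved nor
at the last level, an action chooses a literal of a violated clause, which is made true. -/
noncomputable def satMDP : DetMDP 3 ((v + 2) ^ r) where
  State := SatState v ((v + 2) ^ r)
  code := SatState.code
  code_injective := SatState.code_injective
  bot := none
  code_bot := rfl
  start := some (⟨0, by positivity⟩, fun _ => false)
  trans := satNext φ
  trans_bot _ := rfl
  reward s _ := if IsSolved φ s ∨ IsLeaf s then
    coinReward (goalProb r target s) (goalProb_le_one r target s) else PMF.pure 0
  reward_mem s a x hx := by
    split_ifs at hx
    · rcases coinReward_support hx with rfl | rfl <;> simp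
    · simp only [PMF.support_pure, Set.mem_singleton_iff] at hx
      simp [hx]
  reward_bot _ := by simp [IsSolved, IsLeaf]
  horizon := (v + 2) ^ r
  trans_horizon s a := by
    set F : ℕ → SatState v ((v + 2) ^ r) :=
      fun t => Nat.rec (motive := fun _ => SatState v ((v + 2) ^ r)) s
        (fun t s' => satNext φ s' (a t)) t with hF
    -- After `t` actions the level is at least `t`, so no proper state is left at time `(v + 2) ^
    -- r`.
    have h : ∀ t l w, F t = some (l, w) → t ≤ l := by
      intro t
      induction t with
      | zero => intro l w _; exact Nat.zero_le _
      | succ t ih =>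
        intro l w hs
        obtain ⟨l', w', h1, h2⟩ := satNext_level φ hs
        have := ih l' w' h1
        omega
    change F ((v + 2) ^ r) = none
    cases hx : F ((v + 2) ^ r) with
    | none => rfl
    | some x => exact absurd (h _ x.1 x.2 hx) (not_le.2 x.1.2)
  featV s n := (featOf r s n : ℚ)
  -- In a solved or last-level state every action collects the final reward and ends the process, so
  -- the `Q`-value is the value of the state itself. Elsewhere there is no reward, and it is the
  -- value of the successor.
  featQ s a n := ((if IsSolved φ s ∨ IsLeaf s then featOf r s n
    else featOf r (satNext φ s a) n : ℕ) : ℚ)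

theorem satMDP_meanReward (s : SatState v ((v + 2) ^ r)) (a : Fin 3) :
    (satMDP φ r target).meanReward s a
      = if IsSolved φ s ∨ IsLeaf s then (goalProb r target s : ℝ) else 0 := by
  unfold DetMDP.meanReward
  by_cases h : IsSolved φ s ∨ IsLeaf s
  · rw [if_pos h, ← coinReward_mean _ (goalProb_le_one r target s)]
    simp only [satMDP, h, if_true]
  · rw [if_neg h]
    simp only [satMDP, h, if_false]
    rw [tsum_eq_single 0]
    · simp
    · intro x hx
      simp [hx]

variable {φ target} in
-- The level rises by one while the distance falls by at most one; the end state has value zero.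
theorem goalProb_next_le (s : SatState v ((v + 2) ^ r)) (a : Fin 3) :
    goalProb r target (satNext φ s a) ≤ goalProb r target s := by
  rcases s with _ | ⟨l, w⟩
  · simp [satNext]
  · simp only [satNext]
    split
    · simp [goalProb]
    · split_ifs
      · rcases target with _ | w'
        · simp [goalProb]
        · simp only [goalProb]
          refine pow_le_pow_left₀ bot_le (div_le_div_of_nonneg_right (Nat.cast_le.2 ?_) bot_le) r
          have := hammingDist_le_update w w' ((‹Clause3 v› a).1)
          omega
      · simp [goalProb]

variable {φ target} in
-- The target makes some literal of the violated clause true, on whose variable the current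
-- assignment is wrong. Flipping it lowers the distance by exactly one, which compensates for the
-- higher level.
theorem exists_goalProb_next_eq (ht : ∀ w ∈ target, φ.Satisfies w) {s : SatState v ((v + 2) ^ r)}
    (h : ¬ (IsSolved φ s ∨ IsLeaf s)) :
    ∃ a, goalProb r target (satNext φ s a) = goalProb r target s := by
  rcases s with _ | ⟨l, w⟩
  · exact ⟨0, rfl⟩
  · simp only [IsSolved, IsLeaf, not_or] at h
    obtain ⟨h1, h2⟩ := h
    obtain ⟨c, hc⟩ := Option.ne_none_iff_exists'.1 h1
    have hl : (l : ℕ) + 1 < (v + 2) ^ r := lt_of_le_of_ne l.2 h2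
    rcases target with _ | w'
    · refine ⟨0, ?_⟩
      simp [goalProb, satNext, hc, hl]
    · obtain ⟨hmem, hviol⟩ := CNF3.lastViolated_eq_some hc
      obtain ⟨a, ha⟩ := ht w' rfl c hmem
      refine ⟨a, ?_⟩
      have hne : w (c a).1 ≠ w' (c a).1 := ha ▸ hviol a
      have := hammingDist_update_of_ne hne
      simp only [goalProb, satNext, hc, hl, dif_pos]
      congr 3
      omega

/-- `goalProb` solves the Bellman equation: in solved and last-level states the immediate reward is
the whole value, and elsewhere `goalProb_next_le` and `exists_goalProb_next_eq` apply. -/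
theorem satMDP_optimal (ht : ∀ w ∈ target, φ.Satisfies w) :
    (∀ s : SatState v ((v + 2) ^ r), (satMDP φ r target).Vstar s = goalProb r target s) ∧
    ∀ (s : SatState v ((v + 2) ^ r)) (a : Fin 3), (satMDP φ r target).Qstar s a
      = if IsSolved φ s ∨ IsLeaf s then (goalProb r target s : ℝ)
        else goalProb r target (satNext φ s a) := by
  have hend : ∀ (s : SatState v ((v + 2) ^ r)) (a : Fin 3), IsSolved φ s ∨ IsLeaf s →
      goalProb r target (satNext φ s a) = 0 := by
    intro s a h
    rw [h.elim (fun h => satNext_of_isSolved φ h a) (fun h => satNext_of_isLeaf φ h a)]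
    rfl
  have H := (satMDP φ r target).optimal_of_bellman 
    (g := fun s : SatState v ((v + 2) ^ r) => (goalProb r target s : ℝ))
    (by simp [satMDP, goalProb]) ?_ ?_
  · refine ⟨H.1, fun s a => (H.2 s a).trans ?_⟩
    rw [satMDP_meanReward]
    change _ + (goalProb r target (satNext φ s a) : ℝ) = _
    split_ifs with h
    · simp [hend s a h]
    · simp
  · intro (s : SatState v ((v + 2) ^ r)) a
    rw [satMDP_meanReward]
    change _ + (goalProb r target (satNext φ s a) : ℝ) ≤ _
    split_ifs with h
    · simp [hend s a h]
    · simpa using goalProb_next_le r s a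
  · intro (s : SatState v ((v + 2) ^ r))
    simp only [satMDP_meanReward]
    by_cases h : IsSolved φ s ∨ IsLeaf s
    · refine ⟨0, ?_⟩
      change _ + (goalProb r target (satNext φ s 0) : ℝ) = _
      simp [hend s 0 h, h]
    · obtain ⟨a, ha⟩ := exists_goalProb_next_eq r ht h
      refine ⟨a, ?_⟩
      change _ + (goalProb r target (satNext φ s a) : ℝ) = _
      simp [h, ha]

/-- The parameter is the tensor power of the coefficient vector of `N - l - dist`, scaled by `(1 /
N) ^ r`. Only the parameter depends on the target. -/
theorem exists_goalProb_linear : ∃ θ : Fin ((v + 2) ^ r) → ℝ,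
    ∀ s, (goalProb r target s : ℝ) = ∑ n, θ n * (featOf r s n : ℝ) := by
  rcases target with _ | w'
  · exact ⟨0, fun s => by rcases s with _ | ⟨l, w⟩ <;> simp [goalProb]⟩
  · set N := (v + 2) ^ r + v with hN
    have hNpos : 0 < N := by positivity
    refine ⟨fun n => (1 / (N : ℝ)) ^ r *
      treeProd (v + 2) (distCoeff w') (levelStart (v + 2) r + n), fun s => ?_⟩
    rcases s with _ | ⟨l, w⟩
    · simp [goalProb, featOf]
    · have hl : (l : ℕ) ≤ N := by have := l.2; omega
      have hd : hammingDist w w' ≤ v := by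
        simpa using hammingDist_le_card_fintype (x := w) (y := w')
      have hcast : ∀ j, ((treeProd (v + 2) (coordOf N l (bitsOf w)) j : ℕ) : ℝ)
          = treeProd (v + 2) (fun i => (coordOf N l (bitsOf w) i : ℝ)) j := by
        intro j
        induction j using Nat.strong_induction_on with
        | _ j ih =>
          cases j with
          | zero => simp [treeProd]
          | succ j =>
            rw [treeProd, treeProd, Nat.cast_mul, ih _ (Nat.lt_succ_of_le (Nat.div_le_self _ _))]
      simp only [goalProb, featOf, ← hN, hcast]
      rw [← Finset.sum_range (fun n => (1 / (N : ℝ)) ^ r *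
        treeProd (v + 2) (distCoeff w') (levelStart (v + 2) r + n) *
        treeProd (v + 2) (fun i => (coordOf N l (bitsOf w) i : ℝ)) (levelStart (v + 2) r + n))]
      simp only [mul_assoc]
      rw [← Finset.mul_sum, sum_treeProd, sum_distCoeff _ _ hl, ← mul_pow]
      simp only [NNReal.coe_pow, NNReal.coe_div, NNReal.coe_natCast]
      congr 1
      -- This is why `N` exceeds the number of levels by `v`: the truncated subtractions in
      -- `goalProb` are genuine, so the value really is linear.
      have h1 : hammingDist w w' ≤ N - l := by have := l.2; omega
      rw [Nat.cast_sub h1, Nat.cast_sub hl]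
      ring

theorem satMDP_linear (ht : ∀ w ∈ target, φ.Satisfies w) :
    (satMDP φ r target).LinearOptimalValues := by
  obtain ⟨θ, hθ⟩ := exists_goalProb_linear r target
  obtain ⟨hV, hQ⟩ := satMDP_optimal φ r target ht
  refine ⟨θ, fun s => ?_, fun s a => ?_⟩
  · refine (hV s).trans ((hθ s).trans ?_)
    simp [satMDP]
  · refine (hQ s a).trans ?_
    by_cases h : IsSolved φ s ∨ IsLeaf s
    · refine (if_pos h).trans ((hθ s).trans ?_)
      simp [satMDP, h]
    · refine (if_neg h).trans ((hθ _).trans ?_)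
      simp [satMDP, h]

end MDP

/-! ### Size and error bounds -/

/-- The requirement `8 ≤ r` enters here. The inequality makes `d` large compared with `r ^ 2 * v`,
as needed for the bit lengths and for the value of the starting state. -/
theorem sq_mul_le_pow (v : ℕ) {r : ℕ} (hr : 8 ≤ r) : r ^ 2 * (v + 2) ≤ (v + 2) ^ r := by
  have h : ∀ n, 8 ≤ n → n ^ 2 ≤ 2 ^ (n - 1) := by
    intro n hn
    induction n, hn using Nat.le_induction with
    | base => norm_num
    | succ n hn ih =>
      obtain ⟨m, rfl⟩ : ∃ m, n = m + 1 := ⟨n - 1, by omega⟩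
      simp only [Nat.add_sub_cancel] at ih ⊢
      rw [pow_succ 2 m]
      nlinarith
  obtain ⟨m, rfl⟩ : ∃ m, r = m + 1 := ⟨r - 1, by omega⟩
  rw [pow_succ (v + 2) m]
  refine Nat.mul_le_mul_right _ ((h _ hr).trans ?_)
  exact Nat.pow_le_pow_left (by omega) _

section

variable {v : ℕ} (φ : CNF3 v) {r : ℕ} (target : Option (Fin v → Bool))

theorem satMDP_code_lt (hr : 8 ≤ r) (s : SatState v ((v + 2) ^ r)) :
    s.code < 2 ^ ((v + 2) ^ r + 1) := by
  have h1 := s.code_lt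
  have h2 := sq_mul_le_pow v hr
  have h3 : (v + 2) ^ r ≤ 2 ^ ((v + 2) * r) := by
    rw [pow_mul]
    exact Nat.pow_le_pow_left (Nat.lt_two_pow_self).le _
  have h4 : (v + 2) * r + v ≤ (v + 2) ^ r := by
    have h5 := Nat.mul_le_mul_right (v + 2) (by nlinarith : 8 * r ≤ r ^ 2)
    nlinarith
  have h5 : (v + 2) ^ r * 2 ^ v ≤ 2 ^ ((v + 2) ^ r) := by
    calc (v + 2) ^ r * 2 ^ v ≤ 2 ^ ((v + 2) * r) * 2 ^ v := Nat.mul_le_mul_right _ h3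
      _ = 2 ^ ((v + 2) * r + v) := (pow_add _ _ _).symm
      _ ≤ _ := Nat.pow_le_pow_right two_pos h4
  have h6 : 0 < 2 ^ ((v + 2) ^ r) := by positivity
  rw [pow_succ]
  omega

/-- A feature is at most `N ^ r ≤ (2 * d) ^ r`, whose binary logarithm is at most `r + (v + 1) * r ^
2 ≤ d`. -/
theorem featOf_lt (hr : 8 ≤ r) (s : SatState v ((v + 2) ^ r)) {n : ℕ} (hn : n < (v + 2) ^ r) :
    featOf r s n < 2 ^ ((v + 2) ^ r + 1) := by
  have h2 := sq_mul_le_pow v hr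
  refine (featOf_le r s hn).trans_lt ?_
  calc ((v + 2) ^ r + v) ^ r ≤ (2 * (v + 2) ^ r) ^ r := by
        gcongr
        have : v + 2 ≤ (v + 2) ^ r := Nat.le_self_pow (by omega) _
        omega
    _ = 2 ^ r * (v + 2) ^ (r ^ 2) := by rw [mul_pow, ← pow_mul, sq]
    _ ≤ 2 ^ r * 2 ^ ((v + 1) * r ^ 2) := by
        refine Nat.mul_le_mul_left _ ?_
        rw [pow_mul]
        exact Nat.pow_le_pow_left (Nat.lt_two_pow_self (n := v + 1)) _
    _ = 2 ^ (r + (v + 1) * r ^ 2) := (pow_add _ _ _).symm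
    _ < _ := Nat.pow_lt_pow_right (by norm_num) (by nlinarith)

theorem satMDP_sizeBounded (hr : 8 ≤ r) {K b : ℕ} (hK : 1 ≤ K) (hb : 1 ≤ b) :
    (satMDP φ r target).SizeBounded K b := by
  have hd : (v + 2) ^ r + 1 ≤ ((v + 2) ^ r) ^ b + b :=
    Nat.add_le_add (Nat.le_self_pow (by omega) _) hb
  have hsize : ∀ n, n < 2 ^ ((v + 2) ^ r + 1) → n.size ≤ ((v + 2) ^ r) ^ b + b :=
    fun n hn => Nat.size_le.2 (hn.trans_le (Nat.pow_le_pow_right two_pos hd))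
  have hone : Nat.size 1 ≤ ((v + 2) ^ r) ^ b + b := hsize 1 (Nat.one_lt_pow (by omega) (by norm_num))
  refine ⟨Nat.le_mul_of_pos_left _ hK, fun s => hsize _ (satMDP_code_lt hr s), ?_, ?_, ?_⟩
  · intro (s : SatState v ((v + 2) ^ r)) a x hx
    obtain ⟨h0, h1⟩ := (satMDP φ r target).reward_mem s a x hx
    have hx' : x = 1 ∨ x = 0 := by
      change x ∈ (if IsSolved φ s ∨ IsLeaf s then _ else _ : PMF ℚ).support at hx
      split_ifs at hx
      · exact coinReward_support hx
      · exact Or.inr (by simpa using hx)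
    rcases hx' with rfl | rfl
    · exact ⟨hone, hone⟩
    · exact ⟨by simp, hone⟩
  · intro s i
    exact ⟨by simpa [satMDP] using hsize _ (featOf_lt hr s i.2), by simpa [satMDP] using hone⟩
  · intro (s : SatState v ((v + 2) ^ r)) a i
    simp only [satMDP, Rat.num_natCast, Int.natAbs_natCast, Rat.den_natCast]
    refine ⟨?_, hone⟩
    split_ifs
    · exact hsize _ (featOf_lt hr s i.2)
    · exact hsize _ (featOf_lt hr _ i.2)

/-- At the last level the expected reward is tiny. -/
theorem goalProb_le_of_isLeaf {s : SatState v ((v + 2) ^ r)} (hr : 8 ≤ r) (hs : IsLeaf s) :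
    goalProb r target s ≤ (((v : ℝ≥0) + 2) ^ (r * (r - 1)))⁻¹ := by
  rcases s with _ | ⟨l, w⟩
  · exact hs.elim
  · simp only [IsLeaf] at hs
    rcases target with _ | w'
    · simp [goalProb]
    · simp only [goalProb]
      have hpos : (0 : ℝ≥0) < (v : ℝ≥0) + 2 := by positivity
      rw [mul_comm r (r - 1), pow_mul, ← inv_pow]
      refine pow_le_pow_left₀ bot_le ?_ r
      -- On the last level `l = d - 1`, so the numerator is at most `v + 1`.
      have h1 : (((v + 2) ^ r + v - l - hammingDist w w' : ℕ) : ℝ≥0) ≤ (v : ℝ≥0) + 2 := by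
        have : (v + 2) ^ r + v - l - hammingDist w w' ≤ v + 2 := by omega
        exact_mod_cast this
      have h2 : ((v : ℝ≥0) + 2) ^ r ≤ (((v + 2) ^ r + v : ℕ) : ℝ≥0) := by
        push_cast
        exact le_add_of_nonneg_right bot_le
      calc _ ≤ ((v : ℝ≥0) + 2) / ((v : ℝ≥0) + 2) ^ r := div_le_div₀ bot_le h1 (by positivity) h2
        _ = _ := by
          obtain ⟨m, rfl⟩ : ∃ m, r = m + 1 := ⟨r - 1, by omega⟩
          rw [Nat.add_sub_cancel, pow_succ, div_mul_cancel_right₀ hpos.ne']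

/-- In the starting state, the expected reward is large. -/
theorem le_goalProb_start (hr : 8 ≤ r) (w' : Fin v → Bool) (h : 0 < (v + 2) ^ r) :
    (3 / 4 : ℝ) ≤ goalProb r (some w') (some (⟨0, h⟩, fun _ => false)) := by
  simp only [goalProb, NNReal.coe_pow, NNReal.coe_div, NNReal.coe_natCast]
  set N := (v + 2) ^ r + v with hN
  have hd : hammingDist (fun _ => false) w' ≤ v := by
    simpa using hammingDist_le_card_fintype (x := fun _ : Fin v => false) (y := w')
  have hNpos : (0 : ℝ) < N := by exact_mod_cast (by omega : 0 < N)
  have hsq := sq_mul_le_pow v hr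
  have hle : 4 * (r * v) ≤ N := by nlinarith
  -- Bernoulli's inequality: the value at the start is at least `(1 - v / N) ^ r ≥ 1 - r * v / N`,
  -- and `4 * r * v ≤ N`.
  have h1 : 1 + (r : ℝ) * (-(v / N)) ≤ (1 + -(v / N : ℝ)) ^ r := by
    refine one_add_mul_le_pow ?_ r
    have : (v : ℝ) / N ≤ 1 := div_le_one_of_le₀ (by exact_mod_cast (by omega : v ≤ N)) hNpos.le
    linarith
  have h2 : (r : ℝ) * (v / N) ≤ 1 / 4 := by
    rw [← mul_div_assoc, div_le_iff₀ hNpos]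
    have : (4 : ℝ) * (r * v) ≤ N := by exact_mod_cast hle
    linarith
  have h3 : (1 + -(v / N : ℝ)) ≤ ((N - 0 - hammingDist (fun _ => false) w' : ℕ) : ℝ) / N := by
    rw [le_div_iff₀ hNpos, add_mul, neg_mul, div_mul_cancel₀ _ hNpos.ne', one_mul, Nat.sub_zero,
      Nat.cast_sub (by omega)]
    have : (hammingDist (fun _ => false) w' : ℝ) ≤ v := by exact_mod_cast hd
    linarith
  have h4 : 0 ≤ 1 + -(v / N : ℝ) := by
    have : (v : ℝ) / N ≤ 1 := div_le_one_of_le₀ (by exact_mod_cast (by omega : v ≤ N)) hNpos.le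
    linarith
  have h5 := pow_le_pow_left₀ h4 h3 r
  linarith

theorem satMDP_path_level {a : ℕ → Fin 3} {t : ℕ} {l : Fin ((v + 2) ^ r)} {w : Fin v → Bool}
    (h : (satMDP φ r target).path (satMDP φ r target).start a t = some (l, w)) : (l : ℕ) = t := by
  induction t generalizing l w with
  | zero =>
    change some (⟨0, _⟩, _) = some (l, w) at h
    simp only [Option.some.injEq, Prod.mk.injEq] at h
    rw [← h.1]
  | succ t ih =>
    obtain ⟨l', w', h1, h2⟩ := satNext_level φ (a := a t) h
    rw [h2, ih h1]

/-- Nearly optimal actions lead to a solution. -/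
theorem exists_isSolved_of_goodActions (hr : 8 ≤ r) {w' : Fin v → Bool} (hw : φ.Satisfies w')
    {a : ℕ → Fin 3} (h : (satMDP φ r (some w')).GoodActions a) :
    ∃ t < (v + 2) ^ r, IsSolved φ
      ((satMDP φ r (some w')).path (satMDP φ r (some w')).start a t : SatState v ((v + 2) ^ r)) := by
  by_contra hcon
  push Not at hcon
  set M := satMDP φ r (some w') with hM
  obtain ⟨π, hπ, hV⟩ := h
  have hopt : M.Vstar M.start = goalProb r (some w') M.start :=
    (satMDP_optimal φ r (some w') (by simpa using hw)).1 _
  have hstart : (3 / 4 : ℝ) ≤ M.Vstar M.start :=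
    hopt.ge.trans' (le_goalProb_start hr w' (by positivity))
  have htraj : ∀ t, M.traj π M.start t = M.path M.start a t := by
    intro t
    induction t with
    | zero => rfl
    | succ t ih =>
      rw [DetMDP.traj_succ, ih]
      change _ = M.trans (M.path M.start a t) (a t)
      -- Behind the end state the policy may differ from the sequence, but then both stay there.
      by_cases hb : M.path M.start a t = M.bot
      · rw [hb, M.trans_bot, M.trans_bot]
      · rw [hπ t hb]
  have hB : (1 : ℝ≥0) ≤ (v : ℝ≥0) + 2 := by
    exact le_add_of_nonneg_of_le bot_le (by norm_num)
  -- Without a solved state on the way, the only possible reward comes at time `d - 1` on the last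
  -- level and has mean at most `1 / 4`. A good policy earns more than `3 / 4 - 1 / 4`.
  have hle : M.V π M.start ≤ 1 / 4 := by
    calc M.V π M.start ≤ ∑ t ∈ Finset.range ((v + 2) ^ r),
          if t = (v + 2) ^ r - 1 then (1 / 4 : ℝ) else 0 := by
          refine Finset.sum_le_sum fun t ht => ?_
          rw [htraj]
          refine (satMDP_meanReward φ r (some w') _ _).le.trans ?_
          have h1 := hcon t (Finset.mem_range.1 ht)
          by_cases h2 : IsLeaf (M.path M.start a t : SatState v ((v + 2) ^ r))
          · rw [if_pos (Or.inr h2)]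
            have h3 : t = (v + 2) ^ r - 1 := by
              cases h4 : (M.path M.start a t : SatState v ((v + 2) ^ r)) with
              | none => rw [h4] at h2; exact h2.elim
              | some x =>
                rw [h4] at h2
                have h5 := satMDP_path_level φ (some w') (l := x.1) (w := x.2) h4
                simp only [IsLeaf] at h2
                omega
            rw [if_pos h3]
            have h6 := goalProb_le_of_isLeaf (some w') hr h2
            have h7 : (((v : ℝ≥0) + 2) ^ (r * (r - 1)))⁻¹ ≤ 1 / 4 := by
              rw [inv_le_comm₀ (by positivity) (by norm_num)]
              calc ((1 / 4 : ℝ≥0))⁻¹ = 2 ^ 2 := by norm_num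
                _ ≤ ((v : ℝ≥0) + 2) ^ 2 := by
                  exact pow_le_pow_left₀ bot_le (le_add_of_nonneg_left bot_le) _
                _ ≤ _ := pow_le_pow_right₀ hB (by
                  calc 2 ≤ 8 * (8 - 1) := by norm_num
                    _ ≤ r * (r - 1) := Nat.mul_le_mul hr (by omega))
            exact_mod_cast h6.trans h7
          · rw [if_neg (by simp only [h2, or_false]; exact h1)]
            split_ifs <;> norm_num
      _ ≤ 1 / 4 := by
          rw [Finset.sum_ite_eq']
          split_ifs <;> norm_num
  linarith

/-! ### Answering queries without knowing the target -/

/-- The features of a state, or of the state reached. -/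
noncomputable def simFeat (r : ℕ) (s : SatState v ((v + 2) ^ r)) (n : Fin ((v + 2) ^ r)) : ℚ :=
  (featOf r s n : ℚ)

/-- The answers to the queries to the MDP of the formula. The rewards are taken to be `0`. There is
no answer if the query involves a solution of the formula. -/
noncomputable def satSim (r : ℕ) : RLQuery → Mem → Option Mem
  | .reward num den s _, μ =>
      if IsSolved φ (SatState.decode v ((v + 2) ^ r) (μ.reg s)) then none
      else some ((μ.setReg num 0).setReg den 1)
  | .trans x s a, μ =>
      let σ := SatState.decode v ((v + 2) ^ r) (μ.reg s)
      if IsSolved φ σ then none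
      else some (μ.setReg x (satNext φ σ (Fin.ofNat 3 (μ.reg a))).code)
  | .featV y s, μ =>
      some (μ.setArr y
        (writeVec (simFeat r (SatState.decode v ((v + 2) ^ r) (μ.reg s))) (μ.arr y)))
  | .featQ y s a, μ =>
      let σ := SatState.decode v ((v + 2) ^ r) (μ.reg s)
      -- On the last level the answer is the feature vector of the state itself, solved or not, so
      -- this case comes before the test of the formula.
      if IsLeaf σ then some (μ.setArr y (writeVec (simFeat r σ) (μ.arr y)))
      else if IsSolved φ σ then none
      else some (μ.setArr y
        (writeVec (simFeat r (satNext φ σ (Fin.ofNat 3 (μ.reg a)))) (μ.arr y)))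

theorem satMDP_decode (n : ℕ) :
    (satMDP φ r target).decode n = SatState.decode v ((v + 2) ^ r) n := by
  by_cases h : SatState.decode v ((v + 2) ^ r) n = none
  · rw [h]
    by_cases h' : ∃ s, (satMDP φ r target).code s = n
    · obtain ⟨s, rfl⟩ := h'
      rw [DetMDP.decode_code]
      exact (SatState.decode_code s).symm.trans h
    · exact (satMDP φ r target).decode_of_forall_ne (by simpa using h')
  · have := (satMDP φ r target).decode_code (SatState.decode v ((v + 2) ^ r) n)
    rwa [show (satMDP φ r target).code (SatState.decode v ((v + 2) ^ r) n) = n from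
      SatState.code_decode h] at this

/-- All answers are exact except the reward `0` in an unsolved state of the last level, which has
true probability `1 - goalProb`. -/
theorem satSim_approx {a : ℝ≥0∞} (ha : 1 ≤ a)
    (hleaf : ∀ s : SatState v ((v + 2) ^ r), IsLeaf s →
      1 ≤ a * (1 - (goalProb r target s : ℝ≥0∞)))
    (o : RLQuery) (μ μ' : Mem) (h : satSim φ r o μ = some μ') :
    1 ≤ a * mdpAnswer (satMDP φ r target) o μ μ' := by
  have hpure : ∀ p : PMF Mem, p = PMF.pure μ' → 1 ≤ a * p μ' := by
    rintro p rfl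
    simpa using ha
  cases o with
  | reward num den s b =>
    simp only [satSim] at h
    split_ifs at h with hs
    simp only [Option.some.injEq] at h
    subst h
    set σ : SatState v ((v + 2) ^ r) := SatState.decode v ((v + 2) ^ r) (μ.reg s) with hσ
    have h1 : 1 ≤ a * (satMDP φ r target).reward σ (Fin.ofNat 3 (μ.reg b)) 0 := by
      by_cases hl : IsLeaf σ
      · have h2 : (satMDP φ r target).reward σ (Fin.ofNat 3 (μ.reg b))
            = coinReward (goalProb r target σ) (goalProb_le_one r target σ) :=
          if_pos (Or.inr hl)
        rw [h2, coinReward_zero]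
        exact hleaf σ hl
      · have h2 : (satMDP φ r target).reward σ (Fin.ofNat 3 (μ.reg b)) = PMF.pure 0 :=
          if_neg (by simp [hl, hs])
        rw [h2]
        simpa using ha
    refine h1.trans ?_
    gcongr
    simp only [mdpAnswer, satMDP_decode]
    rw [PMF.map_apply]
    refine le_trans (le_of_eq ?_) (ENNReal.le_tsum 0)
    simp [hσ]
  | trans x s b =>
    simp only [satSim] at h
    split_ifs at h with hs
    simp only [Option.some.injEq] at h
    refine hpure _ ?_
    simp only [mdpAnswer, satMDP_decode, ← h]
    rfl
  | featV y s =>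
    simp only [satSim, Option.some.injEq] at h
    refine hpure _ ?_
    simp only [mdpAnswer, satMDP_decode, ← h]
    rfl
  | featQ y s b =>
    simp only [satSim] at h
    refine hpure _ ?_
    simp only [mdpAnswer, satMDP_decode]
    congr 1
    split_ifs at h with h1 h2
    · simp only [Option.some.injEq] at h
      rw [← h]
      congr 2
      funext n
      simp [satMDP, simFeat, h1]
    · simp only [Option.some.injEq] at h
      rw [← h]
      congr 2
      funext n
      simp [satMDP, simFeat, h1, h2]

end

/-! ### Deterministic program fragments -/

@[simp] theorem Mem.setReg_reg (μ : Mem) (x n y : ℕ) :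
    (μ.setReg x n).reg y = if y = x then n else μ.reg y := by
  simp [Mem.setReg, Function.update_apply]

@[simp] theorem Mem.setReg_arr (μ : Mem) (x n : ℕ) : (μ.setReg x n).arr = μ.arr := rfl

@[simp] theorem Mem.setArr_reg (μ : Mem) (a : ℕ) (f : ℕ → ℕ) : (μ.setArr a f).reg = μ.reg := rfl

@[simp] theorem Mem.setArr_arr (μ : Mem) (a : ℕ) (f : ℕ → ℕ) (b : ℕ) :
    (μ.setArr a f).arr b = if b = a then f else μ.arr b := by
  simp [Mem.setArr, Function.update_apply]

/-- Programs without oracle have no queries to be answered. -/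
abbrev noAns : Empty → Mem → PMF Mem := fun o _ => o.elim

/-- Started on `μ`, the program halts within `t` steps, deterministically, in a memory satisfying
`Q`. -/
def Det (c : Cmd Empty) (t : ℕ) (μ : Mem) (Q : Mem → Prop) : Prop :=
  ∃ μ' n, n ≤ t ∧ Q μ' ∧ ∀ k, runFor noAns n (c :: k, μ) = PMF.pure (k, μ')

/-- The effect of an elementary deterministic instruction. -/
def Cmd.exec : Cmd Empty → Mem → Mem
  | .const x n, μ => μ.setReg x n
  | .add x y z, μ => μ.setReg x (μ.reg y + μ.reg z)
  | .sub x y z, μ => μ.setReg x (μ.reg y - μ.reg z)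
  | .half x y, μ => μ.setReg x (μ.reg y / 2)
  | .load x a i, μ => μ.setReg x (μ.arr a (μ.reg i))
  | .store a i x, μ => μ.setArr a (Function.update (μ.arr a) (μ.reg i) (μ.reg x))
  | _, μ => μ

/-- Elementary deterministic instructions. -/
def Cmd.IsBasic : Cmd Empty → Prop
  | .flip _ | .call _ | .seq _ _ | .ite _ _ _ | .while _ _ => False
  | _ => True

/-- A sequence of commands. -/
def block : List (Cmd Empty) → Cmd Empty
  | [] => .skip
  | c :: L => .seq c (block L)

/-- The effect of a sequence of elementary instructions. -/
def execs (L : List (Cmd Empty)) (μ : Mem) : Mem := L.foldl (fun μ c => c.exec μ) μ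

theorem Det.mono {c : Cmd Empty} {t t' : ℕ} {μ : Mem} {Q Q' : Mem → Prop} (h : Det c t μ Q)
    (ht : t ≤ t') (hQ : ∀ μ', Q μ' → Q' μ') : Det c t' μ Q' := by
  obtain ⟨μ', n, hn, h1, h2⟩ := h
  exact ⟨μ', n, hn.trans ht, hQ _ h1, h2⟩

theorem Det.skip {μ : Mem} {Q : Mem → Prop} (h : Q μ) : Det .skip 1 μ Q :=
  ⟨μ, 1, le_rfl, h, fun k => by simp [runFor, step]⟩

theorem Det.basic {c : Cmd Empty} (hc : c.IsBasic) {μ : Mem} {Q : Mem → Prop} (h : Q (c.exec μ)) :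
    Det c 1 μ Q := by
  refine ⟨c.exec μ, 1, le_rfl, h, fun k => ?_⟩
  cases c <;> first | exact hc.elim | simp [runFor, step, Cmd.exec]

theorem Det.seq {c₁ c₂ : Cmd Empty} {t₁ t₂ : ℕ} {μ : Mem} {Q : Mem → Prop}
    (h : Det c₁ t₁ μ fun μ' => Det c₂ t₂ μ' Q) : Det (.seq c₁ c₂) (t₁ + t₂ + 1) μ Q := by
  obtain ⟨μ₁, n₁, hn₁, ⟨μ₂, n₂, hn₂, hQ, h₂⟩, h₁⟩ := h
  refine ⟨μ₂, (n₁ + n₂) + 1, by omega, hQ, fun k => ?_⟩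
  simp [runFor, step, runFor_add, h₁, h₂]

theorem Det.ite {x : ℕ} {c₁ c₂ : Cmd Empty} {t : ℕ} {μ : Mem} {Q : Mem → Prop}
    (h₁ : μ.reg x ≠ 0 → Det c₁ t μ Q) (h₂ : μ.reg x = 0 → Det c₂ t μ Q) :
    Det (.ite x c₁ c₂) (t + 1) μ Q := by
  by_cases hx : μ.reg x = 0
  · obtain ⟨μ', n, hn, hQ, h⟩ := h₂ hx
    exact ⟨μ', n + 1, by omega, hQ, fun k => by simp [runFor, step, hx, h]⟩
  · obtain ⟨μ', n, hn, hQ, h⟩ := h₁ hx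
    exact ⟨μ', n + 1, by omega, hQ, fun k => by simp [runFor, step, hx, h]⟩

/-- The index of the invariant `I` bounds the number of iterations still to come, so it serves for
both termination and the time bound. -/
theorem Det.while {x : ℕ} {c : Cmd Empty} {t : ℕ} {Q : Mem → Prop} (I : ℕ → Mem → Prop)
    (hstep : ∀ n μ, I n μ → μ.reg x ≠ 0 → ∃ m, n = m + 1 ∧ Det c t μ (I m))
    (hend : ∀ n μ, I n μ → μ.reg x = 0 → Q μ) {n : ℕ} {μ : Mem} (h : I n μ) :
    Det (.while x c) (n * (t + 1) + 1) μ Q := by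
  induction n generalizing μ with
  | zero =>
    have hx : μ.reg x = 0 := by
      by_contra hx
      obtain ⟨m, hm, -⟩ := hstep 0 μ h hx
      omega
    exact ⟨μ, 1, by omega, hend 0 μ h hx, fun k => by simp [runFor, step, hx]⟩
  | succ n ih =>
    by_cases hx : μ.reg x = 0
    · exact ⟨μ, 1, by omega, hend _ μ h hx, fun k => by simp [runFor, step, hx]⟩
    · obtain ⟨m, hm, μ₁, n₁, hn₁, hI, h₁⟩ := hstep _ μ h hx
      obtain rfl : n = m := by omega
      obtain ⟨μ₂, n₂, hn₂, hQ, h₂⟩ := ih hI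
      refine ⟨μ₂, (n₁ + n₂) + 1, by rw [Nat.add_mul]; omega, hQ, fun k => ?_⟩
      simp [runFor, step, hx, runFor_add, h₁, h₂]

theorem Det.block {L : List (Cmd Empty)} (hL : ∀ c ∈ L, c.IsBasic) {μ : Mem} {Q : Mem → Prop}
    (h : Q (execs L μ)) : Det (block L) (2 * L.length + 1) μ Q := by
  induction L generalizing μ with
  | nil => exact Det.skip h
  | cons c L ih =>
    refine (Det.seq (t₁ := 1) (t₂ := 2 * L.length + 1) (Det.basic (hL c (by simp)) ?_)).mono ?_
      fun _ h => h
    · exact ih (fun c hc => hL c (by simp [hc])) h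
    · simp only [List.length_cons]; omega

/-- Registers from `n` on are kept, and so are the input array and all arrays from `k` on. -/
structure Keeps (n k : ℕ) (μ μ' : Mem) : Prop where
  reg : ∀ x, n ≤ x → μ'.reg x = μ.reg x
  arr : ∀ a, a = 0 ∨ k ≤ a → μ'.arr a = μ.arr a

theorem Keeps.refl (n k : ℕ) (μ : Mem) : Keeps n k μ μ := ⟨fun _ _ => rfl, fun _ _ => rfl⟩

theorem Keeps.trans {n k : ℕ} {μ₁ μ₂ μ₃ : Mem} (h : Keeps n k μ₁ μ₂) (h' : Keeps n k μ₂ μ₃) :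
    Keeps n k μ₁ μ₃ :=
  ⟨fun x hx => (h'.reg x hx).trans (h.reg x hx), fun a ha => (h'.arr a ha).trans (h.arr a ha)⟩

theorem Keeps.mono {n n' k k' : ℕ} {μ μ' : Mem} (h : Keeps n k μ μ') (hn : n ≤ n') (hk : k ≤ k') :
    Keeps n' k' μ μ' :=
  ⟨fun x hx => h.reg x (hn.trans hx), fun a ha => h.arr a (ha.imp_right fun h => hk.trans h)⟩

/-- The instruction writes only to registers below `n` and to arrays between `1` and `k`. -/
def Cmd.WritesBelow (n k : ℕ) : Cmd Empty → Prop
  | .const x _ | .add x _ _ | .sub x _ _ | .half x _ | .load x _ _ => x < n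
  | .store a _ _ => 1 ≤ a ∧ a < k
  | _ => True

theorem Keeps.exec {n k : ℕ} {c : Cmd Empty} (hc : c.WritesBelow n k) (μ : Mem) :
    Keeps n k μ (c.exec μ) := by
  cases c
  case store a i x =>
    refine ⟨fun y hy => rfl, fun b hb => ?_⟩
    have : b ≠ a := by simp only [Cmd.WritesBelow] at hc; omega
    simp [Cmd.exec, this]
  all_goals
    refine ⟨fun y hy => ?_, fun b hb => rfl⟩
    first
    | rfl
    | (simp only [Cmd.exec, Mem.setReg_reg]
       rw [if_neg]
       simp only [Cmd.WritesBelow] at hc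
       omega)

theorem Keeps.execs {n k : ℕ} {L : List (Cmd Empty)} (hL : ∀ c ∈ L, c.WritesBelow n k) (μ : Mem) :
    Keeps n k μ (execs L μ) := by
  induction L generalizing μ with
  | nil => exact Keeps.refl _ _ _
  | cons c L ih =>
    exact (Keeps.exec (hL c (by simp)) μ).trans (ih (fun c hc => hL c (by simp [hc])) _)

theorem Det.block_keeps {n k : ℕ} {L : List (Cmd Empty)} (hL : ∀ c ∈ L, c.IsBasic)
    (hL' : ∀ c ∈ L, c.WritesBelow n k) {μ : Mem} {Q : Mem → Prop}
    (h : Keeps n k μ (_root_.execs L μ) → Q (_root_.execs L μ)) :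
    Det (_root_.block L) (2 * L.length + 1) μ Q :=
  Det.block hL (h (Keeps.execs hL' μ))

/-! ### Reduction modulo 3 -/

/-- Reduce register `9` modulo `3`. -/
def modThree : Cmd Empty :=
  block [block [.const 5 3, .sub 8 9 5],
    .while 8 (block [.half 7 9, .half 7 7, .add 6 7 7, .add 6 6 6, .sub 6 9 6, .add 9 7 6,
      .sub 8 9 5]),
    block [.const 8 2, .sub 8 9 8, .sub 9 9 8, .sub 9 9 8, .sub 9 9 8]]

/-- Since `4 ≡ 1` modulo `3`, replacing `x` by `x / 4 + x % 4` keeps the residue, and it at least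
halves the excess `x - 3`. The loop stops with `x ≤ 3`; then the truncated difference `x - 2` is `1`
only for `x = 3`, and subtracting it three times finishes. -/
theorem det_modThree {Z : ℕ} {μ : Mem} (hZ : μ.reg 9 < 2 ^ Z) :
    Det modThree (16 * Z + 40) μ fun μ' => Keeps 10 1 μ μ' ∧ μ'.reg 9 = μ.reg 9 % 3 := by
  refine (Det.seq (t₁ := 5) (t₂ := 16 * Z + 30) ?_).mono (by omega) fun _ h => h
  refine Det.block_keeps (n := 10) (k := 1) (by simp [Cmd.IsBasic]) (by simp [Cmd.WritesBelow])
    fun hk => ?_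
  refine (Det.seq (t₁ := Z * 16 + 1) (t₂ := 13) ?_).mono (by omega) fun _ h => h
  refine Det.while (fun m μ' => Keeps 10 1 μ μ' ∧ μ'.reg 9 % 3 = μ.reg 9 % 3 ∧ μ'.reg 5 = 3 ∧
    μ'.reg 8 = μ'.reg 9 - 3 ∧ μ'.reg 8 < 2 ^ m) ?_ ?_ ?_
  · rintro n μ' ⟨h1, h2, h3, h4, h5⟩ h6
    cases n with
    | zero => simp only [pow_zero] at h5; omega
    | succ m =>
      refine ⟨m, rfl, Det.block_keeps (n := 10) (k := 1) (by simp [Cmd.IsBasic])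
        (by simp [Cmd.WritesBelow]) fun hk' => ⟨h1.trans hk', ?_⟩⟩
      rw [pow_succ] at h5
      simp [execs, Cmd.exec, h3]
      omega
  · rintro n μ' ⟨h1, h2, h3, h4, h5⟩ h6
    refine (Det.seq (t₁ := 11) (t₂ := 1) ?_).mono (by omega) fun _ h => h
    refine Det.block_keeps (n := 10) (k := 1) (by simp [Cmd.IsBasic])
        (by simp [Cmd.WritesBelow]) fun hk' => Det.skip ⟨h1.trans hk', ?_⟩
    simp [execs, Cmd.exec]
    omega
  · refine ⟨hk, ?_⟩
    simp [execs, Cmd.exec]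
    omega

/-! ### Simulating the local search process -/

/-- The registers and arrays which describe the formula and the parameters. -/
structure Ctx {v : ℕ} (φ : CNF3 v) (r : ℕ) (μ : Mem) : Prop where
  vars : μ.reg 20 = v
  len : μ.reg 21 = φ.length
  base : μ.reg 22 = v + 2
  dim : μ.reg 23 = (v + 2) ^ r
  top : μ.reg 24 = (v + 2) ^ r + v
  lev : μ.reg 25 = levelStart (v + 2) r
  one : μ.reg 33 = 1
  zero : μ.reg 34 = 0
  input : μ.arr 0 = (satInput φ).arr 0

theorem Ctx.keeps {v : ℕ} {φ : CNF3 v} {r n k : ℕ} {μ μ' : Mem} (h : Ctx φ r μ)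
    (hk : Keeps n k μ μ') (hn : n ≤ 20) : Ctx φ r μ' where
  vars := by rw [hk.reg _ (by omega), h.vars]
  len := by rw [hk.reg _ (by omega), h.len]
  base := by rw [hk.reg _ (by omega), h.base]
  dim := by rw [hk.reg _ (by omega), h.dim]
  top := by rw [hk.reg _ (by omega), h.top]
  lev := by rw [hk.reg _ (by omega), h.lev]
  one := by rw [hk.reg _ (by omega), h.one]
  zero := by rw [hk.reg _ (by omega), h.zero]
  input := by rw [hk.arr _ (Or.inl rfl), h.input]

/-- Array `1` holds the assignment. -/
def HoldsBits {v : ℕ} (w : Fin v → Bool) (μ : Mem) : Prop := ∀ i < v, μ.arr 1 i = bitsOf w i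

/-- Registers `10`, `11` and array `1` hold the state. -/
def Holds {v d : ℕ} : SatState v d → Mem → Prop
  | none, μ => μ.reg 10 = 0
  | some (l, w), μ => μ.reg 10 = d - l ∧ μ.reg 11 = l ∧ HoldsBits w μ

theorem Holds.keeps {v d n k : ℕ} {s : SatState v d} {μ μ' : Mem} (h : Holds s μ)
    (hk : Keeps n k μ μ') (hn : n ≤ 10) (hk1 : k ≤ 1) : Holds s μ' := by
  rcases s with _ | ⟨l, w⟩
  · exact (hk.reg _ (by omega)).trans h
  · exact ⟨(hk.reg _ (by omega)).trans h.1, (hk.reg _ (by omega)).trans h.2.1, fun i hi => by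
      rw [hk.arr _ (by omega), h.2.2 i hi]⟩

/-- Read the state with the code in register `0`. -/
def readState : Cmd Empty :=
  .seq (.const 10 0) (.ite 0
    (block [
      block [.sub 0 0 33, .add 1 34 34, .add 2 20 34],
      .while 2 (block [.half 3 0, .add 4 3 3, .sub 4 0 4, .store 1 1 4, .add 0 3 34, .add 1 1 33,
        .sub 2 2 33]),
      block [.add 11 0 34, .sub 10 23 11]])
    .skip)

/-- After `v` binary digits have been split off, the quotient is the level. If it is out of range,
the truncated difference `d - l` in register `10` vanishes, which is how the end state is
represented. -/
theorem det_readState {v r : ℕ} {φ : CNF3 v} {μ : Mem} (hμ : Ctx φ r μ) :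
    Det readState (16 * v + 40) μ fun μ' =>
      Keeps 12 2 μ μ' ∧ Holds (SatState.decode v ((v + 2) ^ r) (μ.reg 0)) μ' := by
  refine (Det.seq (t₁ := 1) (t₂ := 16 * v + 30) (Det.basic (by simp [Cmd.IsBasic]) ?_)).mono (by omega)
    fun _ h => h
  have hk0 := Keeps.exec (n := 12) (k := 2) (c := .const 10 0) (by simp [Cmd.WritesBelow]) μ
  set μ₀ := Cmd.exec (.const 10 0) μ with hμ₀
  have hr0 : μ₀.reg 0 = μ.reg 0 := by simp [hμ₀, Cmd.exec]
  have hc0 := hμ.keeps hk0 (by norm_num)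
  refine (Det.ite (t := 16 * v + 25) ?_ ?_).mono (by omega) fun _ h => h
  · intro h0
    rw [hr0] at h0
    refine (Det.seq (t₁ := 7) (t₂ := 16 * v + 15) ?_).mono (by omega) fun _ h => h
    refine Det.block_keeps (n := 12) (k := 2) (by simp [Cmd.IsBasic]) (by simp [Cmd.WritesBelow])
      fun hk => ?_
    refine (Det.seq (t₁ := v * 16 + 1) (t₂ := 9) ?_).mono (by omega) fun _ h => h
    refine Det.while (fun m μ' => Keeps 12 2 μ μ' ∧ μ'.reg 2 = m ∧ ∃ i, i + m = v ∧ μ'.reg 1 = i ∧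
      μ'.reg 0 = (μ.reg 0 - 1) / 2 ^ i ∧
      ∀ j < i, μ'.arr 1 j = (μ.reg 0 - 1) / 2 ^ j % 2) ?_ ?_ ?_
    · rintro n μ' ⟨h1, h2, i, hi, h3, h4, h5⟩ h6
      cases n with
      | zero => omega
      | succ m =>
        have hc := hμ.keeps h1 (by norm_num)
        refine ⟨m, rfl, Det.block_keeps (n := 12) (k := 2) (by simp [Cmd.IsBasic])
          (by simp [Cmd.WritesBelow]) fun hk' => ⟨h1.trans hk', ?_, i + 1, by omega, ?_, ?_, ?_⟩⟩
        · simp [execs, Cmd.exec, h2, hc.one]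
        · simp [execs, Cmd.exec, h3, hc.one]
        · simp [execs, Cmd.exec, h4, hc.zero, pow_succ, Nat.div_div_eq_div_mul]
        · intro j hj
          simp only [execs, Cmd.exec, List.foldl, Mem.setReg_arr, Mem.setArr_arr, Mem.setReg_reg,
            Function.update_apply, if_true, h3, h4]
          norm_num
          split_ifs with hji
          · subst hji
            omega
          · exact h5 j (by omega)
    · rintro n μ' ⟨h1, h2, i, hi, h3, h4, h5⟩ h6
      obtain rfl : n = 0 := by omega
      obtain rfl : i = v := by omega
      have hc := hμ.keeps h1 (by norm_num)
      refine (Det.seq (t₁ := 5) (t₂ := 1) ?_).mono (by omega) fun _ h => h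
      refine Det.block_keeps (n := 12) (k := 2) (by simp [Cmd.IsBasic]) (by simp [Cmd.WritesBelow])
        fun hk' => Det.skip ⟨h1.trans hk', ?_⟩
      unfold SatState.decode
      rw [if_neg h0]
      split_ifs with hd
      · refine ⟨?_, ?_, ?_⟩
        · simp [execs, Cmd.exec, h4, hc.zero, hc.dim]
        · simp [execs, Cmd.exec, h4, hc.zero]
        · intro j hj
          have h7 := Nat.mod_lt ((μ.reg 0 - 1) / 2 ^ j) two_pos
          have h8 : (execs [Cmd.add 11 0 34, Cmd.sub 10 23 11] μ').arr 1 j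
              = (μ.reg 0 - 1) / 2 ^ j % 2 := h5 j hj
          rw [h8]
          simp only [bitsOf, hj, dif_pos]
          by_cases h : (μ.reg 0 - 1) / 2 ^ j % 2 = 1 <;> simp [h]
          omega
      · simp only [Holds]
        simp [execs, Cmd.exec, h4, hc.zero, hc.dim]
        omega
    · refine ⟨hk0.trans hk, ?_, 0, by omega, ?_, ?_, by omega⟩
      · simp [execs, Cmd.exec, hc0.vars, hc0.zero]
      · simp [execs, Cmd.exec, hc0.zero]
      · simp [execs, Cmd.exec, hc0.one, hr0]
  · intro h0
    rw [hr0] at h0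
    refine Det.mono (Det.skip ⟨hk0, ?_⟩) (by omega) fun _ h => h
    simp [SatState.decode, h0, Holds, hμ₀, Cmd.exec]

/-- Subtract from register `3` the value of the literal at the address in register `1`, and go to
the next literal. -/
def evalLiteral : Cmd Empty :=
  -- For the literal `2 * i + β`, two opposite truncated differences give `|β - w i|`, and `1` minus
  -- this is the truth value of the literal.
  block [.load 4 0 1, .half 5 4, .load 6 1 5, .add 5 5 5, .sub 4 4 5, .sub 5 4 6, .sub 6 6 4,
    .add 5 5 6, .sub 5 33 5, .sub 3 3 5, .add 1 1 33]

theorem satInput_arr_zero {v : ℕ} {φ : CNF3 v} {c₀ : ℕ} {c : Clause3 v} (h : φ[c₀]? = some c)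
    (j : Fin 3) :
    (satInput φ).arr 0 (3 * c₀ + j) = 2 * (c j).1.val + (c j).2.toNat := by
  have h1 : (3 * c₀ + (j : ℕ)) / 3 = c₀ := by omega
  have h2 : Fin.ofNat 3 (3 * c₀ + (j : ℕ)) = j := by
    ext
    simp only [Fin.ofNat]
    omega
  simp only [satInput, if_true, h1, h, h2]

theorem det_evalLiteral {v r : ℕ} {φ : CNF3 v} {μ : Mem} (hμ : Ctx φ r μ) {w : Fin v → Bool}
    (hw : HoldsBits w μ) {c₀ : ℕ} {c : Clause3 v} (h : φ[c₀]? = some c) (j : Fin 3)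
    (hj : μ.reg 1 = 3 * c₀ + j) :
    Det evalLiteral 23 μ fun μ' => Keeps 7 1 μ μ' ∧ μ'.reg 0 = μ.reg 0 ∧ μ'.reg 2 = μ.reg 2 ∧
      μ'.reg 1 = μ.reg 1 + 1 ∧ μ'.reg 3 = μ.reg 3 - if w (c j).1 = (c j).2 then 1 else 0 := by
  refine Det.block_keeps (n := 7) (k := 1) (by simp [Cmd.IsBasic]) (by simp [Cmd.WritesBelow])
    fun hk' => ⟨hk', ?_, ?_, ?_, ?_⟩
  · simp [execs, Cmd.exec]
  · simp [execs, Cmd.exec]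
  · simp [execs, Cmd.exec, hμ.one]
  · have h1 : μ.arr 0 (μ.reg 1) = 2 * (c j).1.val + (c j).2.toNat := by
      rw [hμ.input, hj, satInput_arr_zero h]
    have h2 : (2 * (c j).1.val + (c j).2.toNat) / 2 = (c j).1.val := by
      have := Bool.toNat_lt (c j).2
      omega
    have h3 : μ.arr 1 (c j).1.val = (w (c j).1).toNat := by
      rw [hw _ (c j).1.2, bitsOf_val]
    have h4 : 2 * (c j).1.val + (c j).2.toNat - ((c j).1.val + (c j).1.val) = (c j).2.toNat := by
      omega
    simp only [execs, Cmd.exec, List.foldl, Mem.setReg_arr, Mem.setReg_reg, h1, hμ.one]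
    norm_num
    rw [h2, h3, h4]
    cases w (c j).1 <;> cases (c j).2 <;> simp

/-- Look for the last violated clause. Register `0` tells if there is one, and register `7` is the
address behind it. -/
def findViolated : Cmd Empty :=
  block [
    block [.const 0 0, .add 1 34 34, .add 2 21 34],
    .while 2 (block [.const 3 1, evalLiteral, evalLiteral, evalLiteral,
      .ite 3 (block [.const 0 1, .add 7 1 34]) .skip, .sub 2 2 33])]

theorem det_findViolated {v r : ℕ} {φ : CNF3 v} {μ : Mem} (hμ : Ctx φ r μ) {w : Fin v → Bool}
    (hw : HoldsBits w μ) :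
    Det findViolated (100 * φ.length + 20) μ fun μ' => Keeps 8 1 μ μ' ∧
      match φ.lastViolated w with
      | none => μ'.reg 0 = 0
      | some c => μ'.reg 0 = 1 ∧ ∃ c₀, φ[c₀]? = some c ∧ μ'.reg 7 = 3 * c₀ + 3 := by
  refine (Det.seq (t₁ := 7) (t₂ := 100 * φ.length + 10) ?_).mono (by omega) fun _ h => h
  refine Det.block_keeps (n := 8) (k := 1) (by simp [Cmd.IsBasic]) (by simp [Cmd.WritesBelow])
    fun hk => ?_
  refine (Det.seq (t₁ := φ.length * (98 + 1) + 1) (t₂ := 1) ?_).mono (by omega) fun _ h => h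
  refine Det.while (fun m μ' => Keeps 8 1 μ μ' ∧ μ'.reg 2 = m ∧ ∃ i, i + m = φ.length ∧
    μ'.reg 1 = 3 * i ∧ match CNF3.lastViolated (φ.take i) w with
      | none => μ'.reg 0 = 0
      | some c => μ'.reg 0 = 1 ∧ ∃ c₀, φ[c₀]? = some c ∧ μ'.reg 7 = 3 * c₀ + 3) ?_ ?_ ?_
  · rintro n μ₀ ⟨h1, h2, i, hi, h3, h4⟩ h6
    cases n with
    | zero => omega
    | succ m =>
      refine ⟨m, rfl, ?_⟩
      have hilt : i < φ.length := by omega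
      have hc : φ[i]? = some φ[i] := List.getElem?_eq_getElem hilt
      generalize hcc : φ[i] = c at hc
      have hHB : ∀ {μ'}, Keeps 8 1 μ μ' → HoldsBits w μ' := fun hk j hj => by
        rw [hk.arr 1 (by omega), hw j hj]
      refine (Det.seq (t₁ := 1) (t₂ := 96) (Det.basic (by simp [Cmd.IsBasic]) ?_)).mono (by omega) fun _ h => h
      have hk1 := Keeps.exec (n := 8) (k := 1) (c := .const 3 1) (by simp [Cmd.WritesBelow]) μ₀
      have e1 : (Cmd.exec (.const 3 1) μ₀).reg 0 = μ₀.reg 0 := by simp [Cmd.exec]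
      have e2 : (Cmd.exec (.const 3 1) μ₀).reg 2 = μ₀.reg 2 := by simp [Cmd.exec]
      have e3 : (Cmd.exec (.const 3 1) μ₀).reg 1 = μ₀.reg 1 := by simp [Cmd.exec]
      have e4 : (Cmd.exec (.const 3 1) μ₀).reg 3 = 1 := by simp [Cmd.exec]
      have e5 : (Cmd.exec (.const 3 1) μ₀).reg 7 = μ₀.reg 7 := by simp [Cmd.exec]
      replace hk1 := h1.trans hk1
      generalize Cmd.exec (.const 3 1) μ₀ = μ₁ at *
      refine (Det.seq (t₁ := 23) (t₂ := 72) ?_).mono (by omega) fun _ h => h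
      refine (det_evalLiteral (hμ.keeps hk1 (by norm_num)) (hHB hk1) hc 0
        (by rw [e3, h3]; rfl)).mono le_rfl ?_
      rintro μ₂ ⟨hk2, f1, f2, f3, f4⟩
      have f5 := hk2.reg 7 le_rfl
      replace hk2 := hk1.trans (hk2.mono (n' := 8) (by norm_num) le_rfl)
      refine (Det.seq (t₁ := 23) (t₂ := 48) ?_).mono (by omega) fun _ h => h
      refine (det_evalLiteral (hμ.keeps hk2 (by norm_num)) (hHB hk2) hc 1
        (by rw [f3, e3, h3]; rfl)).mono le_rfl ?_
      rintro μ₃ ⟨hk3, g1, g2, g3, g4⟩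
      have g5 := hk3.reg 7 le_rfl
      replace hk3 := hk2.trans (hk3.mono (n' := 8) (by norm_num) le_rfl)
      refine (Det.seq (t₁ := 23) (t₂ := 24) ?_).mono (by omega) fun _ h => h
      refine (det_evalLiteral (hμ.keeps hk3 (by norm_num)) (hHB hk3) hc 2
        (by rw [g3, f3, e3, h3]; rfl)).mono le_rfl ?_
      rintro μ₄ ⟨hk4, k1, k2, k3, k4⟩
      have k5 := hk4.reg 7 le_rfl
      replace hk4 := hk3.trans (hk4.mono (n' := 8) (by norm_num) le_rfl)
      -- Register `3` starts at `1` and is zero, by truncation, as soon as one of the three literals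
      -- is true.
      have hviol : μ₄.reg 3 ≠ 0 ↔ c.Violated w := by
        rw [k4, g4, f4, e4]
        unfold Clause3.Violated
        rw [Fin.forall_fin_succ, Fin.forall_fin_two]
        simp only [Fin.succ_zero_eq_one, Fin.succ_one_eq_two, ne_eq]
        split_ifs <;> simp_all
      have htake : φ.take (i + 1) = φ.take i ++ [c] := by
        rw [List.take_add_one, hc]; rfl
      refine (Det.seq (t₁ := 6) (t₂ := 10) ?_).mono (by omega) fun _ h => h
      have fin : ∀ μ₅, Keeps 8 1 μ μ₅ → μ₅.reg 2 = m + 1 → μ₅.reg 1 = 3 * i + 3 →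
          (match CNF3.lastViolated (φ.take (i + 1)) w with
            | none => μ₅.reg 0 = 0
            | some c => μ₅.reg 0 = 1 ∧ ∃ c₀, φ[c₀]? = some c ∧ μ₅.reg 7 = 3 * c₀ + 3) →
          Det (block [.sub 2 2 33]) 10 μ₅ (fun μ' => Keeps 8 1 μ μ' ∧ μ'.reg 2 = m ∧
            ∃ i, i + m = φ.length ∧ μ'.reg 1 = 3 * i ∧ match CNF3.lastViolated (φ.take i) w with
              | none => μ'.reg 0 = 0
              | some c => μ'.reg 0 = 1 ∧ ∃ c₀, φ[c₀]? = some c ∧ μ'.reg 7 = 3 * c₀ + 3) := by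
        intro μ₅ hk5 l1 l2 l3
        refine (Det.block_keeps (n := 8) (k := 1) (by simp [Cmd.IsBasic])
          (by simp [Cmd.WritesBelow]) fun hk6 => ?_).mono (t := 3) (by norm_num) fun _ h => h
        refine ⟨hk5.trans hk6, ?_, i + 1, by omega, ?_, ?_⟩
        · simp [execs, Cmd.exec, l1, (hμ.keeps hk5 (by norm_num)).one]
        · simp [execs, Cmd.exec, l2]; ring
        · simpa [execs, Cmd.exec] using l3
      refine (Det.ite (t := 5) ?_ ?_).mono (by omega) fun _ h => h
      · intro h7
        refine Det.block_keeps (n := 8) (k := 1) (by simp [Cmd.IsBasic])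
          (by simp [Cmd.WritesBelow]) fun hk5 => fin _ (hk4.trans hk5) ?_ ?_ ?_
        · simp [execs, Cmd.exec]; omega
        · simp [execs, Cmd.exec]; omega
        · rw [htake, CNF3.lastViolated_concat, if_pos (hviol.1 h7)]
          refine ⟨by simp [execs, Cmd.exec], i, hc, ?_⟩
          simp [execs, Cmd.exec, (hμ.keeps hk4 (by norm_num)).zero]
          omega
      · intro h7
        refine Det.mono (t := 1) (Det.skip (fin _ hk4 ?_ ?_ ?_)) (by omega) fun _ h => h
        · omega
        · omega
        · rw [htake, CNF3.lastViolated_concat, if_neg (fun h => hviol.2 h h7)]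
          rw [k1, g1, f1, e1, k5, g5, f5, e5]
          exact h4
  · rintro n μ' ⟨h1, h2, i, hi, h3, h4⟩ h6
    obtain rfl : n = 0 := by omega
    obtain rfl : i = φ.length := by omega
    rw [List.take_length] at h4
    exact Det.skip ⟨h1, h4⟩
  · refine ⟨hk, ?_, 0, by omega, ?_, ?_⟩
    · simp [execs, Cmd.exec, hμ.len, hμ.zero]
    · simp [execs, Cmd.exec, hμ.zero]
    · simp [execs, Cmd.exec, CNF3.lastViolated]

/-- Perform the action in register `9`. If the state is solved, raise register `12` instead. -/
def moveState : Cmd Empty :=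
  .ite 10 (.seq findViolated (.ite 0
    -- Register `7` points behind the clause, so going back three cells and adding the action
    -- addresses the chosen literal. If the new level is `d`, register `10` becomes zero and the
    -- state is the end state.
    (block [.const 1 3, .sub 7 7 1, .add 7 7 9, .load 4 0 7, .half 5 4, .load 6 1 5, .sub 6 33 6,
      .store 1 5 6, .add 11 11 33, .sub 10 23 11])
    (block [.const 12 1, .const 10 0]))) .skip

theorem det_moveState {v r : ℕ} {φ : CNF3 v} {μ : Mem} (hμ : Ctx φ r μ)
    {s : SatState v ((v + 2) ^ r)} (hs : Holds s μ) {a : Fin 3} (ha : μ.reg 9 = a) :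
    Det moveState (100 * φ.length + 50) μ fun μ' => Keeps 13 2 μ μ' ∧
      Holds (satNext φ s a) μ' ∧ μ'.reg 12 = if IsSolved φ s then 1 else μ.reg 12 := by
  rcases s with _ | ⟨l, w⟩
  · refine (Det.ite (t := 1) (fun h => absurd hs h) fun _ => Det.skip
      ⟨Keeps.refl _ _ _, hs, ?_⟩).mono (by omega) fun _ h => h
    simp [IsSolved]
  obtain ⟨h10, h11, hw⟩ := hs
  refine (Det.ite (t := 100 * φ.length + 45) (fun _ => ?_) fun h => ?_).mono (by omega) fun _ h => h
  swap
  · rw [h10] at h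
    have := l.2
    omega
  refine (Det.seq (t₁ := 100 * φ.length + 20) (t₂ := 22) ?_).mono (by omega) fun _ h => h
  refine (det_findViolated hμ hw).mono le_rfl ?_
  rintro μ₁ ⟨hk1, h1⟩
  have hc := hμ.keeps hk1 (by norm_num)
  have e9 := hk1.reg 9 (by norm_num)
  have e11 := hk1.reg 11 (by norm_num)
  have e12 := hk1.reg 12 (by norm_num)
  have ea := hk1.arr 1 (by norm_num)
  replace hk1 := hk1.mono (n' := 13) (k' := 2) (by norm_num) (by norm_num)
  cases hv : φ.lastViolated w with
  | none =>
    rw [hv] at h1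
    refine (Det.ite (t := 5) (fun h => absurd h1 h) fun _ => ?_).mono (by omega) fun _ h => h
    refine Det.block_keeps (n := 13) (k := 2) (by simp [Cmd.IsBasic]) (by simp [Cmd.WritesBelow])
      fun hk => ⟨hk1.trans hk, ?_, ?_⟩
    · simp [satNext, hv, Holds, execs, Cmd.exec]
    · simp [IsSolved, hv, execs, Cmd.exec]
  | some c =>
    rw [hv] at h1
    obtain ⟨h0, c₀, hc₀, h7⟩ := h1
    refine (Det.ite (t := 21) (fun _ => ?_) fun h => by omega).mono (by omega) fun _ h => h
    refine Det.block_keeps (n := 13) (k := 2) (by simp [Cmd.IsBasic]) (by simp [Cmd.WritesBelow])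
      fun hk => ⟨hk1.trans hk, ?_, ?_⟩
    · have r11 : (execs [.const 1 3, .sub 7 7 1, .add 7 7 9, .load 4 0 7, .half 5 4, .load 6 1 5,
          .sub 6 33 6, .store 1 5 6, .add 11 11 33, .sub 10 23 11] μ₁).reg 11 = l + 1 := by
        simp [execs, Cmd.exec, e11, h11, hc.one]
      have r10 : (execs [.const 1 3, .sub 7 7 1, .add 7 7 9, .load 4 0 7, .half 5 4, .load 6 1 5,
          .sub 6 33 6, .store 1 5 6, .add 11 11 33, .sub 10 23 11] μ₁).reg 10
            = (v + 2) ^ r - (l + 1) := by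
        simp [execs, Cmd.exec, e11, h11, hc.one, hc.dim]
      simp only [satNext, hv]
      split_ifs with hd
      · refine ⟨r10, r11, fun i hi => ?_⟩
        have hlit : μ₁.arr 0 (3 * c₀ + a) = 2 * (c a).1.val + (c a).2.toNat := by
          rw [hc.input, satInput_arr_zero hc₀]
        have hhalf : (2 * (c a).1.val + (c a).2.toNat) / 2 = (c a).1.val := by
          have := Bool.toNat_lt (c a).2
          omega
        have hbit : ∀ j < v, μ₁.arr 1 j = bitsOf w j := fun j hj => by rw [ea, hw j hj]
        simp [execs, Cmd.exec, h7, e9, ha, hlit, hhalf, hc.one]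
        rw [Function.update_apply, hbit _ (c a).1.2, hbit i hi]
        simp only [bitsOf, hi, dif_pos, Fin.is_lt]
        split_ifs with hia
        · subst hia
          simp only [Fin.eta, Function.update_self]
          cases w (c a).1 <;> rfl
        · rw [Function.update_of_ne]
          exact fun h => hia (congrArg Fin.val h)
      · simp only [Holds]
        rw [r10]
        omega
    · simp [IsSolved, hv, execs, Cmd.exec, e12]

/-- Write the code of the state to register `0`. -/
def writeCode : Cmd Empty :=
  .ite 10 (block [
      block [.add 0 11 34, .add 1 20 34],
      .while 1 (block [.sub 1 1 33, .load 2 1 1, .add 0 0 0, .add 0 0 2]),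
      block [.add 0 0 33]])
    (.const 0 0)

/-- Horner's scheme from the highest digit: in the invariant, absorbing the remaining `m` digits
into register `0` gives the full code. -/
theorem det_writeCode {v r : ℕ} {φ : CNF3 v} {μ : Mem} (hμ : Ctx φ r μ)
    {s : SatState v ((v + 2) ^ r)} (hs : Holds s μ) :
    Det writeCode (10 * v + 20) μ fun μ' => Keeps 10 1 μ μ' ∧ μ'.reg 0 = s.code := by
  rcases s with _ | ⟨l, w⟩
  · refine (Det.ite (t := 1) (fun h => absurd hs h) fun _ => Det.basic (by simp [Cmd.IsBasic])
      ⟨Keeps.exec (by simp [Cmd.WritesBelow]) _, ?_⟩).mono (by omega) fun _ h => h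
    simp [SatState.code, Cmd.exec]
  obtain ⟨h10, h11, hw⟩ := hs
  refine (Det.ite (t := 10 * v + 18) (fun _ => ?_) fun h => ?_).mono (by omega) fun _ h => h
  swap
  · rw [h10] at h
    have := l.2
    omega
  refine (Det.seq (t₁ := 5) (t₂ := 10 * v + 12) ?_).mono (by omega) fun _ h => h
  refine Det.block_keeps (n := 10) (k := 1) (by simp [Cmd.IsBasic]) (by simp [Cmd.WritesBelow])
    fun hk => ?_
  refine (Det.seq (t₁ := v * (9 + 1) + 1) (t₂ := 5) ?_).mono (by omega) fun _ h => h
  refine Det.while (fun m μ' => Keeps 10 1 μ μ' ∧ μ'.reg 1 = m ∧ m ≤ v ∧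
    encodeBits (bitsOf w) m (μ'.reg 0) = encodeBits (bitsOf w) v l) ?_ ?_ ?_
  · rintro n μ' ⟨h1, h2, h3, h4⟩ h6
    cases n with
    | zero => omega
    | succ m =>
      have hc := hμ.keeps h1 (by norm_num)
      refine ⟨m, rfl, Det.block_keeps (n := 10) (k := 1) (by simp [Cmd.IsBasic])
        (by simp [Cmd.WritesBelow]) fun hk' => ⟨h1.trans hk', ?_, by omega, ?_⟩⟩
      · simp [execs, Cmd.exec, h2, hc.one]
      · rw [← h4]
        simp only [encodeBits]
        congr 1
        simp [execs, Cmd.exec, h2, hc.one, h1.arr 1 (by norm_num), hw m h3]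
        ring
  · rintro n μ' ⟨h1, h2, h3, h4⟩ h6
    obtain rfl : n = 0 := by omega
    have hc := hμ.keeps h1 (by norm_num)
    refine (Det.seq (t₁ := 3) (t₂ := 1) ?_).mono (by omega) fun _ h => h
    refine Det.block_keeps (n := 10) (k := 1) (by simp [Cmd.IsBasic]) (by simp [Cmd.WritesBelow])
      fun hk' => Det.skip ⟨h1.trans hk', ?_⟩
    simp only [SatState.code, ← h4, encodeBits]
    simp [execs, Cmd.exec, hc.one]
  · refine ⟨hk, ?_, le_rfl, ?_⟩
    · simp [execs, Cmd.exec, hμ.vars, hμ.zero]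
    · simp [execs, Cmd.exec, h11, hμ.zero]

/-! ### Computing the features -/

/-- Write the factors of the features to array `2`. -/
def writeCoords : Cmd Empty :=
  block [
    block [.sub 0 24 11, .const 1 0, .store 2 1 0, .store 2 33 33, .const 1 2, .const 3 0,
      .add 2 20 34],
    .while 2 (block [.load 4 1 3, .store 2 1 4, .add 1 1 33, .add 3 3 33, .sub 2 2 33])]

theorem det_writeCoords {v r : ℕ} {φ : CNF3 v} {μ : Mem} (hμ : Ctx φ r μ)
    {l : Fin ((v + 2) ^ r)} {w : Fin v → Bool} (hs : Holds (some (l, w)) μ) :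
    Det writeCoords (12 * v + 20) μ fun μ' => Keeps 10 3 μ μ' ∧
      ∀ i < v + 2, μ'.arr 2 i = coordOf ((v + 2) ^ r + v) l (bitsOf w) i := by
  obtain ⟨h10, h11, hw⟩ := hs
  refine (Det.seq (t₁ := 15) (t₂ := 12 * v + 3) ?_).mono (by omega) fun _ h => h
  refine Det.block_keeps (n := 10) (k := 3) (by simp [Cmd.IsBasic]) (by simp [Cmd.WritesBelow])
    fun hk => ?_
  refine (Det.seq (t₁ := v * (11 + 1) + 1) (t₂ := 1) ?_).mono (by omega) fun _ h => h
  refine Det.while (fun m μ' => Keeps 10 3 μ μ' ∧ μ'.reg 2 = m ∧ μ'.arr 1 = μ.arr 1 ∧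
    ∃ i, i + m = v ∧ μ'.reg 1 = i + 2 ∧ μ'.reg 3 = i ∧
    ∀ j < i + 2, μ'.arr 2 j = coordOf ((v + 2) ^ r + v) l (bitsOf w) j) ?_ ?_ ?_
  · rintro n μ' ⟨h1, h2, h3, i, hi, h4, h5, h7⟩ h6
    cases n with
    | zero => omega
    | succ m =>
      have hc := hμ.keeps h1 (by norm_num)
      refine ⟨m, rfl, Det.block_keeps (n := 10) (k := 3) (by simp [Cmd.IsBasic])
        (by simp [Cmd.WritesBelow]) fun hk' => ⟨h1.trans hk', ?_, ?_, i + 1, by omega, ?_, ?_, ?_⟩⟩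
      · simp [execs, Cmd.exec, h2, hc.one]
      · simp [execs, Cmd.exec, h3]
      · simp [execs, Cmd.exec, h4, hc.one]
      · simp [execs, Cmd.exec, h5, hc.one]
      · intro j hj
        simp only [execs, Cmd.exec, List.foldl, Mem.setReg_arr, Mem.setArr_arr, Mem.setReg_reg,
          Function.update_apply, if_true, h3, h4, h5]
        norm_num
        split_ifs with hji
        · subst hji
          exact hw i (by omega)
        · exact h7 j (by omega)
  · rintro n μ' ⟨h1, h2, h3, i, hi, h4, h5, h7⟩ h6
    obtain rfl : n = 0 := by omega
    obtain rfl : i = v := by omega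
    exact Det.skip ⟨h1, h7⟩
  · refine ⟨hk, ?_, ?_, 0, by omega, ?_, ?_, ?_⟩
    · simp [execs, Cmd.exec, hμ.vars, hμ.zero]
    · simp [execs, Cmd.exec]
    · simp [execs, Cmd.exec]
    · simp [execs, Cmd.exec]
    · intro j hj
      interval_cases j <;> simp [execs, Cmd.exec, hμ.one, hμ.top, h11, coordOf]

/-- Compute in array `3` the products of the factors in array `2` along the branches of the
tree. -/
def writeTree : Cmd Empty :=
  block [
    block [.const 0 0, .const 1 1, .store 3 0 33, .add 2 25 34],
    .while 2 (block [
      block [.load 3 3 0, .const 4 0, .add 5 22 34],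
      .while 5 (block [
        block [.load 6 2 4, .const 7 0],
        .while 6 (block [.add 7 7 3, .sub 6 6 33]),
        block [.store 3 1 7, .add 1 1 33, .add 4 4 33, .sub 5 5 33]]),
      block [.add 0 0 33, .sub 2 2 33]])]

/-- The children of successive nodes are stored in successive cells, so two running pointers suffice
and no address is computed. Products are repeated additions, at most `N` each, since every label is
at most `N`. -/
theorem det_writeTree {v r : ℕ} {φ : CNF3 v} {μ : Mem} (hμ : Ctx φ r μ) {x : ℕ → ℕ} {N : ℕ}
    (hx : ∀ i < v + 2, μ.arr 2 i = x i) (hN : ∀ i, x i ≤ N) :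
    Det writeTree (levelStart (v + 2) r * ((v + 2) * (6 * N + 30) + 30) + 20) μ fun μ' =>
      Keeps 10 4 μ μ' ∧ ∀ j < levelStart (v + 2) (r + 1), μ'.arr 3 j = treeProd (v + 2) x j := by
  set P := levelStart (v + 2) r with hP
  rw [levelStart_succ', ← hP]
  set B := v + 2 with hB
  refine (Det.seq (t₁ := 9) (t₂ := P * (B * (6 * N + 30) + 30) + 3) ?_).mono (by omega)
    fun _ h => h
  refine Det.block_keeps (n := 10) (k := 4) (by simp [Cmd.IsBasic]) (by simp [Cmd.WritesBelow])
    fun hk => ?_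
  refine (Det.seq (t₁ := P * ((B * (6 * N + 30) + 29) + 1) + 1) (t₂ := 1) ?_).mono
    (by simp only [Nat.add_assoc, Nat.reduceAdd]; omega) fun _ h => h
  refine Det.while (fun m μ' => Keeps 10 4 μ μ' ∧ μ'.reg 2 = m ∧ μ'.arr 2 = μ.arr 2 ∧
    ∃ p, p + m = P ∧ μ'.reg 0 = p ∧ μ'.reg 1 = B * p + 1 ∧
    ∀ j < B * p + 1, μ'.arr 3 j = treeProd B x j) ?_ ?_ ?_
  · rintro n μ₁ ⟨h1, h2, h3, p, hp, h4, h5, h7⟩ h6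
    cases n with
    | zero => omega
    | succ m =>
      refine ⟨m, rfl, ?_⟩
      have hc := hμ.keeps h1 (by norm_num)
      refine (Det.seq (t₁ := 7) (t₂ := B * (6 * N + 30) + 20) ?_).mono (by omega) fun _ h => h
      refine Det.block_keeps (n := 10) (k := 4) (by simp [Cmd.IsBasic])
        (by simp [Cmd.WritesBelow]) fun hk' => ?_
      refine (Det.seq (t₁ := B * ((6 * N + 29) + 1) + 1) (t₂ := 8) ?_).mono
        (by simp only [Nat.add_assoc, Nat.reduceAdd]; omega) fun _ h => h
      refine Det.while (fun m' μ' => Keeps 10 4 μ μ' ∧ μ'.reg 2 = m + 1 ∧ μ'.arr 2 = μ.arr 2 ∧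
        μ'.reg 0 = p ∧ μ'.reg 3 = treeProd B x p ∧ μ'.reg 5 = m' ∧
        ∃ i, i + m' = B ∧ μ'.reg 4 = i ∧ μ'.reg 1 = B * p + i + 1 ∧
        ∀ j < B * p + i + 1, μ'.arr 3 j = treeProd B x j) ?_ ?_ ?_
      · rintro n μ₂ ⟨k1, k2, k3, k4, k5, k6, i, hi, k7, k8, k9⟩ k10
        cases n with
        | zero => omega
        | succ m' =>
          refine ⟨m', rfl, ?_⟩
          have hc' := hμ.keeps k1 (by norm_num)
          have hiB : i < B := by omega
          refine (Det.seq (t₁ := 5) (t₂ := 6 * N + 20) ?_).mono (by omega) fun _ h => h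
          refine Det.block_keeps (n := 10) (k := 4) (by simp [Cmd.IsBasic])
            (by simp [Cmd.WritesBelow]) fun hk2 => ?_
          refine (Det.seq (t₁ := x i * (5 + 1) + 1) (t₂ := 11) ?_).mono
            (by have := hN i; omega) fun _ h => h
          refine Det.while (fun z μ' => Keeps 10 4 μ μ' ∧ μ'.reg 2 = m + 1 ∧ μ'.arr 2 = μ.arr 2 ∧
            μ'.reg 0 = p ∧ μ'.reg 3 = treeProd B x p ∧ μ'.reg 5 = m' + 1 ∧ μ'.reg 4 = i ∧
            μ'.reg 1 = B * p + i + 1 ∧ μ'.arr 3 = μ₂.arr 3 ∧ μ'.reg 6 = z ∧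
            μ'.reg 7 + z * treeProd B x p = x i * treeProd B x p) ?_ ?_ ?_
          · rintro n μ₃ ⟨l1, l2, l3, l4, l5, l6, l7, l8, l9, l10, l11⟩ l12
            cases n with
            | zero => omega
            | succ z =>
              have hc2 := hμ.keeps l1 (by norm_num)
              refine ⟨z, rfl, Det.block_keeps (n := 10) (k := 4) (by simp [Cmd.IsBasic])
                (by simp [Cmd.WritesBelow]) fun hk3 => ⟨l1.trans hk3, ?_⟩⟩
              rw [Nat.add_mul] at l11
              simp [execs, Cmd.exec, l2, l3, l4, l5, l6, l7, l8, l9, l10, hc2.one]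
              omega
          · rintro n μ₃ ⟨l1, l2, l3, l4, l5, l6, l7, l8, l9, l10, l11⟩ l12
            obtain rfl : n = 0 := by omega
            have hc2 := hμ.keeps l1 (by norm_num)
            refine (Det.seq (t₁ := 9) (t₂ := 1) ?_).mono (by omega) fun _ h => h
            refine Det.block_keeps (n := 10) (k := 4) (by simp [Cmd.IsBasic])
              (by simp [Cmd.WritesBelow]) fun hk3 => Det.skip ⟨l1.trans hk3, ?_, ?_, ?_, ?_, ?_,
                i + 1, by omega, ?_, ?_, ?_⟩
            · simp [execs, Cmd.exec, l2]
            · simp [execs, Cmd.exec, l3]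
            · simp [execs, Cmd.exec, l4]
            · simp [execs, Cmd.exec, l5]
            · simp [execs, Cmd.exec, l6, hc2.one]
            · simp [execs, Cmd.exec, l7, hc2.one]
            · simp [execs, Cmd.exec, l8, hc2.one]; ring
            · intro j hj
              simp only [execs, Cmd.exec, List.foldl, Mem.setReg_arr, Mem.setArr_arr,
                if_true, Function.update_apply, l8, l9]
              split_ifs with hji
              · rw [hji, treeProd_child x p hiB, ← l11]
                simp
              · exact k9 j (by omega)
          · refine ⟨k1.trans hk2, ?_⟩
            simp [execs, Cmd.exec, k2, k3, k4, k5, k6, k7, k8, hx i hiB]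
      · rintro n μ₂ ⟨k1, k2, k3, k4, k5, k6, i, hi, k7, k8, k9⟩ k10
        obtain rfl : n = 0 := by omega
        obtain rfl : i = B := by omega
        have hc' := hμ.keeps k1 (by norm_num)
        refine (Det.seq (t₁ := 5) (t₂ := 1) ?_).mono (by omega) fun _ h => h
        refine Det.block_keeps (n := 10) (k := 4) (by simp [Cmd.IsBasic])
          (by simp [Cmd.WritesBelow]) fun hk2 => Det.skip ⟨k1.trans hk2, ?_, ?_, p + 1, by omega,
            ?_, ?_, ?_⟩
        · simp [execs, Cmd.exec, k2, hc'.one]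
        · simp [execs, Cmd.exec, k3]
        · simp [execs, Cmd.exec, k4, hc'.one]
        · simp [execs, Cmd.exec, k8]; ring
        · intro j hj
          exact k9 j (by rw [Nat.mul_succ] at hj; exact hj)
      · refine ⟨h1.trans hk', ?_, ?_, ?_, ?_, ?_, 0, by omega, ?_, ?_, ?_⟩
        · simp [execs, Cmd.exec, h2]
        · simp [execs, Cmd.exec, h3]
        · simp [execs, Cmd.exec, h4]
        · simp only [execs, Cmd.exec, List.foldl, Mem.setReg_reg, h4]
          norm_num
          exact h7 p (Nat.lt_succ_of_le (Nat.le_mul_of_pos_left _ (by omega)))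
        · simp [execs, Cmd.exec, hc.base, hc.zero, hB]
        · simp [execs, Cmd.exec]
        · simp [execs, Cmd.exec, h5]
        · intro j hj
          exact h7 j hj
  · rintro n μ' ⟨h1, h2, h3, p, hp, h4, h5, h7⟩ h6
    obtain rfl : n = 0 := by omega
    obtain rfl : p = P := by omega
    exact Det.skip ⟨h1, h7⟩
  · refine ⟨hk, ?_, ?_, 0, by omega, ?_, ?_, ?_⟩
    · simp [execs, Cmd.exec, hμ.lev, hμ.zero]; rfl
    · simp [execs, Cmd.exec]
    · simp [execs, Cmd.exec]
    · simp [execs, Cmd.exec]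
    · intro j hj
      obtain rfl : j = 0 := by omega
      simp [execs, Cmd.exec, hμ.one, treeProd]

/-- Copy the features to array `a`, marking the cells written in array `b`. -/
def copyFeatures (a b : ℕ) : Cmd Empty :=
  block [
    block [.add 0 25 34, .const 1 0, .add 2 23 34],
    .while 2 (block [
      .ite 10 (.load 3 3 0) (.const 3 0),
      block [.store a 1 34, .store b 1 28, .add 1 1 33, .store a 1 3, .store b 1 28, .add 1 1 33,
        .store a 1 33, .store b 1 28, .add 1 1 33, .add 0 0 33, .sub 2 2 33]])]

/-- The content of the cells written. -/
def vecCell (u : ℕ → ℕ) (j : ℕ) : ℕ :=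
  if j % 3 = 0 then 0 else if j % 3 = 1 then u (j / 3) else 1

/-- The first `3 * d` cells of array `a` hold the vector `u`, and are marked in array `b`. All other
cells except those of the arrays `1`, `2`, `3` are kept. -/
structure HoldsVec (a b d : ℕ) (u : ℕ → ℕ) (μ μ' : Mem) : Prop where
  reg : ∀ x, 10 ≤ x → μ'.reg x = μ.reg x
  arr : ∀ c, c ≠ a → c ≠ b → c = 0 ∨ 4 ≤ c → μ'.arr c = μ.arr c
  val : ∀ j, μ'.arr a j = if j < 3 * d then vecCell u j else μ.arr a j
  mark : ∀ j, μ'.arr b j = if j < 3 * d then μ.reg 28 else μ.arr b j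

theorem det_copyFeatures {v r : ℕ} {φ : CNF3 v} {μ : Mem} (hμ : Ctx φ r μ) {a b : ℕ} (ha : 4 ≤ a)
    (hb : 4 ≤ b) (hab : a ≠ b) {u : ℕ → ℕ}
    (hu : ∀ n < (v + 2) ^ r, (if μ.reg 10 = 0 then 0 else μ.arr 3 (levelStart (v + 2) r + n))
      = u n) :
    Det (copyFeatures a b) (30 * (v + 2) ^ r + 20) μ (HoldsVec a b ((v + 2) ^ r) u μ) := by
  set P := levelStart (v + 2) r with hP
  set d := (v + 2) ^ r with hd
  have h20 : ∀ x < 10, ∀ y, 10 ≤ y → y ≠ x := fun x hx y hy => by omega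
  have ctx : ∀ {k μ'}, HoldsVec a b k u μ μ' →
      μ'.reg 28 = μ.reg 28 ∧ μ'.reg 33 = 1 ∧ μ'.reg 34 = 0 ∧ μ'.reg 10 = μ.reg 10 := fun h =>
    ⟨h.reg 28 (by norm_num), (h.reg 33 (by norm_num)).trans hμ.one,
      (h.reg 34 (by norm_num)).trans hμ.zero, h.reg 10 le_rfl⟩
  refine (Det.seq (t₁ := 7) (t₂ := 30 * d + 10) ?_).mono (by omega) fun _ h => h
  refine Det.block (by simp [Cmd.IsBasic]) ?_
  refine (Det.seq (t₁ := d * (29 + 1) + 1) (t₂ := 1) ?_).mono (by omega) fun _ h => h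
  refine Det.while (fun m μ' => ∃ i, i + m = d ∧ HoldsVec a b i u μ μ' ∧ μ'.reg 2 = m ∧
    μ'.reg 1 = 3 * i ∧ μ'.reg 0 = P + i ∧ μ'.arr 3 = μ.arr 3) ?_ ?_ ?_
  · rintro n μ₁ ⟨i, hi, h1, h2, h3, h4, h5⟩ h6
    cases n with
    | zero => omega
    | succ m =>
      refine ⟨m, rfl, ?_⟩
      obtain ⟨c28, c33, c34, c10⟩ := ctx h1
      have goal : ∀ μ₂ : Mem, (∀ x, x ≠ 3 → μ₂.reg x = μ₁.reg x) → μ₂.arr = μ₁.arr →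
          μ₂.reg 3 = u i →
          Det (block [block [.store a 1 34, .store b 1 28, .add 1 1 33, .store a 1 3,
            .store b 1 28, .add 1 1 33, .store a 1 33, .store b 1 28, .add 1 1 33, .add 0 0 33,
            .sub 2 2 33]]) 25 μ₂ fun μ' => ∃ i, i + m = d ∧ HoldsVec a b i u μ μ' ∧
              μ'.reg 2 = m ∧ μ'.reg 1 = 3 * i ∧ μ'.reg 0 = P + i ∧ μ'.arr 3 = μ.arr 3 := by
        intro μ₂ hr harr hr3
        refine (Det.seq (t₁ := 23) (t₂ := 1) ?_).mono (by omega) fun _ h => h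
        have d0 := hr 0 (by norm_num)
        have d1 := hr 1 (by norm_num)
        have d2 := hr 2 (by norm_num)
        have d28 := hr 28 (by norm_num)
        have d33 := hr 33 (by norm_num)
        have d34 := hr 34 (by norm_num)
        rw [c28] at d28
        rw [c33] at d33
        rw [c34] at d34
        rw [h3] at d1
        rw [h4] at d0
        rw [h2] at d2
        have v0 : vecCell u (3 * i) = 0 := by simp [vecCell]
        have v1 : vecCell u (3 * i + 1) = u i := by
          simp only [vecCell]
          rw [if_neg (by omega), if_pos (by omega)]
          congr 1; omega
        have v2 : vecCell u (3 * i + 1 + 1) = 1 := by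
          simp only [vecCell]
          rw [if_neg (by omega), if_neg (by omega)]
        refine Det.block (by simp [Cmd.IsBasic])
          (Det.skip ⟨i + 1, by omega, ⟨?_, ?_, ?_, ?_⟩, ?_, ?_, ?_, ?_⟩)
        · intro x hx
          have := hr x (by omega)
          rw [← h1.reg x hx, ← this]
          have hx0 : x ≠ 0 := by omega
          have hx1 : x ≠ 1 := by omega
          have hx2 : x ≠ 2 := by omega
          simp [execs, Cmd.exec, hx0, hx1, hx2]
        · intro c hca hcb hc4
          rw [← h1.arr c hca hcb hc4, ← harr]
          simp [execs, Cmd.exec, hca, hcb]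
        · intro j
          simp only [execs, Cmd.exec, List.foldl, Mem.setReg_arr, Mem.setArr_arr, Mem.setReg_reg,
            Mem.setArr_reg, hab, hab.symm, if_true, if_false, d1, d33, d34, hr3, harr]
          norm_num
          simp only [Function.update_apply, h1.val]
          split_ifs <;> first | omega | (subst_vars; simp only [v0, v1, v2])
        · intro j
          simp only [execs, Cmd.exec, List.foldl, Mem.setReg_arr, Mem.setArr_arr, Mem.setReg_reg,
            Mem.setArr_reg, hab, hab.symm, if_true, if_false, d1, d33, d28, harr]
          norm_num
          simp only [Function.update_apply, h1.mark]
          split_ifs <;> omega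
        · simp [execs, Cmd.exec, d2, d33]
        · simp [execs, Cmd.exec, d1, d33]; ring
        · simp [execs, Cmd.exec, d0, d33]; ring
        · have h3a : 3 ≠ a := by omega
          have h3b : 3 ≠ b := by omega
          simp [execs, Cmd.exec, h3a, h3b, harr, h5]
      refine (Det.seq (t₁ := 2) (t₂ := 25) ?_).mono (by omega) fun _ h => h
      have hui := hu i (by omega)
      refine Det.ite ?_ ?_
      · intro h10
        refine Det.basic (by simp [Cmd.IsBasic]) (goal _ ?_ ?_ ?_)
        · intro x hx; simp [Cmd.exec, hx]
        · simp [Cmd.exec]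
        · rw [← hui, if_neg (by rwa [← c10])]
          simp [Cmd.exec, h4, h5]
      · intro h10
        refine Det.basic (by simp [Cmd.IsBasic]) (goal _ ?_ ?_ ?_)
        · intro x hx; simp [Cmd.exec, hx]
        · simp [Cmd.exec]
        · rw [← hui, if_pos (by rwa [← c10])]
          simp [Cmd.exec]
  · rintro n μ' ⟨i, hi, h1, h2, -⟩ h6
    obtain rfl : n = 0 := by omega
    obtain rfl : i = d := by omega
    exact Det.skip h1
  · refine ⟨0, by omega, ⟨?_, ?_, ?_, ?_⟩, ?_, ?_, ?_, ?_⟩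
    · intro x hx
      have hx0 : x ≠ 0 := by omega
      have hx1 : x ≠ 1 := by omega
      have hx2 : x ≠ 2 := by omega
      simp [execs, Cmd.exec, hx0, hx1, hx2]
    · intros; simp [execs, Cmd.exec]
    · simp [execs, Cmd.exec]
    · simp [execs, Cmd.exec]
    · simp [execs, Cmd.exec, hμ.dim, hμ.zero, hd]
    · simp [execs, Cmd.exec]
    · simp [execs, Cmd.exec, hμ.lev, hμ.zero, hP]
    · simp [execs, Cmd.exec]

/-- Write the features of the state to array `a`, marking the cells written in array `b`. -/
def writeFeatures (a b : ℕ) : Cmd Empty :=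
  block [.ite 10 (block [writeCoords, writeTree]) .skip, copyFeatures a b]

/-- A time bound for `writeFeatures`. -/
def featTime (v r : ℕ) : ℕ :=
  levelStart (v + 2) r * ((v + 2) * (6 * ((v + 2) ^ r + v) + 30) + 30) + 30 * (v + 2) ^ r
    + 12 * v + 100

theorem det_writeFeatures {v r : ℕ} {φ : CNF3 v} {μ : Mem} (hμ : Ctx φ r μ) {a b : ℕ} (ha : 4 ≤ a)
    (hb : 4 ≤ b) (hab : a ≠ b) {s : SatState v ((v + 2) ^ r)} (hs : Holds s μ) :
    Det (writeFeatures a b) (featTime v r) μ (HoldsVec a b ((v + 2) ^ r) (featOf r s) μ) := by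
  unfold featTime
  set Y := levelStart (v + 2) r * ((v + 2) * (6 * ((v + 2) ^ r + v) + 30) + 30) with hY
  have goal : ∀ μ', Keeps 10 4 μ μ' →
      (∀ n < (v + 2) ^ r, (if μ'.reg 10 = 0 then 0 else μ'.arr 3 (levelStart (v + 2) r + n))
        = featOf r s n) →
      Det (block [copyFeatures a b]) (30 * (v + 2) ^ r + 25) μ'
        (HoldsVec a b ((v + 2) ^ r) (featOf r s) μ) := by
    intro μ' hk hf
    refine (Det.seq (t₁ := 30 * (v + 2) ^ r + 20) (t₂ := 1) ?_).mono (by omega) fun _ h => h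
    refine (det_copyFeatures (hμ.keeps hk (by norm_num)) ha hb hab hf).mono le_rfl fun μ₁ h => ?_
    refine Det.skip ⟨fun x hx => (h.reg x hx).trans (hk.reg x hx),
      fun c hca hcb hc => (h.arr c hca hcb hc).trans (hk.arr c hc), fun j => ?_, fun j => ?_⟩
    · rw [h.val, hk.arr a (Or.inr ha)]
    · rw [h.mark, hk.arr b (Or.inr hb), hk.reg 28 (by norm_num)]
  refine (Det.seq (t₁ := Y + 12 * v + 60) (t₂ := 30 * (v + 2) ^ r + 25) ?_).mono (by omega)
    fun _ h => h
  refine (Det.ite (t := Y + 12 * v + 50) ?_ ?_).mono (by omega) fun _ h => h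
  · intro h10
    rcases s with _ | ⟨l, w⟩
    · exact absurd hs h10
    refine (Det.seq (t₁ := 12 * v + 20) (t₂ := Y + 23) ?_).mono (by omega) fun _ h => h
    refine (det_writeCoords hμ hs).mono le_rfl ?_
    rintro μ₁ ⟨hk1, h1⟩
    refine (Det.seq (t₁ := Y + 20) (t₂ := 1) ?_).mono (by omega) fun _ h => h
    refine (det_writeTree (hμ.keeps hk1 (by norm_num)) h1
      (coordOf_le (by have : 0 < (v + 2) ^ r := by positivity
                      omega) _ (bitsOf_lt w))).mono le_rfl ?_
    rintro μ₂ ⟨hk2, h2⟩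
    have hk := (hk1.mono le_rfl (by norm_num : 3 ≤ 4)).trans hk2
    refine Det.skip (goal μ₂ hk fun n hn => ?_)
    rw [hk.reg 10 le_rfl, if_neg h10, h2 _ (by rw [levelStart_succ]; omega)]
    rfl
  · intro h10
    refine Det.mono (t := 1) (Det.skip (goal μ (Keeps.refl _ _ _) fun n hn => ?_)) (by omega)
      fun _ h => h
    rw [if_pos h10]
    rcases s with _ | ⟨l, w⟩
    · rfl
    · have := l.2
      have h := hs.1
      omega

/-! ### The simulated machine -/

/-- The state of the simulated machine: its registers start at `40`, its arrays are the even arrays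
from `4` on. A cell counts as empty unless its mark, in the following array, is the number of the
present run, in register `28`. The budget is in register `26`, the flag in register `27`. -/
def simState (ν : Mem) : BState :=
  ⟨⟨fun x => ν.reg (40 + x),
    fun a i => if ν.arr (5 + 2 * a) i = ν.reg 28 then ν.arr (4 + 2 * a) i else 0⟩,
    ν.reg 26, ν.reg 27⟩

/-- The formula and the parameters are in place, and the registers of the simulating machine are
those of `ν₀`. -/
structure SimBase {v : ℕ} (φ : CNF3 v) (r : ℕ) (ν₀ ν : Mem) : Prop where
  ctx : Ctx φ r ν
  reg : ∀ x, 20 ≤ x → x < 40 → x ≠ 26 → x ≠ 27 → ν.reg x = ν₀.reg x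
  mark : ∀ a i, ν.arr (5 + 2 * a) i ≤ ν.reg 28

section Base

variable {v : ℕ} {φ : CNF3 v} {r : ℕ} {ν₀ ν ν' : Mem}

theorem SimBase.keeps (h : SimBase φ r ν₀ ν) (hk : Keeps 20 4 ν ν') : SimBase φ r ν₀ ν' where
  ctx := h.ctx.keeps hk le_rfl
  reg x h1 h2 h3 h4 := (hk.reg x h1).trans (h.reg x h1 h2 h3 h4)
  mark a i := by
    rw [hk.arr _ (by omega), hk.reg _ (by norm_num)]
    exact h.mark a i

theorem simState_keeps (hk : Keeps 20 4 ν ν') : simState ν' = simState ν := by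
  unfold simState
  rw [hk.reg 26 (by norm_num), hk.reg 27 (by norm_num), hk.reg 28 (by norm_num)]
  congr 2
  · funext x
    exact hk.reg _ (by omega)
  · funext a i
    rw [hk.arr _ (by omega), hk.arr _ (by omega)]

theorem SimBase.setReg (h : SimBase φ r ν₀ ν) {x n : ℕ} (hx : 40 ≤ x ∨ x = 26 ∨ x = 27) :
    SimBase φ r ν₀ (ν.setReg x n) := by
  have hr : ∀ y, 20 ≤ y → y < 40 → y ≠ 26 → y ≠ 27 → (ν.setReg x n).reg y = ν.reg y :=
    fun y h1 h2 h3 h4 => by rw [Mem.setReg_reg, if_neg (by omega)]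
  have hr' : ∀ y, 20 ≤ y ∧ y < 40 ∧ y ≠ 26 ∧ y ≠ 27 → (ν.setReg x n).reg y = ν.reg y :=
    fun y hy => hr y hy.1 hy.2.1 hy.2.2.1 hy.2.2.2
  constructor
  · obtain ⟨h1, h2, h3, h4, h5, h6, h7, h8, h9⟩ := h.ctx
    constructor <;> first | assumption | (rw [hr' _ (by norm_num)]; assumption)
  · exact fun y h1 h2 h3 h4 => (hr y h1 h2 h3 h4).trans (h.reg y h1 h2 h3 h4)
  · intro a i
    rw [hr 28 (by norm_num) (by norm_num) (by norm_num) (by norm_num)]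
    exact h.mark a i

theorem simState_setReg (ν : Mem) (x n : ℕ) : simState (ν.setReg (40 + x) n)
    = ⟨(simState ν).mem.setReg x n, ν.reg 26, ν.reg 27⟩ := by
  have h : ∀ y, y < 40 → (ν.setReg (40 + x) n).reg y = ν.reg y :=
    fun y hy => by rw [Mem.setReg_reg, if_neg (by omega)]
  unfold simState
  rw [h 26 (by norm_num), h 27 (by norm_num), h 28 (by norm_num)]
  congr 1
  unfold Mem.setReg
  congr 1
  funext y
  simp [Function.update_apply]

theorem simState_setBudget (ν : Mem) (n : ℕ) : simState (ν.setReg 26 n)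
    = ⟨(simState ν).mem, n, ν.reg 27⟩ := by
  unfold simState
  simp only [Mem.setReg_reg, Mem.setReg_arr]
  congr 2
  funext x
  rw [if_neg (by omega)]

theorem simState_found (ν : Mem) : simState ((ν.setReg 26 0).setReg 27 1)
    = ⟨(simState ν).mem, 0, 1⟩ := by
  unfold simState
  simp only [Mem.setReg_reg, Mem.setReg_arr]
  congr 2
  funext x
  rw [if_neg (by omega), if_neg (by omega)]

theorem SimBase.store (h : SimBase φ r ν₀ ν) (a i n : ℕ) :
    SimBase φ r ν₀ ((ν.setArr (4 + 2 * a) (Function.update (ν.arr (4 + 2 * a)) i n)).setArr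
      (5 + 2 * a) (Function.update (ν.arr (5 + 2 * a)) i (ν.reg 28))) := by
  constructor
  · obtain ⟨h1, h2, h3, h4, h5, h6, h7, h8, h9⟩ := h.ctx
    constructor <;> first | assumption | skip
    simp only [Mem.setArr_arr]
    rw [if_neg (by omega), if_neg (by omega), h9]
  · exact h.reg
  · intro b j
    simp only [Mem.setArr_arr, Mem.setArr_reg]
    split_ifs with h1 h2
    · rw [Function.update_apply]
      split_ifs
      · exact le_rfl
      · exact h.mark a j
    · omega
    · exact h.mark b j

theorem simState_store (ν : Mem) (a i n : ℕ) :
    simState ((ν.setArr (4 + 2 * a) (Function.update (ν.arr (4 + 2 * a)) i n)).setArr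
      (5 + 2 * a) (Function.update (ν.arr (5 + 2 * a)) i (ν.reg 28)))
    = ⟨(simState ν).mem.setArr a (Function.update ((simState ν).mem.arr a) i n),
        ν.reg 26, ν.reg 27⟩ := by
  unfold simState Mem.setArr
  dsimp only
  congr 2
  funext b j
  have h1 : 4 + 2 * b ≠ 5 + 2 * a := by omega
  have h2 : 5 + 2 * b ≠ 4 + 2 * a := by omega
  by_cases hb : b = a
  · subst hb
    by_cases hj : j = i <;> simp [hj]
  · have h3 : 5 + 2 * b ≠ 5 + 2 * a := by omega
    have h4 : 4 + 2 * b ≠ 4 + 2 * a := by omega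
    simp [hb, h1, h2]

theorem SimBase.holdsVec {a d : ℕ} {u : ℕ → ℕ} (h : SimBase φ r ν₀ ν)
    (hv : HoldsVec (4 + 2 * a) (5 + 2 * a) d u ν ν') : SimBase φ r ν₀ ν' where
  ctx := by
    obtain ⟨h1, h2, h3, h4, h5, h6, h7, h8, h9⟩ := h.ctx
    constructor <;> first
      | (rw [hv.reg _ (by norm_num)]; assumption)
      | (rw [hv.arr 0 (by omega) (by omega) (by omega)]; assumption)
  reg x h1 h2 h3 h4 := (hv.reg x (by omega)).trans (h.reg x h1 h2 h3 h4)
  mark b i := by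
    rw [hv.reg 28 (by norm_num)]
    by_cases hb : b = a
    · subst hb
      rw [hv.mark]
      split_ifs
      exacts [le_rfl, h.mark b i]
    · rw [hv.arr _ (by omega) (by omega) (by omega)]
      exact h.mark b i

theorem writeVec_simFeat {r : ℕ} (s : SatState v ((v + 2) ^ r)) (old : ℕ → ℕ) (j : ℕ) :
    writeVec (simFeat r s) old j
      = if j < 3 * (v + 2) ^ r then vecCell (featOf r s) j else old j := by
  unfold writeVec vecCell simFeat
  have h0 : ∀ n : ℕ, ¬ ((n : ℚ) < 0) := fun n => by simp
  by_cases h : j / 3 < (v + 2) ^ r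
  · have hj : j < 3 * (v + 2) ^ r := by omega
    rw [dif_pos h, if_pos hj, if_neg (h0 _)]
    simp
  · rw [dif_neg h, if_neg (by omega)]

theorem simState_holdsVec {a : ℕ} {s : SatState v ((v + 2) ^ r)}
    (hv : HoldsVec (4 + 2 * a) (5 + 2 * a) ((v + 2) ^ r) (featOf r s) ν ν') :
    simState ν' = ⟨(simState ν).mem.setArr a (writeVec (simFeat r s) ((simState ν).mem.arr a)),
      ν.reg 26, ν.reg 27⟩ := by
  unfold simState Mem.setArr
  rw [hv.reg 26 (by norm_num), hv.reg 27 (by norm_num), hv.reg 28 (by norm_num)]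
  congr 2
  · funext x
    exact hv.reg _ (by omega)
  · funext b j
    by_cases hb : b = a
    · subst hb
      rw [Function.update_self, writeVec_simFeat, hv.mark, hv.val]
      by_cases hj : j < 3 * (v + 2) ^ r
      · simp only [hj, if_true]
      · simp only [hj, if_false]
    · rw [Function.update_of_ne hb, hv.arr _ (by omega) (by omega) (by omega),
        hv.arr _ (by omega) (by omega) (by omega)]

end Base

/-- Raise the flag and withdraw the budget. -/
def found : Cmd Empty := block [.const 26 0, .const 27 1]

/-- Answer a query. -/
def answer : RLQuery → Cmd Empty
  | .reward num den s _ =>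
    block [block [.add 0 (40 + s) 34], readState, block [.const 12 0, .const 9 0], moveState,
      .ite 12 found (block [.const (40 + num) 0, .const (40 + den) 1])]
  | .trans x s a =>
    block [block [.add 0 (40 + s) 34], readState, block [.const 12 0, .add 9 (40 + a) 34],
      modThree, moveState, writeCode, .ite 12 found (.add (40 + x) 0 34)]
  | .featV y s =>
    block [block [.add 0 (40 + s) 34], readState, writeFeatures (4 + 2 * y) (5 + 2 * y)]
  | .featQ y s a =>
    block [block [.add 0 (40 + s) 34], readState,
      block [.const 12 0, .add 9 (40 + a) 34, .sub 0 10 33],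
      .ite 0 (block [modThree, moveState]) .skip,
      .ite 12 found (writeFeatures (4 + 2 * y) (5 + 2 * y))]

/-- Execute an elementary instruction of the simulated machine. -/
def simAtom : Cmd RLQuery → Cmd Empty
  | .const x n => .const (40 + x) n
  | .add x y z => .add (40 + x) (40 + y) (40 + z)
  | .sub x y z => .sub (40 + x) (40 + y) (40 + z)
  | .half x y => .half (40 + x) (40 + y)
  | .load x a i =>
    block [block [.load 0 (5 + 2 * a) (40 + i), .sub 1 0 28, .sub 2 28 0, .add 1 1 2],
      .ite 1 (.const (40 + x) 0) (.load (40 + x) (4 + 2 * a) (40 + i))]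
  | .store a i x =>
    block [.store (4 + 2 * a) (40 + i) (40 + x), .store (5 + 2 * a) (40 + i) 28]
  | .call o => answer o
  | _ => .skip

/-- A time bound for the simulation of an elementary instruction. -/
def atomTime (v r len Z : ℕ) : ℕ := 30 * v + 16 * Z + 100 * len + featTime v r + 400

/-- The state of the simulated machine after an elementary instruction. -/
def BState.after (s : BState) : Option Mem → BState
  | some μ => ⟨μ, s.bud, s.fnd⟩
  | none => ⟨s.mem, 0, 1⟩

section Atom

variable {v : ℕ} {φ : CNF3 v} {r : ℕ} {ν₀ ν : Mem}

theorem det_found {ν' : Mem} (h : SimBase φ r ν₀ ν') (hs : simState ν' = simState ν) :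
    Det found 5 ν' fun ν' => SimBase φ r ν₀ ν' ∧ simState ν' = (simState ν).after none := by
  refine Det.block (by simp [Cmd.IsBasic]) ⟨?_, ?_⟩
  · exact (h.setReg (Or.inr (Or.inl rfl))).setReg (Or.inr (Or.inr rfl))
  · exact (simState_found ν').trans (by rw [hs]; rfl)

/-- The beginning of every answer: the state is read. -/
theorem det_readQuery (h : SimBase φ r ν₀ ν) (s : ℕ) {L : List (Cmd Empty)} {t : ℕ}
    {Q : Mem → Prop}
    (hL : ∀ ν', SimBase φ r ν₀ ν' → Keeps 12 2 ν ν' →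
      Holds (SatState.decode v ((v + 2) ^ r) ((simState ν).mem.reg s)) ν' → Det (block L) t ν' Q) :
    Det (block (block [.add 0 (40 + s) 34] :: readState :: L)) (t + 16 * v + 50) ν Q := by
  refine (Det.seq (t₁ := 3) (t₂ := t + 16 * v + 45) ?_).mono (by omega) fun _ h => h
  refine Det.block_keeps (n := 12) (k := 2) (by simp [Cmd.IsBasic]) (by simp [Cmd.WritesBelow])
    fun hk => ?_
  refine (Det.seq (t₁ := 16 * v + 40) (t₂ := t) ?_).mono (by omega) fun _ h => h
  refine (det_readState (h.ctx.keeps hk (by norm_num))).mono le_rfl ?_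
  rintro ν' ⟨hk', hs⟩
  have hk2 := hk.trans hk'
  refine hL ν' (h.keeps (hk2.mono (by norm_num) (by norm_num))) hk2 ?_
  have : (execs [.add 0 (40 + s) 34] ν).reg 0 = (simState ν).mem.reg s := by
    simp [execs, Cmd.exec, h.ctx.zero, simState]
  rwa [this] at hs

theorem Keeps.to_sim {n k : ℕ} {μ μ' : Mem} (h : Keeps n k μ μ') (hn : n ≤ 20) (hk : k ≤ 4) :
    Keeps 20 4 μ μ' := h.mono hn hk

theorem Holds.keeps' {v d n k : ℕ} {s : SatState v d} {μ μ' : Mem} (h : Holds s μ)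
    (hk : Keeps n k μ μ') (h10 : μ'.reg 10 = μ.reg 10) (h11 : μ'.reg 11 = μ.reg 11)
    (hk1 : k ≤ 1) : Holds s μ' := by
  rcases s with _ | ⟨l, w⟩
  · exact h10.trans h
  · exact ⟨h10.trans h.1, h11.trans h.2.1, fun i hi => by rw [hk.arr _ (by omega), h.2.2 i hi]⟩

/-- The word length `Z` enters the time only through the reduction of the action modulo `3`. -/
theorem det_answer {Z : ℕ} (h : SimBase φ r ν₀ ν) (hZ : ∀ x, ν.reg (40 + x) < 2 ^ Z)
    (o : RLQuery) :
    Det (answer o) (atomTime v r φ.length Z) ν fun ν' =>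
      SimBase φ r ν₀ ν' ∧ simState ν' = (simState ν).after (satSim φ r o (simState ν).mem) := by
  have hT : atomTime v r φ.length Z
      = 30 * v + 16 * Z + 100 * φ.length + featTime v r + 400 := rfl
  cases o with
  | reward num den s a =>
    refine (det_readQuery h s (t := 100 * φ.length + 100) fun ν₁ h₁ hk₁ hs₁ => ?_).mono
      (by omega) fun _ h => h
    generalize hσ : SatState.decode v ((v + 2) ^ r) ((simState ν).mem.reg s) = σ at hs₁
    simp only [satSim, hσ]
    refine (Det.seq (t₁ := 5) (t₂ := 100 * φ.length + 80) ?_).mono (by omega) fun _ h => h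
    refine Det.block_keeps (n := 13) (k := 1) (by simp [Cmd.IsBasic]) (by simp [Cmd.WritesBelow])
      fun hk₂ => ?_
    have hs₂ := hs₁.keeps' hk₂ (by simp [execs, Cmd.exec]) (by simp [execs, Cmd.exec]) le_rfl
    have h9 : (execs [.const 12 0, .const 9 0] ν₁).reg 9 = (0 : Fin 3) := by
      simp [execs, Cmd.exec]
    have h12 : (execs [.const 12 0, .const 9 0] ν₁).reg 12 = 0 := by simp [execs, Cmd.exec]
    generalize execs [.const 12 0, .const 9 0] ν₁ = ν₂ at *
    have h₂ := h₁.keeps (hk₂.to_sim (by norm_num) (by norm_num))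
    refine (Det.seq (t₁ := 100 * φ.length + 50) (t₂ := 20) ?_).mono (by omega) fun _ h => h
    refine (det_moveState h₂.ctx hs₂ h9).mono le_rfl ?_
    rintro ν₃ ⟨hk₃, hs₃, h12'⟩
    rw [h12] at h12'
    have h₃ := h₂.keeps (hk₃.to_sim (by norm_num) (by norm_num))
    have hsim : simState ν₃ = simState ν := by
      rw [simState_keeps (hk₃.to_sim (by norm_num) (by norm_num)),
        simState_keeps (hk₂.to_sim (by norm_num) (by norm_num)),
        simState_keeps (hk₁.to_sim (by norm_num) (by norm_num))]
    refine (Det.seq (t₁ := 6) (t₂ := 1) ?_).mono (by omega) fun _ h => h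
    refine Det.ite ?_ ?_
    · intro hf
      have hσs : IsSolved φ σ := by
        by_contra hn
        rw [if_neg hn] at h12'
        exact hf h12'
      refine (det_found h₃ hsim).mono le_rfl fun ν' hν' => Det.skip ?_
      rw [if_pos hσs]
      exact hν'
    · intro hf
      have hσs : ¬ IsSolved φ σ := by
        intro hn
        rw [if_pos hn] at h12'
        omega
      refine Det.block (by simp [Cmd.IsBasic]) ?_
      change Det _ _ ((ν₃.setReg (40 + num) 0).setReg (40 + den) 1) _
      refine Det.skip ⟨?_, ?_⟩
      · exact (h₃.setReg (Or.inl (by omega))).setReg (Or.inl (by omega))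
      · rw [if_neg hσs]
        refine (simState_setReg _ den 1).trans ?_
        rw [simState_setReg]
        have h26 : (ν₃.setReg (40 + num) 0).reg 26 = ν₃.reg 26 := by
          rw [Mem.setReg_reg, if_neg (by omega)]
        have h27 : (ν₃.setReg (40 + num) 0).reg 27 = ν₃.reg 27 := by
          rw [Mem.setReg_reg, if_neg (by omega)]
        rw [h26, h27, hsim]
        have e1 : ν₃.reg 26 = (simState ν).bud := congrArg BState.bud hsim
        have e2 : ν₃.reg 27 = (simState ν).fnd := congrArg BState.fnd hsim
        rw [e1, e2]
        rfl
  | trans x s a =>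
    refine (det_readQuery h s (t := 10 * v + 16 * Z + 100 * φ.length + 200)
      fun ν₁ h₁ hk₁ hs₁ => ?_).mono (by omega) fun _ h => h
    generalize hσ : SatState.decode v ((v + 2) ^ r) ((simState ν).mem.reg s) = σ at hs₁
    simp only [satSim, hσ]
    refine (Det.seq (t₁ := 5) (t₂ := 10 * v + 16 * Z + 100 * φ.length + 190) ?_).mono (by omega)
      fun _ h => h
    refine Det.block_keeps (n := 13) (k := 1) (by simp [Cmd.IsBasic]) (by simp [Cmd.WritesBelow])
      fun hk₂ => ?_
    have hs₂ := hs₁.keeps' hk₂ (by simp [execs, Cmd.exec]) (by simp [execs, Cmd.exec]) le_rfl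
    have h9 : (execs [.const 12 0, .add 9 (40 + a) 34] ν₁).reg 9 = ν.reg (40 + a) := by
      have : 40 + a ≠ 12 := by omega
      simp [execs, Cmd.exec, h₁.ctx.zero, this, hk₁.reg (40 + a) (by omega)]
    have h12 : (execs [.const 12 0, .add 9 (40 + a) 34] ν₁).reg 12 = 0 := by
      simp [execs, Cmd.exec]
    generalize execs [.const 12 0, .add 9 (40 + a) 34] ν₁ = ν₂ at *
    have h₂ := h₁.keeps (hk₂.to_sim (by norm_num) (by norm_num))
    refine (Det.seq (t₁ := 16 * Z + 40) (t₂ := 10 * v + 100 * φ.length + 140) ?_).mono (by omega)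
      fun _ h => h
    refine (det_modThree (Z := Z) (by rw [h9]; exact hZ a)).mono le_rfl ?_
    rintro ν₃ ⟨hk₃, h9'⟩
    have hs₃ := hs₂.keeps hk₃ le_rfl le_rfl
    have h₃ := h₂.keeps (hk₃.to_sim (by norm_num) (by norm_num))
    refine (Det.seq (t₁ := 100 * φ.length + 50) (t₂ := 10 * v + 80) ?_).mono (by omega)
      fun _ h => h
    refine (det_moveState h₃.ctx hs₃ (a := Fin.ofNat 3 ((simState ν).mem.reg a))
      (by rw [h9', h9]; rfl)).mono le_rfl ?_
    rintro ν₄ ⟨hk₄, hs₄, h12'⟩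
    rw [hk₃.reg 12 (by norm_num), h12] at h12'
    have h₄ := h₃.keeps (hk₄.to_sim (by norm_num) (by norm_num))
    refine (Det.seq (t₁ := 10 * v + 20) (t₂ := 20) ?_).mono (by omega) fun _ h => h
    refine (det_writeCode h₄.ctx hs₄).mono le_rfl ?_
    rintro ν₅ ⟨hk₅, h0⟩
    rw [← hk₅.reg 12 (by norm_num)] at h12'
    have h₅ := h₄.keeps (hk₅.to_sim (by norm_num) (by norm_num))
    have hsim : simState ν₅ = simState ν := by
      rw [simState_keeps (hk₅.to_sim (by norm_num) (by norm_num)),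
        simState_keeps (hk₄.to_sim (by norm_num) (by norm_num)),
        simState_keeps (hk₃.to_sim (by norm_num) (by norm_num)),
        simState_keeps (hk₂.to_sim (by norm_num) (by norm_num)),
        simState_keeps (hk₁.to_sim (by norm_num) (by norm_num))]
    refine (Det.seq (t₁ := 6) (t₂ := 1) ?_).mono (by omega) fun _ h => h
    refine Det.ite ?_ ?_
    · intro hf
      have hσs : IsSolved φ σ := by
        by_contra hn
        rw [if_neg hn] at h12'
        exact hf h12'
      refine (det_found h₅ hsim).mono le_rfl fun ν' hν' => Det.skip ?_
      rw [if_pos hσs]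
      exact hν'
    · intro hf
      have hσs : ¬ IsSolved φ σ := by
        intro hn
        rw [if_pos hn] at h12'
        omega
      refine (Det.basic (by simp [Cmd.IsBasic]) (Det.skip ⟨?_, ?_⟩)).mono (t := 1) (by omega)
        fun _ h => h
      · exact h₅.setReg (Or.inl (by omega))
      · rw [if_neg hσs]
        refine (simState_setReg _ x _).trans ?_
        rw [h0, h₅.ctx.zero, add_zero, hsim]
        have e1 : ν₅.reg 26 = (simState ν).bud := congrArg BState.bud hsim
        have e2 : ν₅.reg 27 = (simState ν).fnd := congrArg BState.fnd hsim
        rw [e1, e2]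
        rfl
  | featV y s =>
    refine (det_readQuery h s (t := featTime v r + 2) fun ν₁ h₁ hk₁ hs₁ => ?_).mono
      (by omega) fun _ h => h
    simp only [satSim]
    have hsim := simState_keeps (hk₁.to_sim (by norm_num) (by norm_num))
    refine (Det.seq (t₁ := featTime v r) (t₂ := 1) ?_).mono (by omega) fun _ h => h
    refine (det_writeFeatures h₁.ctx (a := 4 + 2 * y) (b := 5 + 2 * y) (by omega) (by omega)
      (by omega) hs₁).mono le_rfl fun ν₂ hv => Det.skip ⟨h₁.holdsVec hv, ?_⟩
    rw [simState_holdsVec hv, hsim]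
    have e1 : ν₁.reg 26 = (simState ν).bud := congrArg BState.bud hsim
    have e2 : ν₁.reg 27 = (simState ν).fnd := congrArg BState.fnd hsim
    rw [e1, e2]
    rfl
  | featQ y s a =>
    refine (det_readQuery h s (t := featTime v r + 16 * Z + 100 * φ.length + 200)
      fun ν₁ h₁ hk₁ hs₁ => ?_).mono (by omega) fun _ h => h
    generalize hσ : SatState.decode v ((v + 2) ^ r) ((simState ν).mem.reg s) = σ at hs₁
    simp only [satSim, hσ]
    refine (Det.seq (t₁ := 7) (t₂ := featTime v r + 16 * Z + 100 * φ.length + 190) ?_).mono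
      (by omega) fun _ h => h
    refine Det.block_keeps (n := 13) (k := 1) (by simp [Cmd.IsBasic]) (by simp [Cmd.WritesBelow])
      fun hk₂ => ?_
    have hs₂ := hs₁.keeps' hk₂ (by simp [execs, Cmd.exec]) (by simp [execs, Cmd.exec]) le_rfl
    have h9 : (execs [.const 12 0, .add 9 (40 + a) 34, .sub 0 10 33] ν₁).reg 9
        = ν.reg (40 + a) := by
      have : 40 + a ≠ 12 := by omega
      simp [execs, Cmd.exec, h₁.ctx.zero, this, hk₁.reg (40 + a) (by omega)]
    have h12 : (execs [.const 12 0, .add 9 (40 + a) 34, .sub 0 10 33] ν₁).reg 12 = 0 := by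
      simp [execs, Cmd.exec]
    have h0 : (execs [.const 12 0, .add 9 (40 + a) 34, .sub 0 10 33] ν₁).reg 0
        = ν₁.reg 10 - 1 := by
      simp [execs, Cmd.exec, h₁.ctx.one]
    generalize execs [.const 12 0, .add 9 (40 + a) 34, .sub 0 10 33] ν₁ = ν₂ at *
    have h₂ := h₁.keeps (hk₂.to_sim (by norm_num) (by norm_num))
    have hsim₂ : simState ν₂ = simState ν := by
      rw [simState_keeps (hk₂.to_sim (by norm_num) (by norm_num)),
        simState_keeps (hk₁.to_sim (by norm_num) (by norm_num))]
    have fin : ∀ (ν₃ : Mem) (σ' : SatState v ((v + 2) ^ r)), SimBase φ r ν₀ ν₃ →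
        simState ν₃ = simState ν → Holds σ' ν₃ → ν₃.reg 12 = 0 →
        Det (block [.ite 12 found (writeFeatures (4 + 2 * y) (5 + 2 * y))]) (featTime v r + 10) ν₃
          fun ν' => SimBase φ r ν₀ ν' ∧ simState ν' = (simState ν).after (some
            ((simState ν).mem.setArr y (writeVec (simFeat r σ') ((simState ν).mem.arr y)))) := by
      intro ν₃ σ' h₃ hsim hs₃ hf
      refine (Det.seq (t₁ := featTime v r + 1) (t₂ := 1) ?_).mono (by omega) fun _ h => h
      refine Det.ite (fun h => absurd hf h) fun _ => ?_
      refine (det_writeFeatures h₃.ctx (a := 4 + 2 * y) (b := 5 + 2 * y) (by omega) (by omega)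
        (by omega) hs₃).mono le_rfl fun ν₂ hv => Det.skip ⟨h₃.holdsVec hv, ?_⟩
      rw [simState_holdsVec hv, hsim]
      have e1 : ν₃.reg 26 = (simState ν).bud := congrArg BState.bud hsim
      have e2 : ν₃.reg 27 = (simState ν).fnd := congrArg BState.fnd hsim
      rw [e1, e2]
      rfl
    -- Register `10` holds `d - l`, or zero for the end state, so after subtracting one it vanishes
    -- exactly where no move is to be made.
    have hσ0 : (ν₁.reg 10 - 1 = 0 ↔ σ = none ∨ IsLeaf σ) := by
      rcases σ with _ | ⟨l, w⟩
      · have : ν₁.reg 10 = 0 := hs₁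
        simp [this]
      · have := hs₁.1
        have := l.2
        simp only [reduceCtorEq, false_or, IsLeaf]
        omega
    refine (Det.seq (t₁ := 16 * Z + 100 * φ.length + 150) (t₂ := featTime v r + 10) ?_).mono
      (by omega) fun _ h => h
    refine (Det.ite (t := 16 * Z + 100 * φ.length + 140) ?_ ?_).mono (by omega) fun _ h => h
    · intro hne
      rw [h0] at hne
      have hnl : ¬ IsLeaf σ := fun hl => hne (hσ0.2 (Or.inr hl))
      rw [if_neg hnl]
      refine (Det.seq (t₁ := 16 * Z + 40) (t₂ := 100 * φ.length + 60) ?_).mono (by omega)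
        fun _ h => h
      refine (det_modThree (Z := Z) (by rw [h9]; exact hZ a)).mono le_rfl ?_
      rintro ν₃ ⟨hk₃, h9'⟩
      have hs₃ := hs₂.keeps hk₃ le_rfl le_rfl
      have h₃ := h₂.keeps (hk₃.to_sim (by norm_num) (by norm_num))
      refine (Det.seq (t₁ := 100 * φ.length + 50) (t₂ := 1) ?_).mono (by omega) fun _ h => h
      refine (det_moveState h₃.ctx hs₃ (a := Fin.ofNat 3 ((simState ν).mem.reg a))
        (by rw [h9', h9]; rfl)).mono le_rfl ?_
      rintro ν₄ ⟨hk₄, hs₄, h12'⟩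
      rw [hk₃.reg 12 (by norm_num), h12] at h12'
      have h₄ := h₃.keeps (hk₄.to_sim (by norm_num) (by norm_num))
      have hsim : simState ν₄ = simState ν := by
        rw [simState_keeps (hk₄.to_sim (by norm_num) (by norm_num)),
          simState_keeps (hk₃.to_sim (by norm_num) (by norm_num)), hsim₂]
      refine Det.skip ?_
      by_cases hσs : IsSolved φ σ
      · rw [if_pos hσs] at h12'
        rw [if_pos hσs]
        refine (Det.seq (t₁ := 6) (t₂ := 1) ?_).mono (by unfold featTime; omega) fun _ h => h
        refine Det.ite (fun _ => ?_) fun hf => by omega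
        exact (det_found h₄ hsim).mono le_rfl fun ν' hν' => Det.skip hν'
      · rw [if_neg hσs] at h12'
        rw [if_neg hσs]
        exact fin ν₄ _ h₄ hsim hs₄ h12'
    · intro he
      rw [h0] at he
      refine Det.mono (t := 1) (Det.skip ?_) (by omega) fun _ h => h
      rcases hσ0.1 he with rfl | hl
      · rw [if_neg (fun h : IsLeaf none => h), if_neg (fun h : IsSolved φ none => h)]
        exact fin ν₂ _ h₂ hsim₂ hs₂ h12
      · rw [if_pos hl]
        exact fin ν₂ _ h₂ hsim₂ hs₂ h12

theorem det_simAtom {Z : ℕ} (h : SimBase φ r ν₀ ν) (hZ : ∀ x, ν.reg (40 + x) < 2 ^ Z)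
    (c : Cmd RLQuery) :
    Det (simAtom c) (atomTime v r φ.length Z) ν fun ν' =>
      SimBase φ r ν₀ ν' ∧
        simState ν' = (simState ν).after (effect (satSim φ r) c (simState ν).mem) := by
  have hT : 400 ≤ atomTime v r φ.length Z := Nat.le_add_left _ _
  have setReg : ∀ (x n : ℕ), SimBase φ r ν₀ (ν.setReg (40 + x) n) ∧
      simState (ν.setReg (40 + x) n) = (simState ν).after (some ((simState ν).mem.setReg x n)) :=
    fun x n => ⟨h.setReg (Or.inl (by omega)), simState_setReg ν x n⟩
  cases c with
  | const x n =>
    exact (Det.basic (by simp [simAtom, Cmd.IsBasic]) (setReg x _)).mono (by omega) fun _ h => h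
  | add x y z =>
    exact (Det.basic (by simp [simAtom, Cmd.IsBasic]) (setReg x _)).mono (by omega) fun _ h => h
  | sub x y z =>
    exact (Det.basic (by simp [simAtom, Cmd.IsBasic]) (setReg x _)).mono (by omega) fun _ h => h
  | half x y =>
    exact (Det.basic (by simp [simAtom, Cmd.IsBasic]) (setReg x _)).mono (by omega) fun _ h => h
  | load x a i =>
    refine (Det.seq (t₁ := 9) (t₂ := 10) ?_).mono (by omega) fun _ h => h
    refine Det.block_keeps (n := 12) (k := 1) (by simp [Cmd.IsBasic]) (by simp [Cmd.WritesBelow])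
      fun hk => ?_
    -- Two truncated differences in opposite directions have sum zero only if the mark equals the
    -- number of the present run.
    have h1 : (execs [.load 0 (5 + 2 * a) (40 + i), .sub 1 0 28, .sub 2 28 0, .add 1 1 2] ν).reg 1
        = 0 ↔ ν.arr (5 + 2 * a) (ν.reg (40 + i)) = ν.reg 28 := by
      simp [execs, Cmd.exec]
      omega
    generalize execs [.load 0 (5 + 2 * a) (40 + i), .sub 1 0 28, .sub 2 28 0, .add 1 1 2] ν = ν₁
      at *
    have h₁ := h.keeps (hk.to_sim (by norm_num) (by norm_num))
    have hsim := simState_keeps (hk.to_sim (by norm_num) (by norm_num))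
    have hfin : ∀ n, n = (simState ν).mem.arr a ((simState ν).mem.reg i) →
        SimBase φ r ν₀ (ν₁.setReg (40 + x) n) ∧ simState (ν₁.setReg (40 + x) n)
          = (simState ν).after (effect (satSim φ r) (.load x a i) (simState ν).mem) := by
      rintro n rfl
      refine ⟨h₁.setReg (Or.inl (by omega)), ?_⟩
      rw [simState_setReg, hsim, hk.reg 26 (by norm_num), hk.reg 27 (by norm_num)]
      rfl
    refine (Det.seq (t₁ := 2) (t₂ := 1) ?_).mono (by omega) fun _ h => h
    refine Det.ite ?_ ?_
    · intro hne
      refine Det.basic (by simp [Cmd.IsBasic]) (Det.skip (hfin 0 ?_))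
      simp only [simState]
      rw [if_neg (fun h => hne (h1.2 h))]
    · intro he
      refine Det.basic (by simp [Cmd.IsBasic]) (Det.skip (hfin _ ?_))
      simp only [simState]
      rw [if_pos (h1.1 he), hk.arr _ (by omega), hk.reg _ (by omega)]
  | store a i x =>
    refine (Det.block (by simp [Cmd.IsBasic]) ?_).mono (t := 5) (by omega) fun _ h => h
    have h5 : 5 + 2 * a ≠ 4 + 2 * a := by omega
    have : execs [.store (4 + 2 * a) (40 + i) (40 + x), .store (5 + 2 * a) (40 + i) 28] ν
        = (ν.setArr (4 + 2 * a) (Function.update (ν.arr (4 + 2 * a)) (ν.reg (40 + i))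
            (ν.reg (40 + x)))).setArr (5 + 2 * a)
            (Function.update (ν.arr (5 + 2 * a)) (ν.reg (40 + i)) (ν.reg 28)) := by
      simp [execs, Cmd.exec]
    rw [this]
    exact ⟨h.store a _ _, simState_store ν a _ _⟩
  | call o => exact det_answer h hZ o
  | _ => exact (Det.skip ⟨h, rfl⟩).mono (by omega) fun _ h => h

end Atom

/-! ### Bounds on the memory of the simulated machine -/

/-- The instruction writes only to registers below `X`, and its numerals are less than `2 ^ Y`. -/
def Cmd.Fits (X Y : ℕ) : Cmd RLQuery → Prop
  | .const x n => x < X ∧ n < 2 ^ Y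
  | .add x _ _ | .sub x _ _ | .half x _ | .load x _ _ | .flip x => x < X
  | .call (.reward num den _ _) => num < X ∧ den < X
  | .call (.trans x _ _) => x < X
  | .seq c₁ c₂ | .ite _ c₁ c₂ => c₁.Fits X Y ∧ c₂.Fits X Y
  | .while _ c => c.Fits X Y
  | _ => True

theorem Cmd.Fits.mono {X X' Y Y' : ℕ} (hX : X ≤ X') (hY : Y ≤ Y') :
    ∀ {c : Cmd RLQuery}, c.Fits X Y → c.Fits X' Y'
  | .const _ _, h => ⟨h.1.trans_le hX, h.2.trans_le (Nat.pow_le_pow_right two_pos hY)⟩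
  | .add _ _ _, h | .sub _ _ _, h | .half _ _, h | .load _ _ _, h | .flip _, h =>
    Nat.lt_of_lt_of_le h hX
  | .call (.reward _ _ _ _), h => ⟨h.1.trans_le hX, h.2.trans_le hX⟩
  | .call (.trans _ _ _), h => Nat.lt_of_lt_of_le h hX
  | .seq _ _, h | .ite _ _ _, h => ⟨h.1.mono hX hY, h.2.mono hX hY⟩
  | .while _ c, h => Cmd.Fits.mono (c := c) hX hY h
  | .skip, _ | .store _ _ _, _ | .call (.featV _ _), _ | .call (.featQ _ _ _), _ => trivial

theorem Cmd.exists_fits (c : Cmd RLQuery) : ∃ X, 3 ≤ X ∧ ∃ Y, c.Fits X Y := by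
  have two : ∀ c₁ c₂ : Cmd RLQuery, (∃ X, 3 ≤ X ∧ ∃ Y, c₁.Fits X Y) →
      (∃ X, 3 ≤ X ∧ ∃ Y, c₂.Fits X Y) →
      ∃ X, 3 ≤ X ∧ ∃ Y, c₁.Fits X Y ∧ c₂.Fits X Y := by
    rintro c₁ c₂ ⟨X₁, h₁, Y₁, h₁'⟩ ⟨X₂, h₂, Y₂, h₂'⟩
    exact ⟨max X₁ X₂, h₁.trans (le_max_left _ _), max Y₁ Y₂,
      h₁'.mono (le_max_left _ _) (le_max_left _ _),
      h₂'.mono (le_max_right _ _) (le_max_right _ _)⟩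
  have reg : ∀ x : ℕ, ∃ X, 3 ≤ X ∧ ∃ _ : ℕ, x < X := fun x => ⟨x + 3, by omega, 0, by omega⟩
  induction c with
  | const x n => exact ⟨x + 3, by omega, n, by omega, n.lt_two_pow_self⟩
  | add x | sub x | half x | load x | flip x => exact reg x
  | call o =>
    cases o with
    | reward num den => exact ⟨num + den + 3, by omega, 0, by omega, by omega⟩
    | trans x => exact reg x
    | _ => exact ⟨3, le_rfl, 0, trivial⟩
  | seq c₁ c₂ h₁ h₂ => exact two c₁ c₂ h₁ h₂
  | ite x c₁ c₂ h₁ h₂ => exact two c₁ c₂ h₁ h₂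
  | skip | store => exact ⟨3, le_rfl, 0, trivial⟩
  | _ =>
    rename_i x c h
    exact h

/-- All words are less than `n`, and the registers from `X` on are zero. -/
structure Mem.Below (X n : ℕ) (μ : Mem) : Prop where
  reg : ∀ x, μ.reg x < n
  zero : ∀ x, X ≤ x → μ.reg x = 0
  arr : ∀ a i, μ.arr a i < n

section Below

variable {X n : ℕ} {μ : Mem}

theorem Mem.Below.mono {n' : ℕ} (h : μ.Below X n) (hn : n ≤ n') : μ.Below X n' :=
  ⟨fun x => (h.reg x).trans_le hn, h.zero, fun a i => (h.arr a i).trans_le hn⟩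

theorem Mem.Below.setReg (h : μ.Below X n) {x m : ℕ} (hx : x < X) (hm : m < n) :
    (μ.setReg x m).Below X n := by
  refine ⟨fun y => ?_, fun y hy => ?_, h.arr⟩
  · rw [Mem.setReg_reg]
    split_ifs
    exacts [hm, h.reg y]
  · rw [Mem.setReg_reg, if_neg (by omega), h.zero y hy]

theorem Mem.Below.setArr (h : μ.Below X n) {a : ℕ} {f : ℕ → ℕ} (hf : ∀ i, f i < n) :
    (μ.setArr a f).Below X n := by
  refine ⟨h.reg, h.zero, fun b i => ?_⟩
  rw [Mem.setArr_arr]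
  split_ifs
  exacts [hf i, h.arr b i]

theorem writeVec_simFeat_lt {v r : ℕ} (hr : 8 ≤ r) (hn : 2 ^ ((v + 2) ^ r + 1) ≤ n)
    (s : SatState v ((v + 2) ^ r)) {old : ℕ → ℕ} (hold : ∀ i, old i < n) (i : ℕ) :
    writeVec (simFeat r s) old i < n := by
  have h1 : 1 < n := (Nat.one_lt_two_pow (by omega)).trans_le hn
  rw [writeVec_simFeat]
  split_ifs
  · unfold vecCell
    split_ifs
    all_goals first | omega | exact (featOf_lt hr _ (by omega)).trans_le hn
  · exact hold i

/-- Only an addition can produce words larger than those present, and it at most doubles them.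
Numerals, codes and features are below `2 ^ Y` from the outset. -/
theorem effect_below {v : ℕ} {φ : CNF3 v} {r Y : ℕ} (hr : 8 ≤ r) (hY : (v + 2) ^ r + 1 ≤ Y)
    (hn : 2 ^ Y ≤ n) (h : μ.Below X n) {c : Cmd RLQuery} (hc : c.Fits X Y) {μ' : Mem}
    (he : effect (satSim φ r) c μ = some μ') : μ'.Below X (2 * n) := by
  have hd : 2 ^ ((v + 2) ^ r + 1) ≤ n := (Nat.pow_le_pow_right two_pos hY).trans hn
  have h1 : 1 < n := (Nat.one_lt_two_pow (by omega)).trans_le hd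
  have h' : μ.Below X (2 * n) := h.mono (by omega)
  have vec : ∀ (a : ℕ) (s : SatState v ((v + 2) ^ r)),
      (μ.setArr a (writeVec (simFeat r s) (μ.arr a))).Below X (2 * n) := fun a s =>
    h'.setArr fun i => writeVec_simFeat_lt hr (by omega) s (h'.arr a) i
  cases c with
  | const x m => cases he; exact h'.setReg hc.1 (by have := hc.2; omega)
  | add x y z =>
    cases he
    exact h'.setReg hc (by have := h.reg y; have := h.reg z; omega)
  | sub x y z => cases he; exact h'.setReg hc (by have := h.reg y; omega)
  | half x y => cases he; exact h'.setReg hc (by have := h.reg y; omega)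
  | load x a i => cases he; exact h'.setReg hc (h'.arr _ _)
  | store a i x =>
    cases he
    refine h'.setArr fun j => ?_
    rw [Function.update_apply]
    split_ifs
    exacts [h'.reg x, h'.arr a j]
  | call o =>
    cases o with
    | reward num den s a =>
      simp only [effect, satSim] at he
      split_ifs at he
      cases he
      exact (h'.setReg hc.1 (by omega)).setReg hc.2 (by omega)
    | trans x s a =>
      simp only [effect, satSim] at he
      split_ifs at he
      cases he
      exact h'.setReg hc (((satMDP_code_lt hr _).trans_le hd).trans_le (by omega))
    | featV y s => cases he; exact vec _ _
    | featQ y s a =>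
      simp only [effect, satSim] at he
      split_ifs at he <;> cases he <;> exact vec _ _
  | _ => cases he; exact h'

end Below

/-- With less budget left, the words may be larger. -/
structure BState.Bounded (X Y Z : ℕ) (s : BState) : Prop where
  bud : s.bud + Y ≤ Z
  mem : s.mem.Below X (2 ^ (Z - s.bud))

theorem BState.Bounded.tick {X Y Z : ℕ} {s : BState} (h : s.Bounded X Y Z) (h0 : s.bud ≠ 0)
    {μ : Mem} (hμ : μ.Below X (2 * 2 ^ (Z - s.bud))) : (s.tick μ).Bounded X Y Z := by
  have := h.bud
  refine ⟨?_, ?_⟩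
  · simp only [BState.tick]; omega
  · have e : Z - (s.bud - 1) = (Z - s.bud) + 1 := by omega
    simp only [BState.tick]
    rw [e, pow_succ']
    exact hμ

theorem BState.Bounded.apply {v : ℕ} {φ : CNF3 v} {r X Y Z : ℕ} (hr : 8 ≤ r)
    (hY : (v + 2) ^ r + 1 ≤ Y) {s : BState} (h : s.Bounded X Y Z) (h0 : s.bud ≠ 0)
    {c : Cmd RLQuery} (hc : c.Fits X Y) :
    (s.apply (effect (satSim φ r) c s.mem)).Bounded X Y Z := by
  have hb := h.bud
  cases he : effect (satSim φ r) c s.mem with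
  | some μ =>
    exact h.tick h0 (effect_below hr hY (Nat.pow_le_pow_right two_pos (by omega)) h.mem hc he)
  | none =>
    refine ⟨by simp only [BState.apply]; omega, ?_⟩
    exact h.mem.mono (Nat.pow_le_pow_right two_pos (by simp only [BState.apply]; omega))

/-! ### The compiler -/

/-- Execute a command if the budget, in register `26`, allows for it. -/
def guarded (p : Cmd Empty) : Cmd Empty := .ite 26 (.seq (.sub 26 26 33) p) .skip

/-- Copy register `x` of the simulated machine to register `0`, which is set to zero if there is no
budget. -/
def loadTest (x : ℕ) : Cmd Empty := .ite 26 (.add 0 (40 + x) 34) (.const 0 0)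

/-- The program which simulates a given program with access to an MDP. -/
def comp : Cmd RLQuery → Cmd Empty
  | .skip => .skip
  | .flip x => guarded (.flip (40 + x))
  | .seq c₁ c₂ => .seq (comp c₁) (comp c₂)
  | .ite x c₁ c₂ => .ite (40 + x) (comp c₁) (comp c₂)
  -- The loop tests a copy of the register that is zeroed when the budget is gone, so that an
  -- endless simulated loop still terminates.
  | .while x c => .seq (loadTest x)
      (.while 0 (.seq (.sub 26 26 33) (.seq (comp c) (loadTest x))))
  | .const x n => guarded (simAtom (.const x n))
  | .add x y z => guarded (simAtom (.add x y z))
  | .sub x y z => guarded (simAtom (.sub x y z))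
  | .half x y => guarded (simAtom (.half x y))
  | .load x a i => guarded (simAtom (.load x a i))
  | .store a i x => guarded (simAtom (.store a i x))
  | .call o => guarded (simAtom (.call o))

/-- The number of steps of the simulation which are not paid by the budget. -/
def Cmd.overhead : Cmd RLQuery → ℕ
  | .seq c₁ c₂ | .ite _ c₁ c₂ => c₁.overhead + c₂.overhead + 1
  | .while _ c => c.overhead + 10
  | _ => 2

theorem haltVal_step {Q : Type} {ans : Q → Mem → PMF Mem} {c c' : Config Q} {n m : ℕ}
    {f : Mem → ℝ≥0∞} {e : ℝ≥0∞} (h : step ans c = PMF.pure c') (hn : n + 1 ≤ m)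
    (he : e ≤ haltVal ans n c' f) : e ≤ haltVal ans m c f := by
  refine le_trans ?_ (haltVal_mono ans hn c f)
  rw [haltVal_succ, h, PMF.expect_pure]
  exact he

theorem Det.le_haltVal {c : Cmd Empty} {t : ℕ} {μ : Mem} {Q : Mem → Prop} (h : Det c t μ Q)
    {k : List (Cmd Empty)} {n m : ℕ} {f : Mem → ℝ≥0∞} {e : ℝ≥0∞} (hm : n + t ≤ m)
    (he : ∀ μ', Q μ' → e ≤ haltVal noAns n (k, μ') f) : e ≤ haltVal noAns m (c :: k, μ) f := by
  obtain ⟨μ', n', hn', hQ, hrun⟩ := h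
  refine le_trans ?_ (haltVal_mono noAns (m := n' + n) (by omega) _ f)
  rw [haltVal_add_of_pure noAns (hrun k)]
  exact he μ' hQ

/-- The invariant of the simulation. -/
structure SimInv {v : ℕ} (φ : CNF3 v) (r X Y Z : ℕ) (ν₀ ν : Mem) : Prop where
  base : SimBase φ r ν₀ ν
  bounded : (simState ν).Bounded X Y Z

section Simulate

variable {v : ℕ} {φ : CNF3 v} {r X Y Z : ℕ} {ν₀ ν : Mem}

theorem SimInv.reg_lt (h : SimInv φ r X Y Z ν₀ ν) (x : ℕ) : ν.reg (40 + x) < 2 ^ Z :=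
  (h.bounded.mem.reg x).trans_le (Nat.pow_le_pow_right two_pos (Nat.sub_le _ _))

theorem simState_tick (ν : Mem) :
    simState (ν.setReg 26 (ν.reg 26 - 1)) = (simState ν).tick (simState ν).mem :=
  simState_setBudget ν _

theorem SimInv.tick (h : SimInv φ r X Y Z ν₀ ν) (h0 : ν.reg 26 ≠ 0) :
    SimInv φ r X Y Z ν₀ (ν.setReg 26 (ν.reg 26 - 1)) :=
  ⟨h.base.setReg (Or.inr (Or.inl rfl)), by
    rw [simState_tick]
    exact h.bounded.tick h0 (h.bounded.mem.mono (by omega))⟩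

theorem simState_loadTest (ν : Mem) (n : ℕ) : simState (ν.setReg 0 n) = simState ν :=
  simState_keeps ⟨fun x hx => by rw [Mem.setReg_reg, if_neg (by omega)], fun _ _ => rfl⟩

theorem det_loadTest (h : SimInv φ r X Y Z ν₀ ν) (x : ℕ) :
    Det (loadTest x) 2 ν fun ν' => SimInv φ r X Y Z ν₀ ν' ∧ simState ν' = simState ν ∧
      ν'.reg 0 = if ν.reg 26 = 0 then 0 else ν.reg (40 + x) := by
  have key : ∀ n, SimInv φ r X Y Z ν₀ (ν.setReg 0 n) := fun n =>
    ⟨h.base.keeps ⟨fun x hx => by rw [Mem.setReg_reg, if_neg (by omega)], fun _ _ => rfl⟩, by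
      rw [simState_loadTest]; exact h.bounded⟩
  refine Det.ite (t := 1) (fun h0 => ?_) fun h0 => ?_
  · refine Det.basic (by simp [Cmd.IsBasic]) ⟨key _, simState_loadTest _ _, ?_⟩
    simp [Cmd.exec, h0, h.base.ctx.zero]
  · refine Det.basic (by simp [Cmd.IsBasic]) ⟨key _, simState_loadTest _ _, ?_⟩
    simp [Cmd.exec, h0]

/-- The value of a continuation is compared with `g`. -/
def Continues (φ : CNF3 v) (r X Y Z : ℕ) (ν₀ : Mem) (τ N B : ℕ) (k : List (Cmd Empty))
    (f : Mem → ℝ≥0∞) (g : BState → ℝ≥0∞) : Prop :=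
  ∀ ν, SimInv φ r X Y Z ν₀ ν → ν.reg 26 ≤ B →
    g (simState ν) ≤ haltVal noAns (N + τ * ν.reg 26) (k, ν) f

theorem Continues.mono {τ N B B' : ℕ} {k : List (Cmd Empty)} {f : Mem → ℝ≥0∞}
    {g : BState → ℝ≥0∞} (h : Continues φ r X Y Z ν₀ τ N B k f g) (hB : B' ≤ B) :
    Continues φ r X Y Z ν₀ τ N B' k f g := fun ν hν hb => h ν hν (hb.trans hB)

/-- The compiled program simulates the given one, with a number of steps proportional to the
budget used. -/
theorem comp_simulates (hr : 8 ≤ r) (hY : (v + 2) ^ r + 1 ≤ Y) {τ : ℕ}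
    (hτ : atomTime v r φ.length Z + 6 ≤ τ) (c : Cmd RLQuery) (hc : c.Fits X Y)
    (hov : c.overhead + 10 ≤ τ) {k : List (Cmd Empty)} {N : ℕ} {f : Mem → ℝ≥0∞}
    {g : BState → ℝ≥0∞} {ν : Mem} (hν : SimInv φ r X Y Z ν₀ ν)
    (hk : Continues φ r X Y Z ν₀ τ N (ν.reg 26) k f g) :
    (den (satSim φ r) c (simState ν)).expect g
      ≤ haltVal noAns (N + c.overhead + τ * ν.reg 26) (comp c :: k, ν) f := by
  have atom : ∀ c : Cmd RLQuery, c.Fits X Y → ∀ {k : List (Cmd Empty)} {N : ℕ} {f : Mem → ℝ≥0∞}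
      {g : BState → ℝ≥0∞} {ν : Mem}, SimInv φ r X Y Z ν₀ ν →
      Continues φ r X Y Z ν₀ τ N (ν.reg 26) k f g →
      (denAtom (satSim φ r) c (simState ν)).expect g
        ≤ haltVal noAns (N + 2 + τ * ν.reg 26) (guarded (simAtom c) :: k, ν) f := by
    intro c hc k N f g ν hν hk
    rw [denAtom, PMF.expect_pure]
    by_cases h0 : ν.reg 26 = 0
    · rw [if_pos (show (simState ν).bud = 0 from h0)]
      refine (hk ν hν le_rfl).trans ?_
      refine haltVal_step (c' := (.skip :: k, ν)) (by simp [guarded, step, h0]) (n := N + 1 + τ * ν.reg 26)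
        (by omega) ?_
      exact haltVal_step rfl (by omega) le_rfl
    · rw [if_neg (show (simState ν).bud ≠ 0 from h0)]
      obtain ⟨b, hb⟩ : ∃ b, ν.reg 26 = b + 1 := Nat.exists_eq_succ_of_ne_zero h0
      have h1 := hν.tick h0
      -- The unit of budget spent releases `τ` steps, enough for the guard and for any elementary
      -- instruction.
      have hm : τ * ν.reg 26 = τ * b + τ := by rw [hb]; ring
      refine haltVal_step (c' := (.seq (.sub 26 26 33) (simAtom c) :: k, ν))
        (by simp [guarded, step, h0]) (n := N + 2 + τ * b + atomTime v r φ.length Z) (by omega) ?_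
      refine haltVal_step rfl (n := N + 1 + τ * b + atomTime v r φ.length Z) (by omega) ?_
      refine haltVal_step (c' := (simAtom c :: k, ν.setReg 26 (ν.reg 26 - 1)))
        (by simp [step, hν.base.ctx.one]) (n := N + τ * b + atomTime v r φ.length Z) (by omega) ?_
      refine (det_simAtom h1.base h1.reg_lt c).le_haltVal (n := N + τ * b) le_rfl ?_
      rintro ν' ⟨hν', hs⟩
      have hs' : simState ν' = (simState ν).apply (effect (satSim φ r) c (simState ν).mem) := by
        rw [hs, simState_tick]
        cases h : effect (satSim φ r) c (simState ν).mem <;>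
          simp [BState.tick, BState.after, BState.apply, h]
      have hbud : ν'.reg 26 ≤ b := by
        have e : ν'.reg 26 = (simState ν').bud := rfl
        have e' : (simState ν).bud = b + 1 := hb
        rw [e, hs']
        cases effect (satSim φ r) c (simState ν).mem <;>
          simp [BState.tick, BState.apply, e']
      rw [← hs']
      refine (hk ν' ⟨hν', ?_⟩ (by omega)).trans (haltVal_mono _ ?_ _ _)
      · rw [hs']
        exact hν.bounded.apply hr hY h0 hc
      · have := Nat.mul_le_mul_left τ hbud
        omega
  induction c generalizing k N f g ν with
  | skip =>
    simp only [den, PMF.expect_pure]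
    refine (hk ν hν le_rfl).trans ?_
    exact haltVal_step rfl (by simp only [Cmd.overhead]; omega) le_rfl
  | flip x =>
    simp only [den]
    change _ ≤ haltVal noAns (N + 2 + τ * ν.reg 26) _ f
    by_cases h0 : ν.reg 26 = 0
    · rw [if_pos (show (simState ν).bud = 0 from h0), PMF.expect_pure]
      refine (hk ν hν le_rfl).trans ?_
      refine haltVal_step (c' := (.skip :: k, ν)) (by simp [comp, guarded, step, h0])
        (n := N + 1 + τ * ν.reg 26) (by omega) ?_
      exact haltVal_step rfl (by omega) le_rfl
    · rw [if_neg (show (simState ν).bud ≠ 0 from h0)]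
      obtain ⟨b, hb⟩ : ∃ b, ν.reg 26 = b + 1 := Nat.exists_eq_succ_of_ne_zero h0
      have h1 := hν.tick h0
      have hm : τ * ν.reg 26 = τ * b + τ := by rw [hb]; ring
      refine haltVal_step (c' := (.seq (.sub 26 26 33) (.flip (40 + x)) :: k, ν))
        (by simp [comp, guarded, step, h0]) (n := N + τ * b + 3) (by omega) ?_
      refine haltVal_step rfl (n := N + τ * b + 2) (by omega) ?_
      refine haltVal_step (c' := (.flip (40 + x) :: k, ν.setReg 26 (ν.reg 26 - 1)))
        (by simp [step, hν.base.ctx.one]) (n := N + τ * b + 1) (by omega) ?_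
      rw [haltVal_succ]
      simp only [step, PMF.expect_map]
      refine PMF.expect_mono fun β => ?_
      have hs : simState ((ν.setReg 26 (ν.reg 26 - 1)).setReg (40 + x) β.toNat)
          = (simState ν).tick ((simState ν).mem.setReg x β.toNat) := by
        rw [simState_setReg, simState_tick]
        simp only [Mem.setReg_reg]
        rfl
      have hr26 : ((ν.setReg 26 (ν.reg 26 - 1)).setReg (40 + x) β.toNat).reg 26 = b := by
        rw [Mem.setReg_reg, if_neg (by omega), Mem.setReg_reg, if_pos rfl, hb]; rfl
      rw [← hs]
      have := hk _ ⟨h1.base.setReg (x := 40 + x) (n := β.toNat) (Or.inl (by omega)), ?_⟩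
        (by rw [hr26]; omega)
      · rwa [hr26] at this
      · rw [hs]
        refine hν.bounded.tick h0 ?_
        have hZ : 1 < 2 * 2 ^ (Z - (simState ν).bud) := by
          have := Nat.one_le_two_pow (n := Z - (simState ν).bud)
          omega
        refine (hν.bounded.mem.mono (by omega)).setReg hc ?_
        exact (Bool.toNat_lt β).trans_le hZ
  | seq c₁ c₂ ih₁ ih₂ =>
    simp only [Cmd.overhead] at hov
    simp only [den, PMF.expect_bind, comp, Cmd.overhead]
    refine haltVal_step rfl (n := N + c₂.overhead + c₁.overhead + τ * ν.reg 26) (by omega) ?_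
    refine ih₁ hc.1 (by omega) hν fun ν₁ hν₁ hb => ?_
    exact ih₂ hc.2 (by omega) hν₁ (hk.mono hb)
  | ite x c₁ c₂ ih₁ ih₂ =>
    simp only [Cmd.overhead] at hov
    simp only [den, comp, Cmd.overhead]
    by_cases h : ν.reg (40 + x) = 0
    · rw [if_neg (show ¬ (simState ν).mem.reg x ≠ 0 from fun h' => h' h)]
      refine haltVal_step (c' := (comp c₂ :: k, ν)) (by simp [step, h])
        (n := N + c₂.overhead + τ * ν.reg 26) (by omega) ?_
      exact ih₂ hc.2 (by omega) hν hk
    · rw [if_pos (show (simState ν).mem.reg x ≠ 0 from h)]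
      refine haltVal_step (c' := (comp c₁ :: k, ν)) (by simp [step, h])
        (n := N + c₁.overhead + τ * ν.reg 26) (by omega) ?_
      exact ih₁ hc.1 (by omega) hν hk
  | const | add | sub | half | load | store | call => exact atom _ hc hν hk
  | _ =>
    rename_i x c ih
    simp only [Cmd.overhead] at hov
    simp only [den, comp, Cmd.overhead]
    have loop : ∀ (n : ℕ) {ν' : Mem}, SimInv φ r X Y Z ν₀ ν' → ν'.reg 26 ≤ n →
        ν'.reg 26 ≤ ν.reg 26 →
        (ν'.reg 0 = if ν'.reg 26 = 0 then 0 else ν'.reg (40 + x)) →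
        (denLoop x (den (satSim φ r) c) n (simState ν')).expect g
          ≤ haltVal noAns (N + 1 + τ * ν'.reg 26)
            (.while 0 (.seq (.sub 26 26 33) (.seq (comp c) (loadTest x))) :: k, ν') f := by
      intro n
      have leave : ∀ {ν' : Mem}, SimInv φ r X Y Z ν₀ ν' → ν'.reg 26 ≤ ν.reg 26 → ν'.reg 0 = 0 →
          g (simState ν') ≤ haltVal noAns (N + 1 + τ * ν'.reg 26)
            (.while 0 (.seq (.sub 26 26 33) (.seq (comp c) (loadTest x))) :: k, ν') f := by
        intro ν' hν' hb h0
        exact haltVal_step (c' := (k, ν')) (by simp [step, h0]) (by omega) (hk ν' hν' hb)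
      induction n with
      | zero =>
        intro ν' hν' hn hb h0
        rw [if_pos (by omega)] at h0
        simpa only [denLoop, PMF.expect_pure] using leave hν' hb h0
      | succ n ihn =>
        intro ν' hν' hn hb h0
        simp only [denLoop]
        by_cases hx : ν'.reg 26 ≠ 0 ∧ ν'.reg (40 + x) ≠ 0
        · rw [if_pos (show (simState ν').bud ≠ 0 ∧ (simState ν').mem.reg x ≠ 0 from hx),
            PMF.expect_bind]
          rw [if_neg hx.1] at h0
          obtain ⟨b, hb'⟩ : ∃ b, ν'.reg 26 = b + 1 := Nat.exists_eq_succ_of_ne_zero hx.1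
          have h1 := hν'.tick hx.1
          have hm : τ * ν'.reg 26 = τ * b + τ := by rw [hb']; ring
          refine haltVal_step (c' := (.seq (.sub 26 26 33) (.seq (comp c) (loadTest x)) ::
            .while 0 (.seq (.sub 26 26 33) (.seq (comp c) (loadTest x))) :: k, ν'))
            (by simp [step, h0, hx.2]) (n := N + 1 + 2 + c.overhead + τ * b + 3) (by omega) ?_
          refine haltVal_step rfl (n := N + 1 + 2 + c.overhead + τ * b + 2) (by omega) ?_
          refine haltVal_step (c' := (.seq (comp c) (loadTest x) ::
            .while 0 (.seq (.sub 26 26 33) (.seq (comp c) (loadTest x))) :: k,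
            ν'.setReg 26 (ν'.reg 26 - 1)))
            (by simp [step, hν'.base.ctx.one]) (n := N + 1 + 2 + c.overhead + τ * b + 1)
            (by omega) ?_
          refine haltVal_step rfl (n := N + 1 + 2 + c.overhead + τ * b) (by omega) ?_
          rw [← simState_tick]
          have hr26 : (ν'.setReg 26 (ν'.reg 26 - 1)).reg 26 = b := by
            rw [Mem.setReg_reg, if_pos rfl, hb']; rfl
          -- The body is simulated with the remaining iterations as its continuation, whose value is
          -- the expectation over `denLoop` with fuel `n`.
          have := ih (k := loadTest x ::
            .while 0 (.seq (.sub 26 26 33) (.seq (comp c) (loadTest x))) :: k) (N := N + 1 + 2)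
            (f := f) (g := fun s => (denLoop x (den (satSim φ r) c) n s).expect g)
            hc (by omega) h1 ?_
          · rwa [hr26] at this
          · rw [hr26]
            intro ν₁ hν₁ hb₁
            refine (det_loadTest hν₁ x).le_haltVal (n := N + 1 + τ * ν₁.reg 26) (by omega) ?_
            rintro ν₂ ⟨hν₂, hs₂, h0₂⟩
            have e26 : ν₂.reg 26 = ν₁.reg 26 := congrArg BState.bud hs₂
            have e40 : ν₂.reg (40 + x) = ν₁.reg (40 + x) :=
              congrArg (fun s => s.mem.reg x) hs₂
            rw [← hs₂, ← e26]
            exact ihn hν₂ (by omega) (by omega) (by rw [h0₂, e26, e40])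
        · rw [if_neg (show ¬ ((simState ν').bud ≠ 0 ∧ (simState ν').mem.reg x ≠ 0) from hx),
            PMF.expect_pure]
          refine leave hν' hb ?_
          rw [h0]
          split_ifs with h2
          · rfl
          · by_contra h3
            exact hx ⟨h2, h3⟩
    refine haltVal_step rfl (n := N + 1 + τ * ν.reg 26 + 2) (by omega) ?_
    refine (det_loadTest hν x).le_haltVal (n := N + 1 + τ * ν.reg 26) (by omega) ?_
    rintro ν₁ ⟨hν₁, hs₁, h0₁⟩
    have e26 : ν₁.reg 26 = ν.reg 26 := congrArg BState.bud hs₁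
    have e40 : ν₁.reg (40 + x) = ν.reg (40 + x) := congrArg (fun s => s.mem.reg x) hs₁
    rw [← hs₁, ← e26]
    exact loop _ hν₁ le_rfl (by omega) (by rw [h0₁, e26, e40])

end Simulate

/-! ### The stages of the algorithm -/

/-- The budget of the stage with parameter `r`. -/
def stageBudget (B r : ℕ) : ℕ := B ^ ∑ i ∈ Finset.range r, i

theorem stageBudget_succ (B r : ℕ) : stageBudget B (r + 1) = stageBudget B r * B ^ r := by
  rw [stageBudget, stageBudget, Finset.sum_range_succ, pow_add]

theorem stageBudget_sq (B r : ℕ) : stageBudget B r ^ 2 = B ^ (r * (r - 1)) := by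
  rw [stageBudget, ← pow_mul, Finset.sum_range_id_mul_two]

/-- The registers of the main loop hold what they should in the stage with parameter `r`, and the
registers of the simulated machine from `X` on are zero. -/
structure Stage {v : ℕ} (φ : CNF3 v) (r X : ℕ) (ν : Mem) : Prop where
  ctx : Ctx φ r ν
  budget : ν.reg 32 = stageBudget (v + 2) r
  stage : ν.reg 29 = r
  mark : ∀ a i, ν.arr (5 + 2 * a) i ≤ ν.reg 28
  zero : ∀ x, X ≤ x → ν.reg (40 + x) = 0

/-- The product of two registers, in register `1`. -/
def mulReg (y z : ℕ) : Cmd Empty :=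
  block [block [.add 0 z 34, .const 1 0], .while 0 (block [.add 1 1 y, .sub 0 0 33])]

theorem det_mulReg {μ : Mem} (h33 : μ.reg 33 = 1) (h34 : μ.reg 34 = 0) {y z : ℕ} (hy : 2 ≤ y) :
    Det (mulReg y z) (6 * μ.reg z + 10) μ fun μ' =>
      Keeps 2 1 μ μ' ∧ μ'.reg 1 = μ.reg y * μ.reg z := by
  refine (Det.seq (t₁ := 5) (t₂ := 6 * μ.reg z + 4) ?_).mono (by omega) fun _ h => h
  refine Det.block_keeps (n := 2) (k := 1) (by simp [Cmd.IsBasic]) (by simp [Cmd.WritesBelow])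
    fun hk => ?_
  refine (Det.seq (t₁ := μ.reg z * (5 + 1) + 1) (t₂ := 1) ?_).mono (by omega) fun _ h => h
  refine Det.while (fun n μ' => Keeps 2 1 μ μ' ∧ n ≤ μ.reg z ∧ μ'.reg 0 = n ∧
    μ'.reg 1 = μ.reg y * (μ.reg z - n)) ?_ ?_ ?_
  · rintro n μ' ⟨h1, h2, h3, h4⟩ h5
    obtain ⟨m, rfl⟩ : ∃ m, n = m + 1 := Nat.exists_eq_succ_of_ne_zero (by omega)
    refine ⟨m, rfl, Det.block_keeps (n := 2) (k := 1) (by simp [Cmd.IsBasic])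
      (by simp [Cmd.WritesBelow]) fun hk' => ⟨h1.trans hk', by omega, ?_, ?_⟩⟩
    · simp [execs, Cmd.exec, h3, h1.reg 33 (by norm_num), h33]
    · have : μ.reg z - m = μ.reg z - (m + 1) + 1 := by omega
      simp [execs, Cmd.exec, h4, h1.reg y hy, this, Nat.mul_add]
  · rintro n μ' ⟨h1, h2, h3, h4⟩ h5
    refine Det.skip ⟨h1, ?_⟩
    rw [h4, ← h3, h5, Nat.sub_zero]
  · refine ⟨hk, le_rfl, ?_, ?_⟩
    · simp [execs, Cmd.exec, h34]
    · simp [execs, Cmd.exec]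

/-- Pass on to the next stage. -/
def update : Cmd Empty :=
  -- The new budget and level start use the old dimension `(v + 2) ^ r`, so they are updated before
  -- register `23`.
  block [mulReg 32 23, block [.add 32 1 34, .add 25 25 23], mulReg 23 22,
    block [.add 23 1 34, .add 24 23 20, .add 29 29 33, .add 30 29 34]]

section Stage

variable {v : ℕ} {φ : CNF3 v} {r X : ℕ} {ν : Mem}

theorem det_update (h : Stage φ r X ν) :
    Det update (6 * (v + 2) ^ r + 6 * (v + 2) + 60) ν fun ν' =>
      Stage φ (r + 1) X ν' ∧ ν'.reg 30 = r + 1 ∧ ν'.reg 27 = ν.reg 27 := by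
  have hc := h.ctx
  refine (Det.seq (t₁ := 6 * (v + 2) ^ r + 10) (t₂ := 6 * (v + 2) + 40) ?_).mono (by omega)
    fun _ h => h
  refine (det_mulReg hc.one hc.zero (by norm_num)).mono (by rw [hc.dim]) ?_
  rintro ν₁ ⟨hk₁, hp₁⟩
  refine (Det.seq (t₁ := 5) (t₂ := 6 * (v + 2) + 30) ?_).mono (by omega) fun _ h => h
  refine Det.block (by simp [Cmd.IsBasic]) ?_
  obtain ⟨ν₂, hν₂⟩ : ∃ ν₂, ν₂ = execs [.add 32 1 34, .add 25 25 23] ν₁ := ⟨_, rfl⟩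
  rw [← hν₂]
  have r₂ : ∀ x, 2 ≤ x → x ≠ 32 → x ≠ 25 → ν₂.reg x = ν.reg x := by
    intro x h1 h2 h3
    simp [hν₂, execs, Cmd.exec, h2, h3, hk₁.reg x h1]
  have a₂ : ∀ a, a = 0 ∨ 1 ≤ a → ν₂.arr a = ν.arr a := by
    intro a ha
    rw [← hk₁.arr a ha, hν₂]
    rfl
  have h32 : ν₂.reg 32 = ν.reg 32 * ν.reg 23 := by
    simp [hν₂, execs, Cmd.exec, hp₁, hk₁.reg 34 (by norm_num), hc.zero]
  have h25 : ν₂.reg 25 = ν.reg 25 + ν.reg 23 := by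
    simp [hν₂, execs, Cmd.exec, hk₁.reg 25 (by norm_num), hk₁.reg 23 (by norm_num)]
  clear hν₂
  refine (Det.seq (t₁ := 6 * (v + 2) + 10) (t₂ := 15) ?_).mono (by omega) fun _ h => h
  refine (det_mulReg (by rw [r₂ _ (by norm_num) (by norm_num) (by norm_num), hc.one])
    (by rw [r₂ _ (by norm_num) (by norm_num) (by norm_num), hc.zero]) (by norm_num)).mono
    (by rw [r₂ _ (by norm_num) (by norm_num) (by norm_num), hc.base]) ?_
  rintro ν₃ ⟨hk₃, hp₃⟩
  rw [r₂ 23 (by norm_num) (by norm_num) (by norm_num),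
    r₂ 22 (by norm_num) (by norm_num) (by norm_num), hc.dim, hc.base, ← pow_succ] at hp₃
  have r₃ : ∀ x, 2 ≤ x → x ≠ 32 → x ≠ 25 → ν₃.reg x = ν.reg x :=
    fun x h1 h2 h3 => (hk₃.reg x h1).trans (r₂ x h1 h2 h3)
  refine (Det.seq (t₁ := 9) (t₂ := 1) (Det.block (by simp [Cmd.IsBasic]) (Det.skip ?_))).mono
    (by omega) fun _ h => h
  obtain ⟨ν₄, hν₄⟩ : ∃ ν₄, ν₄ = execs [.add 23 1 34, .add 24 23 20, .add 29 29 33, .add 30 29 34]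
    ν₃ := ⟨_, rfl⟩
  rw [← hν₄]
  have r₄ : ∀ x, 2 ≤ x ∧ x ≠ 32 ∧ x ≠ 25 ∧ x ≠ 23 ∧ x ≠ 24 ∧ x ≠ 29 ∧ x ≠ 30 →
      ν₄.reg x = ν.reg x := by
    rintro x ⟨h1, h2, h3, h4, h5, h6, h7⟩
    simp [hν₄, execs, Cmd.exec, h4, h5, h6, h7, r₃ x h1 h2 h3]
  have a₄ : ∀ a, ν₄.arr a = ν.arr a := by
    intro a
    rw [← a₂ a (by omega), ← hk₃.arr a (by omega), hν₄]
    rfl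
  have z34 : ν₃.reg 34 = 0 := (r₃ 34 (by norm_num) (by norm_num) (by norm_num)).trans hc.zero
  have z33 : ν₃.reg 33 = 1 := (r₃ 33 (by norm_num) (by norm_num) (by norm_num)).trans hc.one
  have z20 : ν₃.reg 20 = v := (r₃ 20 (by norm_num) (by norm_num) (by norm_num)).trans hc.vars
  have z29 : ν₃.reg 29 = r := (r₃ 29 (by norm_num) (by norm_num) (by norm_num)).trans h.stage
  refine ⟨⟨⟨?_, ?_, ?_, ?_, ?_, ?_, ?_, ?_, ?_⟩, ?_, ?_, ?_, ?_⟩, ?_, ?_⟩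
  · rw [r₄ _ (by norm_num), hc.vars]
  · rw [r₄ _ (by norm_num), hc.len]
  · rw [r₄ _ (by norm_num), hc.base]
  · simp [hν₄, execs, Cmd.exec, hp₃, z34]
  · simp [hν₄, execs, Cmd.exec, hp₃, z34, z20]
  · simp [hν₄, execs, Cmd.exec, hk₃.reg 25 (by norm_num), h25, hc.lev, hc.dim, levelStart_succ]
  · rw [r₄ _ (by norm_num), hc.one]
  · rw [r₄ _ (by norm_num), hc.zero]
  · rw [a₄, hc.input]
  · simp [hν₄, execs, Cmd.exec, hk₃.reg 32 (by norm_num), h32, h.budget, hc.dim, stageBudget_succ]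
  · simp [hν₄, execs, Cmd.exec, z29, z33]
  · intro a i
    rw [a₄, r₄ _ (by norm_num)]
    exact h.mark a i
  · intro x hx
    rw [r₄ _ (by omega)]
    exact h.zero x hx
  · simp [hν₄, execs, Cmd.exec, z29, z33, z34]
  · exact r₄ _ (by norm_num)

/-! ### The beginning of a run -/

/-- Clear the first `X` registers of the simulated machine. -/
def clearRegs (X : ℕ) : List (Cmd Empty) := (List.range X).map fun x => .const (40 + x) 0

theorem execs_append (L L' : List (Cmd Empty)) (μ : Mem) :
    execs (L ++ L') μ = execs L' (execs L μ) := List.foldl_append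

theorem execs_clearRegs (X : ℕ) (μ : Mem) : (execs (clearRegs X) μ).arr = μ.arr ∧
    ∀ y, (execs (clearRegs X) μ).reg y = if 40 ≤ y ∧ y < 40 + X then 0 else μ.reg y := by
  induction X with
  | zero =>
    refine ⟨rfl, fun y => ?_⟩
    rw [if_neg (by omega)]
    rfl
  | succ X ih =>
    have : execs (clearRegs (X + 1)) μ = (execs (clearRegs X) μ).setReg (40 + X) 0 := by
      rw [clearRegs, List.range_succ, List.map_append, execs_append]
      rfl
    rw [this]
    refine ⟨ih.1, fun y => ?_⟩
    rw [Mem.setReg_reg, ih.2]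
    split_ifs <;> omega

/-- Prepare the registers and the arrays for a run of the simulated machine. -/
def setup (X : ℕ) : Cmd Empty :=
  block ([.add 28 28 33, .add 26 32 34] ++ (clearRegs X ++
    [.add 40 23 34, .add 41 23 34, .const 42 1]))

theorem code_start (v r : ℕ) (target : Option (Fin v → Bool)) (φ : CNF3 v) :
    (satMDP φ r target).code (satMDP φ r target).start = 1 := by
  have : ∀ n, encodeBits (bitsOf (v := v) fun _ => false) n 0 = 0 := by
    intro n
    induction n with
    | zero => rfl
    | succ n ih => simpa [encodeBits, bitsOf] using ih
  change encodeBits (bitsOf (v := v) fun _ => false) v 0 + 1 = 1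
  rw [this]

/-- The input of the learner does not depend on the target, so one preparation serves every choice
of it. Words are below `2 ^ Y` at the beginning, hence below `2 ^ (S + Y)` as long as the budget `S`
lasts. -/
theorem det_setup (hX : 3 ≤ X) {Y : ℕ} (hY : (v + 2) ^ r + 1 ≤ Y)
    (target : Option (Fin v → Bool)) (h : Stage φ r X ν) (h27 : ν.reg 27 = 0) :
    Det (setup X) (2 * X + 11) ν fun ν' =>
      SimInv φ r X Y (stageBudget (v + 2) r + Y) ν' ν' ∧ Stage φ r X ν' ∧
      ν'.reg 30 = ν.reg 30 ∧
      simState ν' = ⟨rlInput (satMDP φ r target), stageBudget (v + 2) r, 0⟩ := by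
  refine (Det.block (Q := fun ν' =>
      SimInv φ r X Y (stageBudget (v + 2) r + Y) ν' ν' ∧ Stage φ r X ν' ∧
      ν'.reg 30 = ν.reg 30 ∧
      simState ν' = ⟨rlInput (satMDP φ r target), stageBudget (v + 2) r, 0⟩) ?_ ?_).mono
      (by simp [clearRegs]; omega) fun _ h => h
  · intro c hc
    simp only [clearRegs, List.cons_append, List.nil_append, List.mem_cons, List.mem_append,
      List.mem_map, List.not_mem_nil, or_false] at hc
    rcases hc with rfl | rfl | ⟨_, _, rfl⟩ | rfl | rfl | rfl <;> trivial
  have hc := h.ctx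
  obtain ⟨ν₁, hν₁⟩ : ∃ ν₁, ν₁ = execs [.add 28 28 33, .add 26 32 34] ν := ⟨_, rfl⟩
  obtain ⟨ν', hν'⟩ : ∃ ν', ν' = execs ([.add 28 28 33, .add 26 32 34] ++ (clearRegs X ++
    [.add 40 23 34, .add 41 23 34, .const 42 1])) ν := ⟨_, rfl⟩
  rw [← hν']
  rw [execs_append, execs_append, ← hν₁] at hν'
  obtain ⟨ha, hreg⟩ := execs_clearRegs X ν₁
  generalize execs (clearRegs X) ν₁ = ν₂ at *
  have a' : ν'.arr = ν.arr := by
    rw [hν', hν₁] at *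
    exact ha
  have r₁ : ∀ x, x ≠ 28 ∧ x ≠ 26 → ν₁.reg x = ν.reg x := by
    rintro x ⟨h1, h2⟩
    simp [hν₁, execs, Cmd.exec, h1, h2]
  have h28 : ν₁.reg 28 = ν.reg 28 + 1 := by simp [hν₁, execs, Cmd.exec, hc.one]
  have h26 : ν₁.reg 26 = stageBudget (v + 2) r := by
    simp [hν₁, execs, Cmd.exec, hc.zero, h.budget]
  have r₂ : ∀ x, x < 40 → ν₂.reg x = ν₁.reg x := fun x hx => by rw [hreg, if_neg (by omega)]
  have hz : ∀ x, ν₂.reg (40 + x) = 0 := by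
    intro x
    rw [hreg]
    split_ifs with hx
    · rfl
    · rw [r₁ _ (by omega)]
      exact h.zero x (by omega)
  have r' : ∀ x, x < 40 → ν'.reg x = ν₁.reg x := by
    intro x hx
    have h0 : x ≠ 40 := by omega
    have h1 : x ≠ 41 := by omega
    have h2 : x ≠ 42 := by omega
    simp [hν', execs, Cmd.exec, h0, h1, h2, r₂ x hx]
  have r'' : ∀ x, x < 40 ∧ x ≠ 28 ∧ x ≠ 26 → ν'.reg x = ν.reg x :=
    fun x hx => (r' x hx.1).trans (r₁ x hx.2)
  have hsim : ∀ x, ν'.reg (40 + x)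
      = if x = 0 then (v + 2) ^ r else if x = 1 then (v + 2) ^ r else if x = 2 then 1 else 0 := by
    intro x
    have h23 : ν₂.reg 23 = (v + 2) ^ r := by rw [r₂ 23 (by norm_num), r₁ 23 (by norm_num), hc.dim]
    have h34 : ν₂.reg 34 = 0 := by rw [r₂ 34 (by norm_num), r₁ 34 (by norm_num), hc.zero]
    have e0 : (40 + x = 40) = (x = 0) := by simp
    have e1 : (40 + x = 41) = (x = 1) := by simp only [eq_iff_iff]; omega
    have e2 : (40 + x = 42) = (x = 2) := by simp only [eq_iff_iff]; omega
    simp only [hν', execs, Cmd.exec, List.foldl_cons, List.foldl_nil, Mem.setReg_reg, e0, e1, e2,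
      h23, h34, hz, add_zero]
    split_ifs <;> first | rfl | omega
  have hctx : Ctx φ r ν' := by
    obtain ⟨h1, h2, h3, h4, h5, h6, h7, h8, h9⟩ := hc
    constructor <;> first
      | (rw [r'' _ (by norm_num)]; assumption)
      | (rw [a']; assumption)
  -- Raising the run number makes all old marks stale, so the simulated arrays are empty without
  -- having been cleared.
  have hmark : ∀ a i, ν'.arr (5 + 2 * a) i < ν'.reg 28 := by
    intro a i
    rw [a', r' 28 (by norm_num), h28]
    exact Nat.lt_succ_of_le (h.mark a i)
  have hst : Stage φ r X ν' := by
    refine ⟨hctx, ?_, ?_, fun a i => (hmark a i).le, fun x hx => ?_⟩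
    · rw [r'' _ (by norm_num), h.budget]
    · rw [r'' _ (by norm_num), h.stage]
    · rw [hsim, if_neg (by omega), if_neg (by omega), if_neg (by omega)]
  have hs : simState ν' = ⟨rlInput (satMDP φ r target), stageBudget (v + 2) r, 0⟩ := by
    unfold simState rlInput
    rw [r' 26 (by norm_num), h26, r'' 27 (by norm_num), h27, code_start]
    congr 2
    · funext x
      exact hsim x
    · funext a i
      rw [if_neg (hmark a i).ne]
  refine ⟨⟨⟨hctx, fun _ _ _ _ _ => rfl, fun a i => (hmark a i).le⟩, ?_⟩, hst,
    r'' _ (by norm_num), hs⟩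
  rw [hs]
  refine ⟨le_rfl, ?_⟩
  have hlt : (v + 2) ^ r < 2 ^ Y :=
    Nat.lt_two_pow_self.trans_le (Nat.pow_le_pow_right two_pos (by omega))
  have h1 : 1 < 2 ^ Y := Nat.one_lt_two_pow (by omega)
  rw [Nat.add_sub_cancel_left]
  refine ⟨fun x => ?_, fun x hx => ?_, fun a i => by simp [rlInput]⟩
  · simp only [rlInput, code_start]
    split_ifs
    exacts [hlt, hlt, h1, by omega]
  · simp only [rlInput]
    rw [if_neg (by omega), if_neg (by omega), if_neg (by omega)]

/-! ### The end of a run -/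

variable (φ r) in
/-- The state reached by the first actions. -/
def satPath (a : ℕ → Fin 3) (t : ℕ) : SatState v ((v + 2) ^ r) :=
  Nat.rec (motive := fun _ => SatState v ((v + 2) ^ r))
    (some (⟨0, by positivity⟩, fun _ => false)) (fun t s => satNext φ s (a t)) t

variable (φ r) in
/-- The actions lead to a solution. -/
def LeadsToSolution (a : ℕ → Fin 3) : Prop := ∃ t < (v + 2) ^ r, IsSolved φ (satPath φ r a t)

/-- Follow the actions which the simulated machine has put out, and raise register `12` at a
solution. -/
def check : Cmd Empty :=
  block [block [.add 0 33 34], readState,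
    block [.const 12 0, .const 14 0, .add 13 23 34],
    .while 13 (block [
      block [.load 0 5 14, .sub 1 0 28, .sub 2 28 0, .add 1 1 2],
      .ite 1 (.const 9 0) (.load 9 4 14),
      modThree, moveState,
      block [.add 14 14 33, .sub 13 13 33]])]

open Classical in
-- The output actions are replayed with `moveState`, whose flag in register `12` stays raised once a
-- solved state has been met.
theorem det_check {Y Z : ℕ} {ν₀ : Mem} (h : SimInv φ r X Y Z ν₀ ν) :
    Det check ((v + 2) ^ r * (16 * Z + 100 * φ.length + 150) + 16 * v + 80) ν fun ν' =>
      Keeps 20 4 ν ν' ∧ ν'.reg 12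
        = if LeadsToSolution φ r (outputActions 3 (simState ν).mem) then 1 else 0 := by
  have hc := h.base.ctx
  set a := outputActions 3 (simState ν).mem with ha
  refine (Det.seq (t₁ := 3)
    (t₂ := (v + 2) ^ r * (16 * Z + 100 * φ.length + 150) + 16 * v + 70) ?_).mono (by omega)
    fun _ h => h
  refine Det.block_keeps (n := 20) (k := 4) (by simp [Cmd.IsBasic]) (by simp [Cmd.WritesBelow])
    fun hk₁ => ?_
  have h0 : (execs [.add 0 33 34] ν).reg 0 = 1 := by
    simp [execs, Cmd.exec, hc.one, hc.zero]
  generalize execs [.add 0 33 34] ν = ν₁ at *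
  refine (Det.seq (t₁ := 16 * v + 40)
    (t₂ := (v + 2) ^ r * (16 * Z + 100 * φ.length + 150) + 20) ?_).mono (by omega) fun _ h => h
  refine (det_readState (hc.keeps hk₁ le_rfl)).mono le_rfl ?_
  rintro ν₂ ⟨hk₂, hs₂⟩
  have hstart : SatState.decode v ((v + 2) ^ r) 1 = satPath φ r a 0 := by
    have := SatState.decode_code (satPath φ r a 0)
    rwa [show (satPath φ r a 0).code = 1 from code_start v r none φ] at this
  rw [h0, hstart] at hs₂
  have hk₂' : Keeps 20 4 ν ν₂ := hk₁.trans (hk₂.mono (by norm_num) (by norm_num))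
  refine (Det.seq (t₁ := 7)
    (t₂ := (v + 2) ^ r * (16 * Z + 100 * φ.length + 150) + 10) ?_).mono (by omega) fun _ h => h
  refine Det.block_keeps (n := 20) (k := 1) (by simp [Cmd.IsBasic]) (by simp [Cmd.WritesBelow])
    fun hk₃ => ?_
  have h23 : ν₂.reg 23 = (v + 2) ^ r := (hk₂'.reg 23 (by norm_num)).trans hc.dim
  have h34 : ν₂.reg 34 = 0 := (hk₂'.reg 34 (by norm_num)).trans hc.zero
  refine (Det.seq (t₁ := (v + 2) ^ r * ((16 * Z + 100 * φ.length + 149) + 1) + 1) (t₂ := 1)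
    ?_).mono (by rw [Nat.add_assoc (16 * Z + 100 * φ.length)]; omega) fun _ h => h
  refine Det.while (fun n ν' => Keeps 20 4 ν ν' ∧ ∃ t, n + t = (v + 2) ^ r ∧ ν'.reg 13 = n ∧
    ν'.reg 14 = t ∧ Holds (satPath φ r a t) ν' ∧
    ν'.reg 12 = if ∃ t' < t, IsSolved φ (satPath φ r a t') then 1 else 0) ?_ ?_ ?_
  · rintro n ν₃ ⟨hk, t, hnt, h13, h14, hs, h12⟩ hne
    obtain ⟨m, rfl⟩ : ∃ m, n = m + 1 := Nat.exists_eq_succ_of_ne_zero (by omega)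
    refine ⟨m, rfl, ?_⟩
    refine (Det.seq (t₁ := 9) (t₂ := 16 * Z + 100 * φ.length + 130) ?_).mono (by omega)
      fun _ h => h
    refine Det.block_keeps (n := 9) (k := 1) (by simp [Cmd.IsBasic]) (by simp [Cmd.WritesBelow])
      fun hk₄ => ?_
    have h1 : (execs [.load 0 5 14, .sub 1 0 28, .sub 2 28 0, .add 1 1 2] ν₃).reg 1 = 0 ↔
        ν.arr 5 t = ν.reg 28 := by
      rw [← hk.arr 5 (by norm_num), ← hk.reg 28 (by norm_num)]
      simp [execs, Cmd.exec, h14]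
      omega
    generalize execs [.load 0 5 14, .sub 1 0 28, .sub 2 28 0, .add 1 1 2] ν₃ = ν₄ at *
    refine (Det.seq (t₁ := 2) (t₂ := 16 * Z + 100 * φ.length + 120) ?_).mono (by omega)
      fun _ h => h
    have hk₄' := hk.trans (hk₄.mono (by norm_num) (by norm_num : 1 ≤ 4))
    have h14₄ : ν₄.reg 14 = t := (hk₄.reg 14 (by norm_num)).trans h14
    have key : Det (.ite 1 (.const 9 0) (.load 9 4 14)) 2 ν₄ fun ν₅ => Keeps 10 1 ν₄ ν₅ ∧
        ν₅.reg 9 = (simState ν).mem.arr 0 t := by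
      have k9 : ∀ n, Keeps 10 1 ν₄ (ν₄.setReg 9 n) := fun n =>
        ⟨fun x hx => by rw [Mem.setReg_reg, if_neg (by omega)], fun _ _ => rfl⟩
      refine Det.ite (fun hne => ?_) fun he => ?_
      · refine Det.basic (by simp [Cmd.IsBasic]) ⟨k9 _, ?_⟩
        change (ν₄.setReg 9 0).reg 9 = if ν.arr 5 t = ν.reg 28 then ν.arr 4 t else 0
        rw [if_neg (fun h => hne (h1.2 h)), Mem.setReg_reg, if_pos rfl]
      · refine Det.basic (by simp [Cmd.IsBasic]) ⟨k9 _, ?_⟩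
        change (ν₄.setReg 9 (ν₄.arr 4 (ν₄.reg 14))).reg 9
          = if ν.arr 5 t = ν.reg 28 then ν.arr 4 t else 0
        rw [if_pos (h1.1 he), Mem.setReg_reg, if_pos rfl, h14₄, hk₄'.arr 4 (by norm_num)]
    refine key.mono le_rfl ?_
    rintro ν₅ ⟨hk₅, h9⟩
    refine (Det.seq (t₁ := 16 * Z + 40) (t₂ := 100 * φ.length + 70) ?_).mono (by omega)
      fun _ h => h
    refine (det_modThree (Z := Z) ?_).mono le_rfl ?_
    · rw [h9]
      exact (h.bounded.mem.arr 0 t).trans_le (Nat.pow_le_pow_right two_pos (Nat.sub_le _ _))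
    rintro ν₆ ⟨hk₆, h9'⟩
    have hk36 : Keeps 10 1 ν₃ ν₆ := ((hk₄.mono (by norm_num) le_rfl).trans hk₅).trans hk₆
    have hk06 := hk.trans (hk36.mono (by norm_num) (by norm_num : 1 ≤ 4))
    have hs₆ := hs.keeps hk36 le_rfl le_rfl
    refine (Det.seq (t₁ := 100 * φ.length + 50) (t₂ := 10) ?_).mono (by omega) fun _ h => h
    refine (det_moveState (hc.keeps hk06 le_rfl) hs₆ (a := a t)
      (by rw [h9', h9, ha]; rfl)).mono le_rfl ?_
    rintro ν₇ ⟨hk₇, hs₇, h12'⟩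
    refine (Det.seq (t₁ := 5) (t₂ := 1) ?_).mono (by omega) fun _ h => h
    refine Det.block_keeps (n := 20) (k := 1) (by simp [Cmd.IsBasic]) (by simp [Cmd.WritesBelow])
      fun hk₈ => Det.skip ?_
    have hk07 := hk06.trans (hk₇.mono (by norm_num) (by norm_num : 2 ≤ 4))
    have e13 : ν₇.reg 13 = m + 1 := by
      rw [hk₇.reg 13 (by norm_num), hk36.reg 13 (by norm_num), h13]
    have e14 : ν₇.reg 14 = t := by
      rw [hk₇.reg 14 (by norm_num), hk36.reg 14 (by norm_num), h14]
    have e33 : ν₇.reg 33 = 1 := (hk07.reg 33 (by norm_num)).trans hc.one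
    refine ⟨hk07.trans (hk₈.mono le_rfl (by norm_num)), t + 1, by omega, ?_, ?_, ?_, ?_⟩
    · simp [execs, Cmd.exec, e13, e33]
    · simp [execs, Cmd.exec, e14, e33]
    · exact hs₇.keeps' hk₈ (by simp [execs, Cmd.exec]) (by simp [execs, Cmd.exec]) le_rfl
    · have e12 : (execs [.add 14 14 33, .sub 13 13 33] ν₇).reg 12 = ν₇.reg 12 := by
        simp [execs, Cmd.exec]
      rw [e12, h12', hk36.reg 12 (by norm_num), h12]
      have : (∃ t' < t + 1, IsSolved φ (satPath φ r a t')) ↔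
          IsSolved φ (satPath φ r a t) ∨ ∃ t' < t, IsSolved φ (satPath φ r a t') := by
        constructor
        · rintro ⟨t', h1, h2⟩
          rcases Nat.lt_succ_iff_lt_or_eq.1 h1 with h3 | rfl
          exacts [Or.inr ⟨t', h3, h2⟩, Or.inl h2]
        · rintro (h1 | ⟨t', h1, h2⟩)
          exacts [⟨t, by omega, h1⟩, ⟨t', by omega, h2⟩]
      by_cases h1 : IsSolved φ (satPath φ r a t) <;> simp only [this, h1, true_or, false_or, if_true,
        if_false]
  · rintro n ν₃ ⟨hk, t, hnt, h13, h14, hs, h12⟩ h0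
    refine Det.skip ⟨hk, ?_⟩
    rw [h12, show t = (v + 2) ^ r by omega]
    exact if_congr Iff.rfl rfl rfl
  · refine ⟨hk₂'.trans (hk₃.mono le_rfl (by norm_num)), 0, rfl, ?_, ?_, ?_, ?_⟩
    · simp [execs, Cmd.exec, h23, h34]
    · simp [execs, Cmd.exec]
    · exact hs₂.keeps' hk₃ (by simp [execs, Cmd.exec]) (by simp [execs, Cmd.exec]) le_rfl
    · simp [execs, Cmd.exec]

end Stage

/-! ### The main loop -/

/-- After a run of the simulated machine: look for a solution in its output if it has halted, and
pass on to the next stage if it has not. -/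
def conclude : Cmd Empty :=
  .seq (.ite 26 (.seq check (.seq (.ite 12 (.const 27 1) .skip) (.sub 30 30 33)))
    (.ite 27 .skip update)) (.ite 27 (.const 31 0) (.add 31 30 34))

/-- A solution has been found during the run, or by means of the output. -/
def Success {v : ℕ} (φ : CNF3 v) (r : ℕ) (s : BState) : Prop :=
  s.fnd ≠ 0 ∨ s.bud ≠ 0 ∧ LeadsToSolution φ r (outputActions 3 s.mem)

/-- In the stage with parameter `r`, there are `j` runs still to be made. -/
structure Ready {v : ℕ} (φ : CNF3 v) (r X j : ℕ) (ν : Mem) : Prop where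
  stage : Stage φ r X ν
  flag : ν.reg 27 = 0
  runs : ν.reg 30 = j
  go : ν.reg 31 = j

/-- A time bound for the part of the main loop after a run. -/
def concludeTime (v r len Z : ℕ) : ℕ :=
  (v + 2) ^ r * (16 * Z + 100 * len + 160) + 22 * v + 200

section Conclude

variable {v : ℕ} {φ : CNF3 v} {r X j : ℕ} {ν ν₀ : Mem}

theorem Stage.keeps {ν' : Mem} (h : Stage φ r X ν) (hk : Keeps 20 4 ν ν') : Stage φ r X ν' where
  ctx := h.ctx.keeps hk le_rfl
  budget := (hk.reg _ (by norm_num)).trans h.budget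
  stage := (hk.reg _ (by norm_num)).trans h.stage
  mark a i := by
    rw [hk.arr _ (by omega), hk.reg _ (by norm_num)]
    exact h.mark a i
  zero x hx := (hk.reg _ (by omega)).trans (h.zero x hx)

theorem Stage.setReg (h : Stage φ r X ν) {x n : ℕ} (hx : x = 27 ∨ x = 30 ∨ x = 31) :
    Stage φ r X (ν.setReg x n) := by
  have hr : ∀ y, y ≠ 27 ∧ y ≠ 30 ∧ y ≠ 31 → (ν.setReg x n).reg y = ν.reg y :=
    fun y hy => by rw [Mem.setReg_reg, if_neg (by omega)]
  obtain ⟨⟨h1, h2, h3, h4, h5, h6, h7, h8, h9⟩, h10, h11, h12, h13⟩ := h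
  refine ⟨?_, ?_, ?_, ?_, ?_⟩
  · constructor <;> first | assumption | (rw [hr _ (by norm_num)]; assumption)
  · rw [hr _ (by norm_num), h10]
  · rw [hr _ (by norm_num), h11]
  · intro a i
    rw [hr _ (by norm_num)]
    exact h12 a i
  · intro x hx
    rw [hr _ (by omega), h13 x hx]

theorem SimInv.stage {Y Z : ℕ} (h : SimInv φ r X Y Z ν₀ ν) (h₀ : Stage φ r X ν₀) :
    Stage φ r X ν where
  ctx := h.base.ctx
  budget := (h.base.reg _ (by norm_num) (by norm_num) (by norm_num) (by norm_num)).trans h₀.budget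
  stage := (h.base.reg _ (by norm_num) (by norm_num) (by norm_num) (by norm_num)).trans h₀.stage
  mark := h.base.mark
  zero := h.bounded.mem.zero

theorem det_decide_found (h : ν.reg 27 ≠ 0) :
    Det (.ite 27 (.const 31 0) (.add 31 30 34)) 2 ν fun ν' => ν'.reg 27 ≠ 0 ∧ ν'.reg 31 = 0 := by
  refine Det.ite (fun _ => ?_) fun h' => absurd h' h
  refine Det.basic (by simp [Cmd.IsBasic]) ?_
  simpa [Cmd.exec] using h

theorem det_decide_ready (hs : Stage φ r X ν) (h : ν.reg 27 = 0) (h30 : ν.reg 30 = j) :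
    Det (.ite 27 (.const 31 0) (.add 31 30 34)) 2 ν (Ready φ r X j) := by
  refine Det.ite (fun h' => absurd h h') fun _ => ?_
  refine Det.basic (by simp [Cmd.IsBasic]) ⟨hs.setReg (Or.inr (Or.inr rfl)), ?_, ?_, ?_⟩
  · simpa [Cmd.exec] using h
  · simpa [Cmd.exec] using h30
  · simpa [Cmd.exec, hs.ctx.zero] using h30

open Classical in
theorem det_conclude {Y Z : ℕ} (h₀ : Stage φ r X ν₀) (h30 : ν₀.reg 30 = j + 1)
    (h : SimInv φ r X Y Z ν₀ ν) :
    Det conclude (concludeTime v r φ.length Z) ν fun ν' =>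
      if Success φ r (simState ν) then ν'.reg 27 ≠ 0 ∧ ν'.reg 31 = 0
      else if ν.reg 26 ≠ 0 then Ready φ r X j ν' else Ready φ (r + 1) X (r + 1) ν' := by
  have hs := h.stage h₀
  have h30' : ν.reg 30 = j + 1 :=
    (h.base.reg _ (by norm_num) (by norm_num) (by norm_num) (by norm_num)).trans h30
  have hT : concludeTime v r φ.length Z
      = (v + 2) ^ r * (16 * Z + 100 * φ.length + 150) + 10 * (v + 2) ^ r + 22 * v + 200 := by
    unfold concludeTime; ring
  rw [hT]
  refine (Det.seq (t₁ := (v + 2) ^ r * (16 * Z + 100 * φ.length + 150) + 10 * (v + 2) ^ r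
    + 22 * v + 190) (t₂ := 2) ?_).mono (by omega) fun _ h => h
  refine (Det.ite (t := (v + 2) ^ r * (16 * Z + 100 * φ.length + 150) + 10 * (v + 2) ^ r
    + 22 * v + 180) (fun hb => ?_) fun hb => ?_).mono (by omega) fun _ h => h
  · refine (Det.seq (t₁ := (v + 2) ^ r * (16 * Z + 100 * φ.length + 150) + 16 * v + 80)
      (t₂ := 20) ?_).mono (by omega) fun _ h => h
    refine (det_check h).mono le_rfl ?_
    rintro ν₁ ⟨hk, h12⟩
    have hs₁ := hs.keeps hk
    have e27 : ν₁.reg 27 = ν.reg 27 := hk.reg 27 (by norm_num)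
    have e30 : ν₁.reg 30 = j + 1 := (hk.reg 30 (by norm_num)).trans h30'
    refine (Det.seq (t₁ := 2) (t₂ := 1) ?_).mono (by omega) fun _ h => h
    refine Det.ite (fun h1 => ?_) fun h1 => ?_
    · have hsol : LeadsToSolution φ r (outputActions 3 (simState ν).mem) := by
        by_contra hn
        rw [if_neg hn] at h12
        exact h1 h12
      refine Det.basic (by simp [Cmd.IsBasic]) (Det.basic (by simp [Cmd.IsBasic]) ?_)
      simp only [if_pos (show Success φ r (simState ν) from Or.inr ⟨hb, hsol⟩)]
      refine det_decide_found ?_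
      simp [Cmd.exec]
    · have hsol : ¬ LeadsToSolution φ r (outputActions 3 (simState ν).mem) := by
        intro hn
        rw [if_pos hn] at h12
        omega
      refine Det.skip (Det.basic (by simp [Cmd.IsBasic]) ?_)
      by_cases hf : ν.reg 27 = 0
      · have hns : ¬ Success φ r (simState ν) := by
          rintro (h2 | h2)
          exacts [h2 hf, hsol h2.2]
        simp only [if_neg hns, if_pos hb]
        refine det_decide_ready (hs₁.setReg (Or.inr (Or.inl rfl))) ?_ ?_
        · simp [Cmd.exec, e27, hf]
        · simp [Cmd.exec, e30, hs₁.ctx.one]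
      · simp only [if_pos (show Success φ r (simState ν) from Or.inl hf)]
        refine det_decide_found ?_
        simp [Cmd.exec, e27, hf]
  · refine (Det.ite (t := 6 * (v + 2) ^ r + 6 * (v + 2) + 60) (fun hf => ?_) fun hf => ?_).mono
      (by omega) fun _ h => h
    · refine (Det.skip ?_).mono (t := 1) (by omega) fun _ h => h
      simp only [if_pos (show Success φ r (simState ν) from Or.inl hf)]
      exact det_decide_found hf
    · have hns : ¬ Success φ r (simState ν) := by
        rintro (h2 | h2)
        exacts [h2 hf, h2.1 hb]
      simp only [if_neg hns, if_neg (not_not.2 hb)]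
      refine (det_update hs).mono le_rfl ?_
      rintro ν₁ ⟨hs₁, h30₁, h27₁⟩
      exact det_decide_ready hs₁ (h27₁.trans hf) h30₁

end Conclude

/-- One run of the simulated machine, with preparation and conclusion. -/
def mainBody (A : Cmd RLQuery) (X : ℕ) : Cmd Empty := .seq (setup X) (.seq (comp A) conclude)

/-- The main loop, and the output. -/
def mainStack (A : Cmd RLQuery) (X : ℕ) : List (Cmd Empty) :=
  [.while 31 (mainBody A X), .add 0 27 34]

/-- The number of steps for a unit of the budget. -/
def stepTime (v r len Y ov : ℕ) : ℕ :=
  atomTime v r len (stageBudget (v + 2) r + ((v + 2) ^ r + 1 + Y)) + ov + 16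

/-- The number of steps of an iteration of the main loop. -/
def iterTime (v r len X Y ov : ℕ) : ℕ :=
  2 * X + ov + stepTime v r len Y ov * stageBudget (v + 2) r
    + concludeTime v r len (stageBudget (v + 2) r + ((v + 2) ^ r + 1 + Y)) + 20

open Classical in
/-- The values `y` of success, `e₁` of another run, and `e₂` of the next stage. -/
noncomputable def stageValue {v : ℕ} (φ : CNF3 v) (r : ℕ) (y e₁ e₂ : ℝ≥0∞) (s : BState) : ℝ≥0∞ :=
  if Success φ r s then y else if s.bud ≠ 0 then e₁ else e₂

section Loop

variable {v : ℕ} {φ : CNF3 v} {X Y : ℕ} {A : Cmd RLQuery} {f : Mem → ℝ≥0∞} {y z : ℝ≥0∞}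

theorem le_haltVal_exit {ν : Mem} {N : ℕ} (hN : 2 ≤ N) {e : ℝ≥0∞} (h31 : ν.reg 31 = 0)
    (he : e ≤ f (ν.setReg 0 (ν.reg 27 + ν.reg 34))) :
    e ≤ haltVal noAns N (mainStack A X, ν) f := by
  refine haltVal_step (c' := ([.add 0 27 34], ν)) (by simp [mainStack, step, h31]) (n := N - 1)
    (by omega) ?_
  refine haltVal_step rfl (n := N - 2) (by omega) ?_
  rwa [haltVal_nil]

/-- One pass through the loop is `det_setup`, `comp_simulates` and `det_conclude` in succession;
`stageValue` assigns to each final state of the run the guaranteed value of what follows. -/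
theorem iteration_le {r j : ℕ} (hr : 8 ≤ r) (hX : 3 ≤ X) (hA : A.Fits X Y)
    (target : Option (Fin v → Bool)) {N : ℕ} (hN : 2 ≤ N) {e₁ e₂ : ℝ≥0∞}
    (hf : ∀ μ : Mem, μ.reg 0 ≠ 0 → y ≤ f μ)
    (h₁ : ∀ ν, Ready φ r X j ν → e₁ ≤ haltVal noAns N (mainStack A X, ν) f)
    (h₂ : ∀ ν, Ready φ (r + 1) X (r + 1) ν → e₂ ≤ haltVal noAns N (mainStack A X, ν) f) {ν : Mem}
    (hν : Ready φ r X (j + 1) ν) :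
    (den (satSim φ r) A ⟨rlInput (satMDP φ r target), stageBudget (v + 2) r, 0⟩).expect
        (stageValue φ r y e₁ e₂)
      ≤ haltVal noAns (N + iterTime v r φ.length X Y A.overhead) (mainStack A X, ν) f := by
  -- The exponent has to cover the codes and features, of at most `d + 1` bits, as well as the
  -- numerals of the given program.
  obtain ⟨Y', hY'⟩ : ∃ Y', Y' = (v + 2) ^ r + 1 + Y := ⟨_, rfl⟩
  have hI : iterTime v r φ.length X Y A.overhead = 2 * X + A.overhead
      + stepTime v r φ.length Y A.overhead * stageBudget (v + 2) r
      + concludeTime v r φ.length (stageBudget (v + 2) r + Y') + 20 := by rw [hY']; rfl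
  have hτ : stepTime v r φ.length Y A.overhead
      = atomTime v r φ.length (stageBudget (v + 2) r + Y') + A.overhead + 16 := by rw [hY']; rfl
  generalize stepTime v r φ.length Y A.overhead = τ at *
  generalize iterTime v r φ.length X Y A.overhead = I at *
  have hY : (v + 2) ^ r + 1 ≤ Y' := by omega
  have hA' : A.Fits X Y' := hA.mono le_rfl (by omega)
  set t₁ := concludeTime v r φ.length (stageBudget (v + 2) r + Y') with ht₁
  set S := stageBudget (v + 2) r with hS
  refine haltVal_step (c' := (mainBody A X :: mainStack A X, ν))
    (by simp [mainStack, step, hν.go]) (n := N + t₁ + A.overhead + τ * S + 2 * X + 13) (by omega) ?_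
  refine haltVal_step rfl (n := N + t₁ + A.overhead + τ * S + 2 * X + 12) (by omega) ?_
  refine (det_setup hX hY target hν.stage hν.flag).le_haltVal
    (n := N + t₁ + A.overhead + τ * S + 1) (by omega) ?_
  rintro ν₀ ⟨hinv, hst, h30, hsim⟩
  rw [hν.runs] at h30
  refine haltVal_step rfl (n := N + t₁ + A.overhead + τ * S) (by omega) ?_
  have hb : ν₀.reg 26 = S := congrArg BState.bud hsim
  rw [← hsim, ← hb]
  refine comp_simulates hr hY (by rw [← hS]; omega) A hA' (by omega) hinv fun ν₁ hν₁ _ => ?_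
  refine (det_conclude hst h30 hν₁).le_haltVal (n := N) (by omega) ?_
  intro ν₂ h
  unfold stageValue
  by_cases hsuc : Success φ r (simState ν₁)
  · rw [if_pos hsuc] at h ⊢
    refine le_haltVal_exit hN h.2 (hf _ ?_)
    rw [Mem.setReg_reg, if_pos rfl]
    have := h.1
    omega
  · rw [if_neg hsuc] at h ⊢
    by_cases hb1 : ν₁.reg 26 = 0
    · rw [if_neg (not_not.2 hb1)] at h
      rw [if_neg (show ¬ (simState ν₁).bud ≠ 0 from not_not.2 hb1)]
      exact h₂ _ h
    · rw [if_pos hb1] at h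
      rw [if_pos (show (simState ν₁).bud ≠ 0 from hb1)]
      exact h₁ _ h

/-- Lower bounds for the value of the main loop. -/
theorem mainStack_le {R I : ℕ} (hX : 3 ≤ X) (hA : A.Fits X Y) (target : Option (Fin v → Bool))
    (hI : ∀ r, 8 ≤ r → r ≤ R → iterTime v r φ.length X Y A.overhead ≤ I)
    (hf : ∀ μ : Mem, μ.reg 0 ≠ 0 → y ≤ f μ) (hf' : ∀ μ : Mem, μ.reg 0 = 0 → z ≤ f μ)
    -- `E r j` is a candidate lower bound with `j` runs left in stage `r`. It only has to satisfy
    -- the one-step recursion, in which going beyond stage `R` is worth nothing.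
    {E : ℕ → ℕ → ℝ≥0∞} (hE₀ : ∀ r, E r 0 ≤ z)
    (hE : ∀ r j, 8 ≤ r → r ≤ R → E r (j + 1) ≤
      (den (satSim φ r) A ⟨rlInput (satMDP φ r target), stageBudget (v + 2) r, 0⟩).expect
        (stageValue φ r y (E r j) (if r < R then E (r + 1) (r + 1) else 0))) (n : ℕ) :
    -- The sum bounds the iterations still to come: `j` in this stage and at most `R + 1` in each
    -- later one.
    ∀ r j, 8 ≤ r → r ≤ R → j + (R - r) * (R + 1) ≤ n → ∀ ν, Ready φ r X j ν →
      E r j ≤ haltVal noAns (2 + n * I) (mainStack A X, ν) f := by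
  have exit : ∀ r ν n, Ready φ r X 0 ν → E r 0 ≤ haltVal noAns (2 + n * I) (mainStack A X, ν) f := by
    intro r ν n hν
    refine le_haltVal_exit (by omega) hν.go ((hE₀ r).trans (hf' _ ?_))
    simp [hν.flag, hν.stage.ctx.zero]
  induction n with
  | zero =>
    intro r j _ _ hn ν hν
    obtain rfl : j = 0 := by omega
    exact exit r ν 0 hν
  | succ n ih =>
    intro r j hr hR hn ν hν
    cases j with
    | zero => exact exit r ν _ hν
    | succ j =>
      refine (hE r j hr hR).trans ((iteration_le hr hX hA target (N := 2 + n * I) (by omega) hf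
        (fun ν' hν' => ih r j hr hR (by omega) ν' hν') ?_ hν).trans ?_)
      · intro ν' hν'
        split_ifs with h
        · refine ih (r + 1) (r + 1) (by omega) h ?_ ν' hν'
          obtain ⟨m, rfl⟩ : ∃ m, R = r + 1 + m := ⟨R - (r + 1), by omega⟩
          have e1 : r + 1 + m - r = m + 1 := by omega
          have e2 : r + 1 + m - (r + 1) = m := by omega
          rw [e1, Nat.add_mul] at hn
          rw [e2]
          omega
        · exact bot_le
      · refine haltVal_mono _ ?_ _ _
        have := hI r hr hR
        rw [Nat.add_mul]
        omega

/-! ### The program -/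

/-- Initialize the registers, for the stage with parameter `8`. -/
def prelude : Cmd Empty :=
  block [block [.const 33 1, .add 20 0 34, .add 21 1 34, .const 22 2, .add 22 22 20, .const 23 1,
    .add 24 23 20, .const 32 1], block (List.replicate 8 update), .add 31 30 34]

theorem det_updates (n : ℕ) {r : ℕ} {ν : Mem} (h : Stage φ r X ν) (h30 : ν.reg 30 = r)
    (h27 : ν.reg 27 = 0) :
    Det (block (List.replicate n update)) (n * (6 * (v + 2) ^ (r + n) + 6 * (v + 2) + 61) + 1) ν
      fun ν' => Stage φ (r + n) X ν' ∧ ν'.reg 30 = r + n ∧ ν'.reg 27 = 0 := by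
  induction n generalizing r ν with
  | zero => exact (Det.skip ⟨h, h30, h27⟩).mono (by omega) fun _ h => h
  | succ n ih =>
    have h1 : (v + 2) ^ r ≤ (v + 2) ^ (r + 1 + n) := Nat.pow_le_pow_right (by omega) (by omega)
    refine (Det.seq (t₁ := 6 * (v + 2) ^ r + 6 * (v + 2) + 60)
      (t₂ := n * (6 * (v + 2) ^ (r + 1 + n) + 6 * (v + 2) + 61) + 1) ?_).mono ?_ fun _ h => h
    · refine (det_update h).mono le_rfl ?_
      rintro ν₁ ⟨hs, h30₁, h27₁⟩
      refine (ih hs h30₁ (h27₁.trans h27)).mono le_rfl ?_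
      rintro ν₂ ⟨h1, h2, h3⟩
      rw [show r + (n + 1) = r + 1 + n by omega]
      exact ⟨h1, h2, h3⟩
    · rw [show r + (n + 1) = r + 1 + n by omega, Nat.add_mul]
      omega

theorem det_prelude : Det prelude (48 * (v + 2) ^ 8 + 48 * (v + 2) + 520) (satInput φ)
    (Ready φ 8 X 8) := by
  refine (Det.seq (t₁ := 17) (t₂ := 48 * (v + 2) ^ 8 + 48 * (v + 2) + 500) ?_).mono (by omega)
    fun _ h => h
  refine Det.block (by simp [Cmd.IsBasic]) ?_
  refine (Det.seq (t₁ := 8 * (6 * (v + 2) ^ (0 + 8) + 6 * (v + 2) + 61) + 1) (t₂ := 3) ?_).mono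
    (by rw [Nat.zero_add]; omega) fun _ h => h
  -- In the fictitious stage `0`, dimension and budget are `1` and the level start is `0`; eight
  -- updates produce the parameters of the first real stage.
  refine (det_updates 8 (r := 0) (X := X) (φ := φ) ?_ ?_ ?_).mono le_rfl ?_
  · refine ⟨⟨?_, ?_, ?_, ?_, ?_, ?_, ?_, ?_, ?_⟩, ?_, ?_, ?_, ?_⟩
    all_goals try simp [execs, Cmd.exec, satInput, levelStart, stageBudget]
    · omega
    · intro x _
      repeat rw [if_neg (by omega)]
  · simp [execs, Cmd.exec, satInput]
  · simp [execs, Cmd.exec, satInput]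
  · rintro ν ⟨hs, h30, h27⟩
    refine (Det.seq (t₁ := 1) (t₂ := 1) (Det.basic (by simp [Cmd.IsBasic])
      (Det.skip ⟨hs.setReg (Or.inr (Or.inr rfl)), ?_, ?_, ?_⟩))).mono (by omega) fun _ h => h
    · simpa [Cmd.exec] using h27
    · simpa [Cmd.exec] using h30
    · simpa [Cmd.exec, hs.ctx.zero] using h30

/-- The algorithm for Unique-3-SAT. -/
def satProgram (A : Cmd RLQuery) (X : ℕ) : Cmd Empty :=
  .seq prelude (.seq (.while 31 (mainBody A X)) (.add 0 27 34))

/-- A time bound for the algorithm, if the last stage has the parameter `R`. -/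
def satTime (v R I : ℕ) : ℕ :=
  48 * (v + 2) ^ 8 + 48 * (v + 2) + 530 + (8 + (R - 8) * (R + 1)) * I

theorem satProgram_le {R I : ℕ} (hR : 8 ≤ R) (hX : 3 ≤ X) (hA : A.Fits X Y)
    (target : Option (Fin v → Bool))
    (hI : ∀ r, 8 ≤ r → r ≤ R → iterTime v r φ.length X Y A.overhead ≤ I)
    (hf : ∀ μ : Mem, μ.reg 0 ≠ 0 → y ≤ f μ) (hf' : ∀ μ : Mem, μ.reg 0 = 0 → z ≤ f μ)
    {E : ℕ → ℕ → ℝ≥0∞} (hE₀ : ∀ r, E r 0 ≤ z)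
    (hE : ∀ r j, 8 ≤ r → r ≤ R → E r (j + 1) ≤
      (den (satSim φ r) A ⟨rlInput (satMDP φ r target), stageBudget (v + 2) r, 0⟩).expect
        (stageValue φ r y (E r j) (if r < R then E (r + 1) (r + 1) else 0))) :
    E 8 8 ≤ haltVal noAns (satTime v R I) ([satProgram A X], satInput φ) f := by
  have hT : satTime v R I
    = 48 * (v + 2) ^ 8 + 48 * (v + 2) + 530 + (8 + (R - 8) * (R + 1)) * I := rfl
  refine haltVal_step rfl (n := 2 + (8 + (R - 8) * (R + 1)) * I + 1
    + (48 * (v + 2) ^ 8 + 48 * (v + 2) + 520)) (by omega) ?_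
  refine (det_prelude (X := X)).le_haltVal le_rfl fun ν hν => ?_
  refine haltVal_step rfl le_rfl ?_
  exact mainStack_le hX hA target hI hf hf' hE₀ hE _ 8 8 le_rfl hR le_rfl ν hν

end Loop

/-! ### Correctness -/

theorem lt_stageBudget (v : ℕ) {r : ℕ} (hr : 8 ≤ r) : 5 ≤ stageBudget (v + 2) r := by
  have h : ∑ i ∈ Finset.range 8, i ≤ ∑ i ∈ Finset.range r, i :=
    Finset.sum_le_sum_of_subset (Finset.range_mono hr)
  calc 5 ≤ 2 ^ ∑ i ∈ Finset.range 8, i := by norm_num [Finset.sum_range_succ]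
    _ ≤ 2 ^ ∑ i ∈ Finset.range r, i := Nat.pow_le_pow_right two_pos h
    _ ≤ stageBudget (v + 2) r := Nat.pow_le_pow_left (by omega) _

/-- The factor by which the probability of an answer of the simulated oracle may be too large. -/
theorem exists_answer_factor (v : ℕ) {r : ℕ} (hr : 8 ≤ r) : ∃ a : ℝ≥0∞, 1 ≤ a ∧
    a ^ stageBudget (v + 2) r ≤ 5 / 4 ∧ ∀ (target : Option (Fin v → Bool))
      (s : SatState v ((v + 2) ^ r)), IsLeaf s → 1 ≤ a * (1 - (goalProb r target s : ℝ≥0∞)) := by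
  set S := stageBudget (v + 2) r with hS
  have hS5 : 5 ≤ S := lt_stageBudget v hr
  have hS5' : (5 : ℝ) ≤ S := by exact_mod_cast hS5
  -- The budget is chosen so that the reward probability on the last level is at most the inverse of
  -- its square.
  have hsq : (((v : ℝ≥0) + 2) ^ (r * (r - 1))) = (S : ℝ≥0) ^ 2 := by
    have := stageBudget_sq (v + 2) r
    exact_mod_cast this.symm
  have hδ1 : ((S : ℝ≥0) ^ 2)⁻¹ ≤ 1 := by
    refine inv_le_one_of_one_le₀ (one_le_pow₀ ?_)
    exact_mod_cast (by omega : 1 ≤ S)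
  have hδr : (((S : ℝ≥0) ^ 2)⁻¹ : ℝ≥0) = ((S : ℝ) ^ 2)⁻¹ := by push_cast; rfl
  have hpow : (4 / 5 : ℝ≥0) ≤ (1 - ((S : ℝ≥0) ^ 2)⁻¹) ^ S := by
    rw [← NNReal.coe_le_coe]
    push_cast [NNReal.coe_sub hδ1]
    have h1 : ((S : ℝ) ^ 2)⁻¹ ≤ 1 := by rw [← hδr]; exact_mod_cast hδ1
    -- Bernoulli's inequality: the `S` errors of size `S ^ (-2)` add up to at most `1 / S ≤ 1 / 5`.
    have h2 := one_add_mul_le_pow (a := -((S : ℝ) ^ 2)⁻¹) (by linarith) S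
    have h3 : (S : ℝ) * ((S : ℝ) ^ 2)⁻¹ = (S : ℝ)⁻¹ := by field_simp
    have h4 : (S : ℝ)⁻¹ ≤ 5⁻¹ := inv_anti₀ (by norm_num) hS5'
    rw [mul_neg, h3, ← sub_eq_add_neg, ← sub_eq_add_neg] at h2
    linarith
  have hpos : 0 < 1 - ((S : ℝ≥0) ^ 2)⁻¹ := by
    rcases (zero_le (a := 1 - ((S : ℝ≥0) ^ 2)⁻¹)).eq_or_lt with h | h
    · rw [← h, zero_pow (by omega)] at hpow
      exact absurd hpow (by norm_num)
    · exact h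
  refine ⟨((1 - ((S : ℝ≥0) ^ 2)⁻¹)⁻¹ : ℝ≥0), ?_, ?_, fun target s hs => ?_⟩
  · exact_mod_cast (one_le_inv₀ hpos).2 tsub_le_self
  · rw [← ENNReal.coe_pow, inv_pow]
    have : (5 / 4 : ℝ≥0∞) = ((4 / 5 : ℝ≥0)⁻¹ : ℝ≥0) := by
      rw [inv_div, ENNReal.coe_div (by norm_num)]
      norm_num
    rw [this, ENNReal.coe_le_coe]
    exact inv_anti₀ (by norm_num) hpow
  · rw [← ENNReal.coe_one, ← ENNReal.coe_sub, ← ENNReal.coe_mul, ENNReal.coe_le_coe]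
    have hle := goalProb_le_of_isLeaf (target := target) hr hs
    rw [hsq] at hle
    rw [inv_mul_eq_div, one_le_div hpos]
    exact tsub_le_tsub_left hle 1

/-- The algorithm for Linear-3-RL solves the instances made from the formula, in time `T`. -/
def SolvesStage {v : ℕ} (φ : CNF3 v) (A : Cmd RLQuery) (r T : ℕ) : Prop :=
  ∀ target : Option (Fin v → Bool), (∀ w ∈ target, φ.Satisfies w) →
    HaltsWithin (mdpAnswer (satMDP φ r target)) A (rlInput (satMDP φ r target)) T ∧
    1 - 1 / 10 ≤ probAfter (mdpAnswer (satMDP φ r target)) A (rlInput (satMDP φ r target)) T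
      {μ | (satMDP φ r target).GoodActions (outputActions 3 μ)}

/-- The final state of the simulated machine in a stage. -/
noncomputable def runStage {v : ℕ} (φ : CNF3 v) (A : Cmd RLQuery) (r : ℕ)
    (target : Option (Fin v → Bool)) : PMF BState :=
  den (satSim φ r) A ⟨rlInput (satMDP φ r target), stageBudget (v + 2) r, 0⟩

section Values

variable {v : ℕ} {φ : CNF3 v} {A : Cmd RLQuery} {r T : ℕ}

/-- The simulated answers are possible answers of the true oracle, so every unflagged run is a
possible run of the given algorithm, and these halt within `T` steps. -/
theorem runStage_not_exhausted (hr : 8 ≤ r) (h : SolvesStage φ A r T)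
    (hT : T < stageBudget (v + 2) r) {target : Option (Fin v → Bool)}
    (ht : ∀ w ∈ target, φ.Satisfies w) {s : BState} (hs : s ∈ (runStage φ A r target).support) :
    s.fnd ≠ 0 ∨ s.bud ≠ 0 := by
  obtain ⟨a, ha, -, hleaf⟩ := exists_answer_factor v hr
  have hsim : ∀ o μ μ', satSim φ r o μ = some μ' → mdpAnswer (satMDP φ r target) o μ μ' ≠ 0 := by
    intro o μ μ' h h0
    have := satSim_approx φ target ha (hleaf target) o μ μ' h
    rw [h0, mul_zero] at this
    simp at this
  rcases den_not_exhausted _ _ hsim A [] T ⟨_, _, _⟩ s (h target ht).1 hT hs with h | ⟨n, -, hn⟩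
  · exact Or.inl h
  · exact Or.inr (by omega)

open Classical in
-- A halted run without success ends with actions that are not good. Under the true oracle such an
-- outcome has probability at most `1 / 10`, and the simulation increases this by at most the factor
-- `a ^ S ≤ 5 / 4`.
theorem runStage_failure_le (hr : 8 ≤ r) (h : SolvesStage φ A r T) {w : Fin v → Bool}
    (hw : φ.Satisfies w) :
    (runStage φ A r (some w)).expect (fun s => if s.bud ≠ 0 ∧ ¬ Success φ r s then 1 else 0)
      ≤ 8⁻¹ := by
  obtain ⟨a, ha, haS, hleaf⟩ := exists_answer_factor v hr
  obtain ⟨h1, h2⟩ := h (some w) (by simpa using hw)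
  set M := satMDP φ r (some w) with hM
  set f : Mem → ℝ≥0∞ := fun μ => if μ ∈ {μ | M.GoodActions (outputActions 3 μ)} then 0 else 1
    with hf
  have hlim : limVal (mdpAnswer M) ([A], rlInput M) f ≤ ENNReal.ofReal (1 / 10) :=
    iSup_le fun n => (haltVal_le_of_haltsWithin (mdpAnswer M) h1 n f).trans
      (haltVal_compl_le (mdpAnswer M) h2)
  have hS0 : stageBudget (v + 2) r ≠ 0 := by
    have := lt_stageBudget v hr
    omega
  have key := den_expect_le (mdpAnswer M) (satSim φ r) ha
    (satSim_approx φ (some w) ha (hleaf (some w))) f A []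
    ⟨rlInput M, stageBudget (v + 2) r, 0⟩
  rw [if_neg hS0] at key
  refine (PMF.expect_mono fun s => ?_).trans (key.trans ?_)
  · by_cases hs : s.bud ≠ 0 ∧ ¬ Success φ r s
    · rw [if_pos hs, if_neg hs.1, limVal_nil]
      have hgood : ¬ M.GoodActions (outputActions 3 s.mem) := by
        intro hg
        obtain ⟨t, ht, hsol⟩ := exists_isSolved_of_goodActions φ hr hw hg
        exact hs.2 (Or.inr ⟨hs.1, t, ht, hsol⟩)
      have : f s.mem = 1 := if_neg hgood
      rw [this, mul_one]
      exact one_le_pow₀ ha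
    · rw [if_neg hs]
      exact bot_le
  · calc a ^ stageBudget (v + 2) r * limVal (mdpAnswer M) ([A], rlInput M) f
        ≤ 5 / 4 * ENNReal.ofReal (1 / 10) := mul_le_mul' haS hlim
      _ = ENNReal.ofReal (5 / 4 * (1 / 10)) := by
        rw [ENNReal.ofReal_mul (by norm_num)]
        congr 1
        rw [ENNReal.ofReal_div_of_pos (by norm_num)]
        norm_num
      _ = 8⁻¹ := by
        rw [show (5 / 4 * (1 / 10) : ℝ) = 8⁻¹ by norm_num, ENNReal.ofReal_inv_of_pos (by norm_num)]
        norm_num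

/-- A bound for the probability that no solution is found. -/
noncomputable def errorBound (r j : ℕ) : ℝ≥0∞ := 8⁻¹ ^ j + 8⁻¹ ^ r * 7⁻¹

/-- As `1 / 8 + 1 / 56 = 1 / 7`, the initial error of the next stage is exactly the second summand
of `errorBound r j`. This closes the recursion over the stages. -/
theorem errorBound_succ_self (r : ℕ) : errorBound (r + 1) (r + 1) = 8⁻¹ ^ r * 7⁻¹ := by
  have h : (8⁻¹ + 8⁻¹ * 7⁻¹ : ℝ≥0∞) = 7⁻¹ := by
    refine (ENNReal.toReal_eq_toReal_iff' (by simp [ENNReal.mul_eq_top]) (by simp)).1 ?_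
    rw [ENNReal.toReal_add (by simp) (ENNReal.mul_ne_top (by simp) (by simp)), ENNReal.toReal_mul]
    simp only [ENNReal.toReal_inv, ENNReal.toReal_ofNat]
    norm_num
  calc errorBound (r + 1) (r + 1) = 8⁻¹ ^ r * (8⁻¹ + 8⁻¹ * 7⁻¹) := by
        unfold errorBound; rw [pow_succ]; ring
    _ = _ := by rw [h]

theorem errorBound_le : errorBound 8 8 ≤ 8⁻¹ := by
  rw [errorBound_succ_self]
  calc (8⁻¹ ^ 7 * 7⁻¹ : ℝ≥0∞) ≤ 8⁻¹ ^ 1 * 1 := by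
        have h8 : (8⁻¹ : ℝ≥0∞) ≤ 1 := ENNReal.inv_le_one.2 (by norm_num)
        have h7 : (7⁻¹ : ℝ≥0∞) ≤ 1 := ENNReal.inv_le_one.2 (by norm_num)
        exact mul_le_mul' (pow_le_pow_of_le_one bot_le h8 (by norm_num)) h7
    _ = 8⁻¹ := by simp

open Classical in
-- The summand `8⁻¹ ^ j` of the error is inherited only after a halted run without success, hence
-- with probability at most `1 / 8`. The summand `8⁻¹ ^ r * 7⁻¹` covers the rest for both kinds of
-- unsuccessful runs. In stage `R` no run exhausts its budget without success.
theorem one_sub_errorBound_le {R : ℕ} (hr : 8 ≤ r) (hR : r ≤ R) (h : SolvesStage φ A r T)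
    (hT : r = R → T < stageBudget (v + 2) r) {w : Fin v → Bool} (hw : φ.Satisfies w) (j : ℕ) :
    1 - errorBound r (j + 1) ≤ (runStage φ A r (some w)).expect
      (stageValue φ r 1 (1 - errorBound r j)
        (if r < R then 1 - errorBound (r + 1) (r + 1) else 0)) := by
  set D := runStage φ A r (some w)
  set g := stageValue φ r 1 (1 - errorBound r j)
    (if r < R then 1 - errorBound (r + 1) (r + 1) else 0) with hg
  set b₁ : BState → ℝ≥0∞ := fun s => if s.bud ≠ 0 ∧ ¬ Success φ r s then 1 else 0 with hb₁
  set b₂ : BState → ℝ≥0∞ := fun s => if Success φ r s then 0 else 1 with hb₂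
  have h2 : D.expect b₂ ≤ 1 := by
    calc D.expect b₂ ≤ D.expect fun _ => 1 := PMF.expect_mono fun s => by
          simp only [hb₂]; split_ifs <;> simp
      _ = 1 := by simp
  rw [tsub_le_iff_right]
  calc (1 : ℝ≥0∞) ≤ D.expect fun s => g s + (8⁻¹ ^ j * b₁ s + 8⁻¹ ^ r * 7⁻¹ * b₂ s) := by
        refine PMF.one_le_expect fun s hs => ?_
        simp only [hg, hb₁, hb₂, stageValue]
        by_cases hsuc : Success φ r s
        · simp [hsuc]
        by_cases hb : s.bud = 0
        · have hlt : r < R := by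
            refine lt_of_le_of_ne hR fun he => ?_
            rcases runStage_not_exhausted hr h (hT he) (by simpa using hw) hs with h1 | h1
            exacts [hsuc (Or.inl h1), h1 hb]
          simp only [hsuc, hb, hlt, if_true, if_false, errorBound_succ_self, ne_eq, not_true,
            false_and, mul_zero, zero_add, mul_one]
          exact le_tsub_add
        · simp only [hsuc, hb, if_true, if_false, ne_eq, not_false_eq_true, true_and, mul_one]
          exact le_tsub_add
    _ = D.expect g + (8⁻¹ ^ j * D.expect b₁ + 8⁻¹ ^ r * 7⁻¹ * D.expect b₂) := by
        rw [PMF.expect_add, PMF.expect_add, PMF.expect_mul_left, PMF.expect_mul_left]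
    _ ≤ D.expect g + (8⁻¹ ^ j * 8⁻¹ + 8⁻¹ ^ r * 7⁻¹ * 1) := by
        gcongr
        exact runStage_failure_le hr h hw
    _ = D.expect g + errorBound r (j + 1) := by rw [errorBound, pow_succ, mul_one]

/-- The value `1` passes through every outcome, since the worthless step beyond stage `R` never
occurs. The first alternative is used for halting, the second for unsatisfiable formulas. -/
theorem one_le_stageValue {R : ℕ} (hr : 8 ≤ r) (hR : r ≤ R) (h : SolvesStage φ A r T)
    (hT : r = R → T < stageBudget (v + 2) r) {y : ℝ≥0∞}
    (hy : 1 ≤ y ∨ ∀ s ∈ (runStage φ A r none).support, ¬ Success φ r s) :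
    1 ≤ (runStage φ A r none).expect (stageValue φ r y 1 (if r < R then 1 else 0)) := by
  refine PMF.one_le_expect fun s hs => ?_
  unfold stageValue
  by_cases hsuc : Success φ r s
  · rw [if_pos hsuc]
    exact hy.resolve_right fun h => h s hs hsuc
  rw [if_neg hsuc]
  by_cases hb : s.bud = 0
  · have hlt : r < R := by
      refine lt_of_le_of_ne hR fun he => ?_
      rcases runStage_not_exhausted hr h (hT he) (by simp) hs with h1 | h1
      exacts [hsuc (Or.inl h1), h1 hb]
    simp [hlt]
  · rw [if_pos hb]

theorem isSolved_satisfiable {d : ℕ} {s : SatState v d} (h : IsSolved φ s) :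
    ∃ w, φ.Satisfies w := by
  rcases s with _ | ⟨l, w⟩
  · exact h.elim
  · exact ⟨w, φ.lastViolated_eq_none.1 h⟩

/-- Both forms of success exhibit a solved state, so the error is one-sided. -/
theorem not_success_of_unsatisfiable (hφ : ¬ ∃ w, φ.Satisfies w) {s : BState}
    (hs : s ∈ (runStage φ A r none).support) : ¬ Success φ r s := by
  have hn : ∀ {d : ℕ} (s : SatState v d), ¬ IsSolved φ s := fun s h => hφ (isSolved_satisfiable h)
  rintro (h | ⟨-, t, -, h⟩)
  · refine h (den_fnd_eq_zero (satSim φ r) (fun o μ => ?_) A (by rfl) hs)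
    cases o <;> simp only [satSim, hn, if_false] <;> (try split_ifs) <;> simp
  · exact hn _ h

theorem probAfter_le_one {Q : Type} (ans : Q → Mem → PMF Mem) (A : Cmd Q) (μ : Mem) (n : ℕ)
    (E : Set Mem) : probAfter ans A μ n E ≤ 1 := by
  unfold probAfter
  have := ENNReal.toReal_mono ENNReal.one_ne_top
    (toOuterMeasure_le_one (runFor ans n ([A], μ)) {c | c.2 ∈ E})
  simpa using this

theorem probAfter_nonneg {Q : Type} (ans : Q → Mem → PMF Mem) (A : Cmd Q) (μ : Mem) (n : ℕ)
    (E : Set Mem) : 0 ≤ probAfter ans A μ n E := ENNReal.toReal_nonneg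

open Classical in
/-- The algorithm is correct, if the budget of the stage with parameter `R` suffices. -/
theorem satProgram_correct {X Y R I : ℕ} {T : ℕ → ℕ} (hX : 3 ≤ X) (hA : A.Fits X Y)
    (hI : ∀ r, 8 ≤ r → r ≤ R → iterTime v r φ.length X Y A.overhead ≤ I) (hR : 8 ≤ R)
    (h : ∀ r, 8 ≤ r → SolvesStage φ A r (T ((v + 2) ^ r)))
    (hT : T ((v + 2) ^ R) < stageBudget (v + 2) R) :
    HaltsWithin noAns (satProgram A X) (satInput φ) (satTime v R I) ∧
    ((∃ w, φ.Satisfies w) →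
      1 - 1 / 8 ≤ probAfter noAns (satProgram A X) (satInput φ) (satTime v R I) saysYes) ∧
    ((¬ ∃ w, φ.Satisfies w) →
      probAfter noAns (satProgram A X) (satInput φ) (satTime v R I) saysNo = 1) := by
  have hT' : ∀ r, r = R → T ((v + 2) ^ r) < stageBudget (v + 2) r := by
    rintro r rfl
    exact hT
  refine ⟨haltsWithin_of_one_le noAns ?_, ?_, fun hφ => ?_⟩
  -- Halting is proved with the reward-free MDP, which is a legitimate instance (with parameter `0`)
  -- for every formula.
  · exact satProgram_le (y := 1) (z := 1) (E := fun _ _ => 1) hR hX hA none hI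
      (fun _ _ => le_rfl) (fun _ _ => le_rfl) (fun _ => le_rfl)
      fun r j hr hrR => one_le_stageValue hr hrR (h r hr) (hT' r) (Or.inl le_rfl)
  · rintro ⟨w, hw⟩
    -- The program is the same for every target, so for the analysis any satisfying assignment may
    -- serve as target.
    have key := satProgram_le (y := 1) (z := 0) (E := fun r j => 1 - errorBound r j)
      (f := fun μ => if μ ∈ saysYes then 1 else 0) hR hX hA (some w) hI
      (fun μ hμ => (if_pos (show μ ∈ saysYes from hμ)).ge) (fun _ _ => bot_le)
      (fun r => by simp [errorBound, tsub_eq_zero_of_le])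
      fun r j hr hrR => one_sub_errorBound_le hr hrR (h r hr) (hT' r) hw j
    have h8 : ENNReal.ofReal (1 - 1 / 8) ≤ 1 - errorBound 8 8 := by
      rw [ENNReal.ofReal_sub _ (by norm_num), ENNReal.ofReal_one]
      refine tsub_le_tsub_left (errorBound_le.trans (le_of_eq ?_)) 1
      rw [one_div, ENNReal.ofReal_inv_of_pos (by norm_num)]
      norm_num
    exact (ENNReal.ofReal_le_ofReal_iff (probAfter_nonneg _ _ _ _ _)).1
      (h8.trans (key.trans (haltVal_indicator_le noAns _ _ _ _)))
  -- Here success is worth nothing, and the bound `1` still holds because success is impossible.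
  · have key := satProgram_le (y := 0) (z := 1) (E := fun _ _ => 1)
      (f := fun μ => if μ ∈ saysNo then 1 else 0) hR hX hA none hI
      (fun _ _ => bot_le) (fun μ hμ => (if_pos (show μ ∈ saysNo from hμ)).ge)
      (fun _ => le_rfl)
      fun r j hr hrR => one_le_stageValue hr hrR (h r hr) (hT' r)
        (Or.inr fun s hs => not_success_of_unsatisfiable hφ hs)
    refine le_antisymm (probAfter_le_one _ _ _ _ _) ?_
    refine (ENNReal.ofReal_le_ofReal_iff (probAfter_nonneg _ _ _ _ _)).1 ?_
    rw [ENNReal.ofReal_one]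
    exact key.trans (haltVal_indicator_le noAns _ _ _ _)

end Values

/-! ### The running time -/

theorem levelStart_le {B : ℕ} (hB : 2 ≤ B) (r : ℕ) : levelStart B r ≤ B ^ r := by
  induction r with
  | zero => simp [levelStart]
  | succ r ih =>
    rw [levelStart_succ, pow_succ]
    nlinarith [Nat.one_le_pow r B (by omega)]

theorem featTime_le {v r G : ℕ} (hv : v + 2 ≤ G) (hd : (v + 2) ^ r ≤ G) :
    featTime v r ≤ 214 * G ^ 3 := by
  have hP : levelStart (v + 2) r ≤ G := (levelStart_le (by omega) r).trans hd
  calc featTime v r ≤ G * (G * (6 * (G + G) + 30) + 30) + 30 * G + 12 * G + 100 := by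
        unfold featTime
        gcongr
        · omega
        · omega
    _ = 12 * G ^ 3 + 30 * G ^ 2 + 72 * G + 100 := by ring
    _ ≤ 12 * G ^ 3 + 30 * G ^ 3 + 72 * G ^ 3 + 100 * G ^ 3 := by
        have h1 : 1 ≤ G ^ 3 := Nat.one_le_pow _ _ (by omega)
        have h2 : G ^ 2 ≤ G ^ 3 := Nat.pow_le_pow_right (by omega) (by norm_num)
        have h3 : G ≤ G ^ 3 := Nat.le_self_pow (by norm_num) _
        omega
    _ = 214 * G ^ 3 := by ring

/-- A unit of budget costs at most the order of `(len + 1) * G ^ 3` steps, mainly for the features;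
multiplying by the budget, at most `G`, gives the fourth power. -/
theorem iterTime_le {v r G : ℕ} (hv : v + 2 ≤ G) (hd : (v + 2) ^ r ≤ G)
    (hS : stageBudget (v + 2) r ≤ G) (len X Y ov : ℕ) :
    iterTime v r len X Y ov ≤ (2 * X + 2 * ov + 32 * Y + 2000) * ((len + 1) * G ^ 4) := by
  have hZ : stageBudget (v + 2) r + ((v + 2) ^ r + 1 + Y) ≤ 2 * G + 1 + Y := by omega
  have hG : 1 ≤ G := by omega
  obtain ⟨M, hM⟩ : ∃ M, M = (len + 1) * G ^ 3 := ⟨_, rfl⟩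
  have h3 : G ^ 3 ≤ M := hM ▸ Nat.le_mul_of_pos_left _ (by omega)
  have hl : len + 1 ≤ M := hM ▸ Nat.le_mul_of_pos_right _ (by positivity)
  have h1 : 1 ≤ M := by omega
  have hG3 : G ≤ M := (Nat.le_self_pow (by norm_num) _).trans h3
  have hY : Y ≤ Y * M := Nat.le_mul_of_pos_right _ h1
  have hX : X ≤ X * (M * G) := Nat.le_mul_of_pos_right _ (by positivity)
  have ho : ov ≤ ov * M := Nat.le_mul_of_pos_right _ h1
  have ho' : ov ≤ ov * (M * G) := Nat.le_mul_of_pos_right _ (by positivity)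
  have hMG : M ≤ M * G := Nat.le_mul_of_pos_right _ hG
  have hatom : stepTime v r len Y ov ≤ 16 * (Y * M) + ov * M + 1000 * M := by
    have := featTime_le hv hd
    unfold stepTime atomTime
    omega
  have hconc : concludeTime v r len (stageBudget (v + 2) r + ((v + 2) ^ r + 1 + Y))
      ≤ (32 * M + 16 * (Y * M) + 500 * M) * G := by
    calc _ ≤ G * (16 * (2 * G + 1 + Y) + 100 * len + 160) + 22 * G + 200 := by
          unfold concludeTime
          gcongr
          omega
      _ ≤ G * (16 * (2 * G + 1 + Y) + 100 * len + 160) + 22 * G + 200 * G := by omega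
      _ = (16 * (2 * G + 1 + Y) + 100 * len + 382) * G := by ring
      _ ≤ _ := Nat.mul_le_mul_right _ (by omega)
  calc iterTime v r len X Y ov
      ≤ 2 * X + ov + (16 * (Y * M) + ov * M + 1000 * M) * G
        + (32 * M + 16 * (Y * M) + 500 * M) * G + 20 := by
        unfold iterTime
        gcongr
    _ = 2 * X + ov + (32 * (Y * (M * G)) + ov * (M * G) + 1532 * (M * G)) + 20 := by ring
    _ ≤ 2 * (X * (M * G)) + 2 * (ov * (M * G)) + 32 * (Y * (M * G)) + 2000 * (M * G) := by omega
    _ = (2 * X + 2 * ov + 32 * Y + 2000) * ((len + 1) * G ^ 4) := by rw [hM]; ring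

theorem sum_range_le_sq (r : ℕ) : ∑ i ∈ Finset.range r, i ≤ r ^ 2 := by
  have := Finset.sum_range_id_mul_two r
  have h : r * (r - 1) ≤ r * r := Nat.mul_le_mul_left _ (Nat.sub_le _ _)
  rw [sq]
  omega

theorem iterTime_le_of_le {v r R : ℕ} (hr : 8 ≤ r) (hR : r ≤ R) (len X Y ov : ℕ) :
    iterTime v r len X Y ov
      ≤ (2 * X + 2 * ov + 32 * Y + 2000) * ((len + 1) * ((v + 2) ^ R ^ 2) ^ 4) := by
  have hpow : ∀ {n : ℕ}, n ≤ R ^ 2 → (v + 2) ^ n ≤ (v + 2) ^ R ^ 2 :=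
    fun h => Nat.pow_le_pow_right (by omega) h
  have hsq : r ^ 2 ≤ R ^ 2 := Nat.pow_le_pow_left hR 2
  have hr1 : r ≤ r ^ 2 := Nat.le_self_pow (by norm_num) r
  refine iterTime_le ?_ (hpow (by omega)) (hpow ((sum_range_le_sq r).trans hsq)) len X Y ov
  calc v + 2 = (v + 2) ^ 1 := (pow_one _).symm
    _ ≤ _ := hpow (by omega)

theorem satTime_le {v R : ℕ} (hR : 8 ≤ R) (C κ : ℕ) :
    satTime v R (κ * ((C * v + 1) * ((v + 2) ^ R ^ 2) ^ 4))
      ≤ (κ * (C + 1) + 1000) * (v + 2) ^ (6 * R ^ 2) := by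
  obtain ⟨G, hG⟩ : ∃ G, G = (v + 2) ^ R ^ 2 := ⟨_, rfl⟩
  have h8 : 8 ≤ R ^ 2 := hR.trans (Nat.le_self_pow (by norm_num) R)
  have hB8 : (v + 2) ^ 8 ≤ G := hG ▸ Nat.pow_le_pow_right (by omega) h8
  have hB : v + 2 ≤ G := (Nat.le_self_pow (by norm_num) _).trans hB8
  have hRG : 8 + (R - 8) * (R + 1) ≤ G := by
    obtain ⟨k, rfl⟩ : ∃ k, R = 8 + k := ⟨R - 8, by omega⟩
    have h1 : 8 + (8 + k - 8) * (8 + k + 1) ≤ (8 + k) ^ 2 := by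
      rw [Nat.add_sub_cancel_left]
      nlinarith
    refine h1.trans ((Nat.lt_two_pow_self).le.trans ?_)
    rw [hG]
    exact Nat.pow_le_pow_left (by omega) _
  have hG6 : G ≤ G ^ 6 := Nat.le_self_pow (by norm_num) _
  have hCv : C * v + 1 ≤ (C + 1) * G := by nlinarith
  rw [← hG]
  calc satTime v R (κ * ((C * v + 1) * G ^ 4))
      ≤ 48 * G + 48 * G + 530 * G + G * (κ * (((C + 1) * G) * G ^ 4)) := by
        unfold satTime
        gcongr
        omega
    _ = κ * (C + 1) * G ^ 6 + 626 * G := by ring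
    _ ≤ κ * (C + 1) * G ^ 6 + 1000 * G ^ 6 := by omega
    _ = (κ * (C + 1) + 1000) * (v + 2) ^ (6 * R ^ 2) := by
        rw [hG, ← pow_mul, mul_comm (R ^ 2) 6]; ring

/-! ### The choice of the last stage. -/

/-- If the parameter is large enough, then the budget of the stage suffices. -/
theorem lt_stageBudget_of_le {m q C₀ : ℝ} (hm : 0 ≤ m) (hq : 1 ≤ q) (hC₀ : 0 < C₀) {T : ℕ → ℕ}
    {D : ℕ} (hT : ∀ d, D ≤ d →
      (T d : ℝ) ≤ C₀ * (d : ℝ) ^ (q * Real.logb 2 (d : ℝ) ^ (m / (m + 2))))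
    {B R : ℕ} (hB : 2 ≤ B) (hR : 8 ≤ R)
    (hRc : (4 * q) ^ ((m + 2) / 2) * Real.logb 2 (B : ℝ) ^ (m / 2) ≤ R) (hD : D ≤ B ^ R)
    (hC : C₀ < (B : ℝ) ^ R) : T (B ^ R) < stageBudget B R := by
  have hB' : (2 : ℝ) ≤ B := by exact_mod_cast hB
  have hB0 : (0 : ℝ) < B := by linarith
  have hB1 : (1 : ℝ) < B := by linarith
  have hR' : (8 : ℝ) ≤ R := by exact_mod_cast hR
  have hR0 : (0 : ℝ) < R := by linarith
  have hm2 : 0 < m + 2 := by linarith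
  set l := Real.logb 2 (B : ℝ) with hl
  have hl1 : 1 ≤ l := by
    rw [hl, Real.le_logb_iff_rpow_le (by norm_num) hB0, Real.rpow_one]
    exact hB'
  have hl0 : 0 ≤ l := by linarith
  set e := m / (m + 2) with he
  -- At `d = B ^ R` the logarithm is `R * l`. Since `1 - m / (m + 2) = 2 / (m + 2)`, the claim
  -- amounts to `4 * q * l ^ e ≤ R ^ (2 / (m + 2))`, which is `hRc` raised to the power `2 / (m +
  -- 2)`.
  have key : 4 * q * (R * l) ^ e ≤ R := by
    have h1 : 4 * q * l ^ e ≤ (R : ℝ) ^ (2 / (m + 2)) := by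
      have h2 := Real.rpow_le_rpow (by positivity) hRc (by positivity : 0 ≤ 2 / (m + 2))
      refine le_trans (le_of_eq ?_) h2
      rw [Real.mul_rpow (by positivity) (by positivity), ← Real.rpow_mul (by positivity),
        ← Real.rpow_mul hl0]
      have e1 : (m + 2) / 2 * (2 / (m + 2)) = 1 := by field_simp
      have e2 : m / 2 * (2 / (m + 2)) = e := by rw [he]; field_simp
      rw [e1, e2, Real.rpow_one]
    have h3 : (R : ℝ) ^ (2 / (m + 2)) * (R : ℝ) ^ e = R := by
      rw [← Real.rpow_add hR0]
      have : 2 / (m + 2) + e = 1 := by rw [he]; field_simp; ring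
      rw [this, Real.rpow_one]
    rw [Real.mul_rpow hR0.le hl0]
    calc 4 * q * ((R : ℝ) ^ e * l ^ e) = 4 * q * l ^ e * (R : ℝ) ^ e := by ring
      _ ≤ (R : ℝ) ^ (2 / (m + 2)) * (R : ℝ) ^ e := by gcongr
      _ = R := h3
  have hsum : ((∑ i ∈ Finset.range R, i : ℕ) : ℝ) * 2 = R * (R - 1) := by
    have := Finset.sum_range_id_mul_two R
    rw [← Nat.cast_pred (by omega), ← Nat.cast_mul, ← this]
    push_cast
    ring
  have hlog : Real.logb 2 ((B ^ R : ℕ) : ℝ) = R * l := by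
    push_cast
    rw [Real.logb_pow]
  have hTd := hT (B ^ R) hD
  rw [hlog] at hTd
  have hexp : ((B ^ R : ℕ) : ℝ) ^ (q * (R * l) ^ e) ≤ (B : ℝ) ^ ((R : ℝ) * (R / 4)) := by
    push_cast
    rw [← Real.rpow_natCast (B : ℝ) R, ← Real.rpow_mul hB0.le]
    refine Real.rpow_le_rpow_of_exponent_le hB1.le ?_
    gcongr
    linarith
  have hfin : (T (B ^ R) : ℝ) < (stageBudget B R : ℕ) := by
    calc (T (B ^ R) : ℝ) ≤ C₀ * (B : ℝ) ^ ((R : ℝ) * (R / 4)) :=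
          hTd.trans (mul_le_mul_of_nonneg_left hexp hC₀.le)
      _ < (B : ℝ) ^ R * (B : ℝ) ^ ((R : ℝ) * (R / 4)) := by gcongr
      _ = (B : ℝ) ^ ((R : ℝ) + (R : ℝ) * (R / 4)) := by
        rw [Real.rpow_add hB0, Real.rpow_natCast]
      _ ≤ (B : ℝ) ^ ((∑ i ∈ Finset.range R, i : ℕ) : ℝ) := by
        refine Real.rpow_le_rpow_of_exponent_le hB1.le ?_
        -- `R + R ^ 2 / 4 ≤ R * (R - 1) / 2` holds because `R ≥ 8`.
        nlinarith
      _ = (stageBudget B R : ℕ) := by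
        rw [Real.rpow_natCast, stageBudget]
        push_cast
        rfl
  exact_mod_cast hfin

/-- The parameter of the last stage. -/
noncomputable def lastStage (m q : ℝ) (D v : ℕ) : ℕ :=
  ⌈(4 * q) ^ ((m + 2) / 2) * Real.logb 2 ((v + 2 : ℕ) : ℝ) ^ (m / 2)⌉₊ + 8
    -- For the finitely many small `v` this makes `(v + 2) ^ R ≥ D`, so that the asymptotic time
    -- bound applies; it does not affect the order of growth.
    + if v + 2 < D then D else 0

theorem eight_le_lastStage (m q : ℝ) (D v : ℕ) : 8 ≤ lastStage m q D v := by
  unfold lastStage; omega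

theorem le_pow_lastStage (m q : ℝ) (D v : ℕ) : D ≤ (v + 2) ^ lastStage m q D v := by
  by_cases h : v + 2 < D
  · have : D ≤ lastStage m q D v := by
      unfold lastStage
      rw [if_pos h]
      omega
    calc D ≤ 2 ^ D := Nat.lt_two_pow_self.le
      _ ≤ 2 ^ lastStage m q D v := Nat.pow_le_pow_right two_pos this
      _ ≤ _ := Nat.pow_le_pow_left (by omega) _
  · exact (not_lt.1 h).trans (Nat.le_self_pow (by have := eight_le_lastStage m q D v; omega) _)

/-- With `x = (4q)^((m+2)/2) (log (v+2))^(m/2) ≥ 1`, rounding up and adding `8` gives at most `10 *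
x`, whence `1200 = 12 * 10 ^ 2`. Moreover `log (v+2) ≤ 2 log v`, and `4 ^ (m+2) * 2 ^ m ≤ 16 ^
(m+2)` absorbs the powers. -/
theorem lastStage_sq_le {m q : ℝ} (hm : 0 ≤ m) (hq : 1 ≤ q) {D v : ℕ} (hv : 2 ≤ v) (hD : D ≤ v) :
    12 * (lastStage m q D v : ℝ) ^ 2
      ≤ 1200 * ((16 : ℝ) ^ (m + 2) * q ^ (m + 2)) * Real.logb 2 (v : ℝ) ^ m := by
  have hv' : (2 : ℝ) ≤ v := by exact_mod_cast hv
  have hv0 : (0 : ℝ) < v := by linarith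
  set l := Real.logb 2 ((v + 2 : ℕ) : ℝ) with hl
  set L := Real.logb 2 (v : ℝ) with hL
  have hL1 : 1 ≤ L := by
    rw [hL, Real.le_logb_iff_rpow_le (by norm_num) hv0, Real.rpow_one]
    exact hv'
  have hLl : L ≤ l := by
    refine Real.logb_le_logb_of_le (by norm_num) hv0 ?_
    push_cast
    linarith
  have hl2 : l ≤ 2 * L := by
    have : 2 * L = Real.logb 2 ((v : ℝ) ^ 2) := by rw [Real.logb_pow, ← hL]; norm_num
    rw [this]
    refine Real.logb_le_logb_of_le (by norm_num) (by positivity) ?_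
    push_cast
    nlinarith
  have hl1 : 1 ≤ l := hL1.trans hLl
  set c := (4 * q) ^ ((m + 2) / 2) with hc
  have hc1 : 1 ≤ c * l ^ (m / 2) := by
    refine one_le_mul_of_one_le_of_one_le ?_ ?_
    · exact Real.one_le_rpow (by linarith) (by linarith)
    · exact Real.one_le_rpow hl1 (by linarith)
  have hR : (lastStage m q D v : ℝ) ≤ 10 * (c * l ^ (m / 2)) := by
    unfold lastStage
    rw [if_neg (by omega)]
    push_cast
    have := (Nat.ceil_lt_add_one (by linarith : 0 ≤ c * l ^ (m / 2))).le
    rw [hl, Nat.cast_add, Nat.cast_ofNat] at this hc1 ⊢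
    linarith
  have hsq : (c * l ^ (m / 2)) ^ 2 = (4 * q) ^ (m + 2) * l ^ m := by
    rw [mul_pow, hc, ← Real.rpow_natCast, ← Real.rpow_natCast (l ^ (m / 2)), ← Real.rpow_mul
      (by linarith), ← Real.rpow_mul (by linarith)]
    congr 2 <;> push_cast <;> ring
  calc 12 * (lastStage m q D v : ℝ) ^ 2 ≤ 12 * (10 * (c * l ^ (m / 2))) ^ 2 := by gcongr
    _ = 1200 * ((4 * q) ^ (m + 2) * l ^ m) := by rw [← hsq]; ring
    _ ≤ 1200 * ((4 * q) ^ (m + 2) * (2 * L) ^ m) := by gcongr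
    _ = 1200 * ((4 : ℝ) ^ (m + 2) * 2 ^ m * q ^ (m + 2)) * L ^ m := by
        rw [Real.mul_rpow (by norm_num) (by linarith), Real.mul_rpow (by norm_num) (by linarith)]
        ring
    _ ≤ 1200 * ((16 : ℝ) ^ (m + 2) * q ^ (m + 2)) * L ^ m := by
        gcongr
        calc (4 : ℝ) ^ (m + 2) * 2 ^ m ≤ 4 ^ (m + 2) * 4 ^ (m + 2) := by
              gcongr
              calc (2 : ℝ) ^ m ≤ 4 ^ m := Real.rpow_le_rpow (by norm_num) (by norm_num) hm
                _ ≤ 4 ^ (m + 2) := Real.rpow_le_rpow_of_exponent_le (by norm_num) (by linarith)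
          _ = 16 ^ (m + 2) := by
              rw [← Real.mul_rpow (by norm_num) (by norm_num)]; norm_num

theorem isBigO_satTime {m q : ℝ} (hm : 0 ≤ m) (hq : 1 ≤ q) (D C κ : ℕ) :
    (fun v : ℕ => (satTime v (lastStage m q D v)
        (κ * ((C * v + 1) * ((v + 2) ^ lastStage m q D v ^ 2) ^ 4)) : ℝ))
      =O[atTop] fun v => (v : ℝ) ^
        (1200 * ((16 : ℝ) ^ (m + 2) * q ^ (m + 2)) * Real.logb 2 (v : ℝ) ^ m) := by
  refine IsBigO.of_bound (κ * (C + 1) + 1000 : ℕ) ?_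
  filter_upwards [eventually_ge_atTop (max 2 D)] with v hv
  have hv2 : 2 ≤ v := (le_max_left _ _).trans hv
  have hv' : (2 : ℝ) ≤ v := by exact_mod_cast hv2
  rw [Real.norm_of_nonneg (Nat.cast_nonneg _), Real.norm_of_nonneg (Real.rpow_nonneg (by linarith) _)]
  set R := lastStage m q D v with hR
  have h1 := satTime_le (v := v) (eight_le_lastStage m q D v) C κ
  have h2 : (v + 2) ^ (6 * R ^ 2) ≤ v ^ (12 * R ^ 2) := by
    -- Passing from base `v + 2` to base `v` doubles the exponent, by `v + 2 ≤ v ^ 2`.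
    rw [show 12 * R ^ 2 = 2 * (6 * R ^ 2) by ring, pow_mul v 2]
    exact Nat.pow_le_pow_left (by nlinarith) _
  have h3 : ((v ^ (12 * R ^ 2) : ℕ) : ℝ) ≤ (v : ℝ) ^
      (1200 * ((16 : ℝ) ^ (m + 2) * q ^ (m + 2)) * Real.logb 2 (v : ℝ) ^ m) := by
    rw [Nat.cast_pow, ← Real.rpow_natCast]
    refine Real.rpow_le_rpow_of_exponent_le (by linarith) ?_
    push_cast
    exact lastStage_sq_le hm hq hv2 ((le_max_right _ _).trans hv)
  calc _ ≤ (((κ * (C + 1) + 1000) * v ^ (12 * R ^ 2) : ℕ) : ℝ) := by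
        exact_mod_cast h1.trans (Nat.mul_le_mul_left _ h2)
    _ ≤ _ := by
        rw [Nat.cast_mul]
        gcongr

/-! ### Proof of the main theorem. -/

theorem mainTheorem7 :
    ∃ A : ℝ, 0 < A ∧
      ∀ (m q : ℝ), 0 ≤ m → 1 ≤ q →
      ∀ (K b : ℕ), 1 ≤ K → 1 ≤ b →
        LinearRLSolvable 3 K b
          (fun d => (d : ℝ) ^ (q * Real.logb 2 (d : ℝ) ^ (m / (m + 2)))) (1 / 10) →
        UniqueThreeSATSolvable
          (fun v => (v : ℝ) ^
            (A * ((16 : ℝ) ^ (m + 2) * q ^ (m + 2)) * Real.logb 2 (v : ℝ) ^ m)) (1 / 8) := by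
  refine ⟨1200, by norm_num, fun m q hm hq K b hK hb => ?_⟩
  rintro ⟨A, T, hT, hA⟩
  obtain ⟨X, hX, Y, hfits⟩ := A.exists_fits
  obtain ⟨C₀, hC₀, hbound⟩ := hT.exists_pos
  obtain ⟨d₀, hd₀⟩ := eventually_atTop.1 hbound.bound
  -- Beyond `D` the time bound holds, and `D > C₀`, so a single factor `(v + 2) ^ R ≥ D` absorbs the
  -- implied constant.
  set D := max d₀ (⌈C₀⌉₊ + 1) with hD
  have hTd : ∀ d, D ≤ d →
      (T d : ℝ) ≤ C₀ * (d : ℝ) ^ (q * Real.logb 2 (d : ℝ) ^ (m / (m + 2))) := by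
    intro d hd
    have := hd₀ d ((le_max_left _ _).trans hd)
    rwa [Real.norm_of_nonneg (Nat.cast_nonneg _),
      Real.norm_of_nonneg (Real.rpow_nonneg (Nat.cast_nonneg _) _)] at this
  refine ⟨satProgram A X, fun C => ⟨_, isBigO_satTime hm hq D C
    (2 * X + 2 * A.overhead + 32 * Y + 2000), fun v φ hlen _ => ?_⟩⟩
  have hDR := le_pow_lastStage m q D v
  refine satProgram_correct (T := T) hX hfits (fun r hr hR => ?_) (eight_le_lastStage m q D v)
    (fun r hr target ht => hA _ _ (satMDP_linear φ r target ht)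
      (satMDP_sizeBounded φ target hr hK hb)) ?_
  · refine (iterTime_le_of_le hr hR _ _ _ _).trans ?_
    gcongr
  · refine lt_stageBudget_of_le hm hq hC₀ hTd (by omega) (eight_le_lastStage m q D v) ?_ hDR ?_
    · refine (Nat.le_ceil _).trans ?_
      unfold lastStage
      exact_mod_cast (Nat.le_add_right _ _).trans (Nat.le_add_right _ _)
    · calc C₀ ≤ ⌈C₀⌉₊ := Nat.le_ceil _
        _ < (D : ℝ) := by exact_mod_cast (Nat.lt_succ_self _).trans_le (le_max_right _ _)
        _ ≤ _ := by exact_mod_cast hDR
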